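/- Let $d\ge 1$ and let $\Omega\subset\mathbb R^d$ be a connected bounded open set. Let $F\colon H^1_0(\Omega)\to[0,+\infty)$ be lower semicontinuous in the weak topology of $H^1_0(\Omega)$, and let $\mu$ and $\nu$ be bounded positive Radon measures on $\Omega\times\Omega$ and $\Omega$, respectively, such that - for every $u\in C^\infty_c(\Omega)$ $$F(u)=\int_{\Omega\times\Omega}|u(x)-u(y)|^2\,d\mu(x,y)+\int_\Omega|u(x)|^2\,d\nu(x)+\int_\Omega|\nabla u(x)|^2\,dx;$$ - $\mu(A\times B)=\mu(B\times A)$ for all Borel sets $A,B\subset\Omega$; - $\mu(\{(x,x):x\in\Omega\})=0$. Suppose also that there is $M>0$ such that $F(u)\le M\,(\operatorname{osc}_\Omega u)^2+\int_\Omega|\nabla u|^2\,dx$ for every $u\in C^\infty_c(\Omega)$, where $\operatorname{osc}_\Omega u=\operatorname{ess\,sup}_\Omega u-\operatorname{ess\,inf}_\Omega u$. For $A\subset\Omega$ let the capacity of $A$ be the infimum of $\int_\Omega|\nabla u|^2\,dx$ over all $u\in H^1_0(\Omega)$ with $u\ge1$ a.e. in an open neighbourhood of $A$. For $u\in H^1_0(\Omega)$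 let $\widetilde u$ be its precise representative: $\widetilde u(x)$ is the limit as $r\to0^+$ of the averages of $u$ over the balls of radius $r$ centred at $x$ where this limit exists, and $0$ otherwise; $\widetilde u$ may be changed arbitrarily on a set of zero capacity. Then: (a) if $B\subset\Omega$ is a Borel set with zero capacity, then $\mu(B\times\Omega)=\nu(B)=0$. Suppose, in addition, that $F$ is a quadratic form on $H^1_0(\Omega)\cap L^\infty(\Omega)$; that is, there is a bilinear form $\mathcal B$ on this space with $F(u)=\mathcal B(u,u)$ for all $u\in H^1_0(\Omega)\cap L^\infty(\Omega)$. Then: (b) for every $u\in H^1_0(\Omega)\cap L^\infty(\Omega)$ $$F(u)=\int_{\Omega\times\Omega}|\widetilde u(x)-\widetilde u(y)|^2\,d\mu(x,y)+\int_\Omega|\widetilde u(x)|^2\,d\nu(x)+\int_\Omega|\nabla u(x)|^2\,dx;\qquad(*)$$ (c) if moreover $F(\Psi_m(u))\le F(u)$ for all $u\in H^1_0(\Omega)$ and $m\in\mathbb N$, where $\Psi_m(t)=\max\{\min\{m,t\},-m\}$, then $(*)$ holds for every $u\in H^1_0(\Omega)$. -/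

import Mathlib

open MeasureTheory TopologicalSpace Filter Topology
open scoped ENNReal NNReal Distributions Gradient

noncomputable section

namespace NonlocalForms

/-- `d`-dimensional Euclidean space. -/
abbrev Euc (d : ℕ) : Type := EuclideanSpace ℝ (Fin d)

variable {d : ℕ}

/-- Lebesgue measure on `Ω`. -/
abbrev leb (Ω : Opens (Euc d)) : Measure (Euc d) := volume.restrict (Ω : Set (Euc d))

/-- The Hilbert space `L²(Ω) × L²(Ω; ℝᵈ)`, with the norm
`(‖u‖²_{L²} + ‖g‖²_{L²})^{1/2}`. -/
abbrev L2Pair (Ω : Opens (Euc d)) : Type :=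
  WithLp 2 (Lp ℝ 2 (leb Ω) × Lp (Euc d) 2 (leb Ω))

theorem testFunction_memLp {Ω : Opens (Euc d)} (φ : 𝓓(Ω, ℝ)) : MemLp φ 2 (leb Ω) :=
  (φ.continuous.memLp_of_hasCompactSupport φ.hasCompactSupport).restrict _

theorem testFunction_differentiable {Ω : Opens (Euc d)} (φ : 𝓓(Ω, ℝ)) :
    Differentiable ℝ (φ : Euc d → ℝ) :=
  φ.contDiff.differentiable (by simp)

theorem testFunction_gradient_memLp {Ω : Opens (Euc d)} (φ : 𝓓(Ω, ℝ)) :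
    MemLp (∇ (φ : Euc d → ℝ)) 2 (leb Ω) := by
  have hc : Continuous (∇ (φ : Euc d → ℝ)) :=
    (InnerProductSpace.toDual ℝ (Euc d)).symm.continuous.comp
      (φ.contDiff.continuous_fderiv (by simp))
  have hs : HasCompactSupport (∇ (φ : Euc d → ℝ)) :=
    (φ.hasCompactSupport.fderiv ℝ).comp_left
      (g := (InnerProductSpace.toDual ℝ (Euc d)).symm) (map_zero _)
  exact (hc.memLp_of_hasCompactSupport hs).restrict _

/-- The map `φ ↦ (φ, ∇φ)` from `C_c^∞(Ω)` to `L²(Ω) × L²(Ω; ℝᵈ)`. -/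
def testGraph (Ω : Opens (Euc d)) : 𝓓(Ω, ℝ) →ₗ[ℝ] L2Pair Ω where
  toFun φ := WithLp.toLp 2
    ((testFunction_memLp φ).toLp φ, (testFunction_gradient_memLp φ).toLp (∇ (φ : Euc d → ℝ)))
  map_add' φ ψ := by
    have h : ∇ ((φ + ψ : 𝓓(Ω, ℝ)) : Euc d → ℝ)
        = ∇ (φ : Euc d → ℝ) + ∇ (ψ : Euc d → ℝ) := by
      funext x
      have e : ((φ + ψ : 𝓓(Ω, ℝ)) : Euc d → ℝ) = (φ : Euc d → ℝ) + (ψ : Euc d → ℝ) := rfl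
      simp only [gradient, Pi.add_apply, e]
      rw [fderiv_add (testFunction_differentiable φ x) (testFunction_differentiable ψ x), map_add]
    refine WithLp.ofLp_injective 2 (Prod.ext ?_ ?_)
    · exact MemLp.toLp_add (testFunction_memLp φ) (testFunction_memLp ψ)
    · refine Eq.trans ?_
        (MemLp.toLp_add (testFunction_gradient_memLp φ) (testFunction_gradient_memLp ψ))
      exact MemLp.toLp_congr (testFunction_gradient_memLp (φ + ψ)) _
        (Eventually.of_forall fun x => congrFun h x)
  map_smul' c φ := by
    have h : ∇ ((c • φ : 𝓓(Ω, ℝ)) : Euc d → ℝ) = c • ∇ (φ : Euc d → ℝ) := by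
      funext x
      have e : ((c • φ : 𝓓(Ω, ℝ)) : Euc d → ℝ) = c • (φ : Euc d → ℝ) := rfl
      simp only [gradient, Pi.smul_apply, e]
      rw [fderiv_const_smul (testFunction_differentiable φ x)]
      simp
    refine WithLp.ofLp_injective 2 (Prod.ext ?_ ?_)
    · exact MemLp.toLp_const_smul c (testFunction_memLp φ)
    · refine Eq.trans ?_ (MemLp.toLp_const_smul c (testFunction_gradient_memLp φ))
      exact MemLp.toLp_congr (testFunction_gradient_memLp (c • φ)) _
        (Eventually.of_forall fun x => congrFun h x)

/-- `H¹₀(Ω)`, the closure of `C_c^∞(Ω)` in the `H¹` norm. A function `u` in it is stored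
together with its weak gradient, that is, as the pair `(u, ∇u)`: the elements are the `L²` limits
of pairs `(φ, ∇φ)` with `φ ∈ C_c^∞(Ω)`. -/
def sobolevH10 (Ω : Opens (Euc d)) : Submodule ℝ (L2Pair Ω) :=
  (LinearMap.range (testGraph Ω)).topologicalClosure

/-- `H¹₀(Ω)` as a Hilbert space. -/
abbrev H10 (Ω : Opens (Euc d)) : Type := ↥(sobolevH10 Ω)

/-- A representative, defined a.e. in `Ω`, of the function `u ∈ H¹₀(Ω)`. -/
def H10.fn {Ω : Opens (Euc d)} (u : H10 Ω) : Euc d → ℝ := (u : L2Pair Ω).fst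

/-- A representative, defined a.e. in `Ω`, of the weak gradient of `u ∈ H¹₀(Ω)`. -/
def H10.grad {Ω : Opens (Euc d)} (u : H10 Ω) : Euc d → Euc d := (u : L2Pair Ω).snd

/-- A test function as an element of `H¹₀(Ω)`. -/
def H10.ofTest {Ω : Opens (Euc d)} (φ : 𝓓(Ω, ℝ)) : H10 Ω :=
  ⟨testGraph Ω φ, Submodule.le_topologicalClosure _ (LinearMap.mem_range_self _ φ)⟩

/-- The Dirichlet integral `∫_Ω |∇u|² dx`. -/
def dirichlet {Ω : Opens (Euc d)} (u : H10 Ω) : ℝ≥0∞ :=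
  ∫⁻ x in (Ω : Set (Euc d)), ‖u.grad x‖ₑ ^ 2

/-- The (harmonic, relative to `Ω`) capacity of `A ⊆ Ω`: the infimum of `∫_Ω |∇u|² dx` over the
`u ∈ H¹₀(Ω)` with `u ≥ 1` a.e. in an open neighbourhood of `A`. -/
def capacity (Ω : Opens (Euc d)) (A : Set (Euc d)) : ℝ≥0∞ :=
  ⨅ (u : H10 Ω) (_ : ∃ U : Set (Euc d), IsOpen U ∧ A ⊆ U ∧
    ∀ᵐ x ∂(volume.restrict (U ∩ Ω)), 1 ≤ u.fn x), dirichlet u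

open Classical in
/-- The precise representative `ũ` of `u`: the limit, as `r → 0`, of the averages of `u` over the
balls of radius `r` centred at `x` where this limit exists, and `0` elsewhere. -/
def preciseRep {Ω : Opens (Euc d)} (u : H10 Ω) (x : Euc d) : ℝ :=
  if h : ∃ l : ℝ, Tendsto (fun r : ℝ => ⨍ y in Metric.ball x r ∩ Ω, u.fn y) (𝓝[>] 0) (𝓝 l)
  then h.choose else 0

/-- `v = w` quasi-everywhere in `Ω`, that is, outside a set of zero capacity. -/
def QuasiEq (Ω : Opens (Euc d)) (v w : Euc d → ℝ) : Prop :=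
  capacity Ω {x | x ∈ Ω ∧ v x ≠ w x} = 0

/-- The oscillation `ess sup_Ω v - ess inf_Ω v` (used for bounded functions `v`). -/
def osc (Ω : Opens (Euc d)) (v : Euc d → ℝ) : ℝ :=
  essSup v (leb Ω) - essInf v (leb Ω)

/-- `∫_{Ω×Ω} |v(x) - v(y)|² dμ(x,y) + ∫_Ω |v(x)|² dν(x) + ∫_Ω |∇u(x)|² dx`,
where `v` is a pointwise defined representative of `u`. -/
def formValue {Ω : Opens (Euc d)} (μ : Measure (Ω × Ω)) (ν : Measure Ω)
    (v : Euc d → ℝ) (u : H10 Ω) : ℝ≥0∞ :=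
  (∫⁻ p : Ω × Ω, ‖v p.1 - v p.2‖ₑ ^ 2 ∂μ) + (∫⁻ x : Ω, ‖v x‖ₑ ^ 2 ∂ν) + dirichlet u

/-- `H¹₀(Ω) ∩ L^∞(Ω)` as a linear subspace of `H¹₀(Ω)`. -/
def H10Bdd (Ω : Opens (Euc d)) : Submodule ℝ (H10 Ω) where
  carrier := {u | MemLp u.fn ∞ (leb Ω)}
  add_mem' {u v} hu hv :=
    (memLp_congr_ae (Lp.coeFn_add (u : L2Pair Ω).fst (v : L2Pair Ω).fst)).2 (hu.add hv)
  zero_mem' := (memLp_congr_ae (Lp.coeFn_zero ℝ 2 (leb Ω))).2 MemLp.zero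
  smul_mem' c u hu :=
    (memLp_congr_ae (Lp.coeFn_smul c (u : L2Pair Ω).fst)).2 (hu.const_smul c)

/-- `F` is lower semicontinuous in the weak topology of `H¹₀(Ω)`. -/
def WeaklyLSC {Ω : Opens (Euc d)} (F : H10 Ω → ℝ≥0) : Prop :=
  LowerSemicontinuous fun u : WeakSpace ℝ (H10 Ω) => F ((toWeakSpace ℝ (H10 Ω)).symm u)

/-- `F` is a quadratic form on `H¹₀(Ω) ∩ L^∞(Ω)`. -/
def IsQuadraticOnBdd {Ω : Opens (Euc d)} (F : H10 Ω → ℝ≥0) : Prop :=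
  ∃ B : LinearMap.BilinForm ℝ (H10Bdd Ω), ∀ u : H10Bdd Ω, (F (u : H10 Ω) : ℝ) = B u u

/-- `F(Ψ_m(u)) ≤ F(u)` for all `u ∈ H¹₀(Ω)` and `m ∈ ℕ`, with `Ψ_m(t) = (m ∧ t) ∨ (-m)`;
`w` is the element `Ψ_m(u)` of `H¹₀(Ω)`. -/
def DecreasesUnderTruncation {Ω : Opens (Euc d)} (F : H10 Ω → ℝ≥0) : Prop :=
  ∀ (u w : H10 Ω) (m : ℕ),
    (∀ᵐ x ∂(leb Ω), w.fn x = max (min (m : ℝ) (u.fn x)) (-(m : ℝ))) → F w ≤ F u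

end NonlocalForms

end

noncomputable section

open scoped ContDiff

namespace NonlocalForms

variable {d : ℕ}

/-! Weak lower semicontinuity implies strong lower semicontinuity of `F`, and only the latter is
used. Everything rests on the finite measure `mass μ ν`, the sum of `ν` and both marginals of `μ`,
being absolutely continuous with respect to capacity in a quantitative sense.

Let `g n` be uniformly bounded test functions tending to `0` in `H10 Ω`. Lower semicontinuity of `F`
along `φ + t • g n`, with `t` small of either sign, forces the cross term `cform μ ν φ (g n)` to
vanish in the limit (`IsRepresented.tendsto_cform`). The carré du champ identity `cform_mul_sub`
converts this into the convergence to `0` of the integrals of `(φ x - φ y)² (w n x + w n y)` against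
`μ` and of `φ² w n` against `ν`, for test functions `0 ≤ w n ≤ 1` tending to `0`. With localized
coordinates as `φ`, and since `μ` does not charge the diagonal, the integrals of `w n` against `mass
μ ν` tend to `0`. Hence an open set on which some `z` of small energy is at least `1` has small mass
(`IsRepresented.exists_mass_open_le`), and (a) follows.

For (b), `u` gets a pointwise representative determined up to `mass`-null sets: a limit in measure
of test functions approximating `u` (`QuasiRep`). The precise representative is one. The required
maximal inequality for ball means comes from least-energy superharmonic majorants, whose ball means
increase as the radius shrinks. Bounded `u` is approximated by uniformly bounded test functions, so
lower semicontinuity and dominated convergence give `F u ≤ formValue`. The parallelogram law applied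
to `u` and `φ n - u` gives the reverse inequality.

For (c), truncations of `u` are bounded. Monotone convergence of the integrals, lower
semicontinuity, and decrease under truncation pass (b) to the limit. -/

/-! ### Cutoffs and calculus of test functions. -/

theorem exists_cutoff {K U : Set (Euc d)} (hK : IsCompact K) (hU : IsOpen U) (hKU : K ⊆ U) :
    ∃ η : Euc d → ℝ, ContDiff ℝ ∞ η ∧ HasCompactSupport η ∧ tsupport η ⊆ U ∧
      (∀ x ∈ K, η x = 1) ∧ ∀ x, 0 ≤ η x ∧ η x ≤ 1 := by
  obtain ⟨L, hL, hKL, hLU⟩ := exists_compact_between hK hU hKU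
  obtain ⟨f, hf1, hf0, hf⟩ := exists_contMDiffMap_one_nhds_of_subset_interior (n := ⊤)
    (modelWithCornersSelf ℝ (Euc d)) hK.isClosed hKL
  have hsup : tsupport f ⊆ L := closure_minimal
    (fun x hx => by_contra fun h => hx (hf0 x h)) hL.isClosed
  exact ⟨f, f.contMDiff.contDiff, hL.of_isClosed_subset (isClosed_tsupport _) hsup,
    hsup.trans hLU, fun x hx => (hf1.self_of_nhdsSet x hx), fun x => hf x⟩

/-- A test function from an unbundled smooth function. -/
def mkTest {Ω : Opens (Euc d)} (f : Euc d → ℝ) (h : ContDiff ℝ ∞ f) (hc : HasCompactSupport f)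
    (hs : tsupport f ⊆ Ω) : 𝓓(Ω, ℝ) := ⟨f, h, hc, hs⟩

@[simp] theorem mkTest_apply {Ω : Opens (Euc d)} (f : Euc d → ℝ) (h : ContDiff ℝ ∞ f)
    (hc : HasCompactSupport f) (hs : tsupport f ⊆ Ω) (x : Euc d) : mkTest f h hc hs x = f x := rfl

theorem test_eq_zero {Ω : Opens (Euc d)} (φ : 𝓓(Ω, ℝ)) {x : Euc d} (hx : x ∉ Ω) : φ x = 0 :=
  image_eq_zero_of_notMem_tsupport fun h => hx (φ.tsupport_subset h)

theorem test_contDiff {Ω : Opens (Euc d)} (φ : 𝓓(Ω, ℝ)) : ContDiff ℝ ∞ (φ : Euc d → ℝ) :=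
  φ.contDiff

/-- The product of a smooth function and a test function. -/
def mulTest {Ω : Opens (Euc d)} (f : Euc d → ℝ) (h : ContDiff ℝ ∞ f) (φ : 𝓓(Ω, ℝ)) : 𝓓(Ω, ℝ) :=
  mkTest (fun x => f x * φ x) (h.mul (test_contDiff φ)) (φ.hasCompactSupport.mul_left)
    ((tsupport_mul_subset_right).trans φ.tsupport_subset)

/-- The composition of a smooth function vanishing at `0` with a test function. -/
def compTest {Ω : Opens (Euc d)} (T : ℝ → ℝ) (h : ContDiff ℝ ∞ T) (h0 : T 0 = 0) (φ : 𝓓(Ω, ℝ)) :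
    𝓓(Ω, ℝ) :=
  mkTest (fun x => T (φ x)) (h.comp (test_contDiff φ)) (φ.hasCompactSupport.comp_left h0)
    ((closure_mono (Function.support_comp_subset h0 φ)).trans φ.tsupport_subset)

theorem gradient_eq_of_hasFDerivAt_inner {f : Euc d → ℝ} {x g : Euc d}
    (h : HasFDerivAt f (innerSL ℝ g) x) : ∇ f x = g := by
  refine HasGradientAt.gradient ?_
  rw [hasGradientAt_iff_hasFDerivAt]
  exact h

theorem gradient_mul {f g : Euc d → ℝ} {x : Euc d} (hf : DifferentiableAt ℝ f x)
    (hg : DifferentiableAt ℝ g x) :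
    ∇ (fun y => f y * g y) x = f x • ∇ g x + g x • ∇ f x := by
  have : fderiv ℝ (fun y => f y * g y) x = f x • fderiv ℝ g x + g x • fderiv ℝ f x :=
    fderiv_fun_mul hf hg
  simp only [gradient, this, map_add, map_smulₛₗ]
  simp

theorem gradient_comp {T : ℝ → ℝ} {f : Euc d → ℝ} {x : Euc d} (hT : DifferentiableAt ℝ T (f x))
    (hf : DifferentiableAt ℝ f x) : ∇ (fun y => T (f y)) x = deriv T (f x) • ∇ f x := by
  have : fderiv ℝ (fun y => T (f y)) x = deriv T (f x) • fderiv ℝ f x :=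
    (hT.hasDerivAt.comp_hasFDerivAt x hf.hasFDerivAt).fderiv
  simp only [gradient, this, map_smulₛₗ]
  simp

theorem continuous_gradient {f : Euc d → ℝ} (hf : ContDiff ℝ ∞ f) : Continuous (∇ f) :=
  (InnerProductSpace.toDual ℝ (Euc d)).symm.continuous.comp (hf.continuous_fderiv (by simp))

/-! ### The Hilbert space `H10 Ω`: components, density of test functions, energy. -/

namespace H10

variable {Ω : Opens (Euc d)}

instance : CompleteSpace (H10 Ω) :=
  (Submodule.isClosed_topologicalClosure (LinearMap.range (testGraph Ω))).completeSpace_coe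

/-- The class of `u` in `L²(Ω)`. -/
def fnL : H10 Ω →L[ℝ] Lp ℝ 2 (leb Ω) :=
  (WithLp.fstL 2 ℝ (Lp ℝ 2 (leb Ω)) (Lp (Euc d) 2 (leb Ω))).comp (sobolevH10 Ω).subtypeL

/-- The gradient of `u` as an element of `L²(Ω; ℝᵈ)`. -/
def gradL : H10 Ω →L[ℝ] Lp (Euc d) 2 (leb Ω) :=
  (WithLp.sndL 2 ℝ (Lp ℝ 2 (leb Ω)) (Lp (Euc d) 2 (leb Ω))).comp (sobolevH10 Ω).subtypeL

theorem coe_fnL (u : H10 Ω) : (fnL u : Euc d → ℝ) = u.fn := rfl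

theorem coe_gradL (u : H10 Ω) : (gradL u : Euc d → Euc d) = u.grad := rfl

theorem fn_memLp (u : H10 Ω) : MemLp u.fn 2 (leb Ω) := Lp.memLp (fnL u)

theorem grad_memLp (u : H10 Ω) : MemLp u.grad 2 (leb Ω) := Lp.memLp (gradL u)

theorem fn_add (u v : H10 Ω) : (u + v).fn =ᵐ[leb Ω] u.fn + v.fn := by
  rw [← coe_fnL, map_add]; exact Lp.coeFn_add _ _

theorem fn_sub (u v : H10 Ω) : (u - v).fn =ᵐ[leb Ω] u.fn - v.fn := by
  rw [← coe_fnL, map_sub]; exact Lp.coeFn_sub _ _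

theorem fn_smul (c : ℝ) (u : H10 Ω) : (c • u).fn =ᵐ[leb Ω] c • u.fn := by
  rw [← coe_fnL, map_smul]; exact Lp.coeFn_smul _ _

theorem ofTest_fn (φ : 𝓓(Ω, ℝ)) : (ofTest φ).fn =ᵐ[leb Ω] φ :=
  MemLp.coeFn_toLp (testFunction_memLp φ)

theorem ofTest_grad (φ : 𝓓(Ω, ℝ)) : (ofTest φ).grad =ᵐ[leb Ω] ∇ (φ : Euc d → ℝ) :=
  MemLp.coeFn_toLp (testFunction_gradient_memLp φ)

theorem ofTest_add (φ ψ : 𝓓(Ω, ℝ)) : ofTest (φ + ψ) = ofTest φ + ofTest ψ :=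
  Subtype.ext (map_add (testGraph Ω) φ ψ)

theorem ofTest_sub (φ ψ : 𝓓(Ω, ℝ)) : ofTest (φ - ψ) = ofTest φ - ofTest ψ :=
  Subtype.ext (map_sub (testGraph Ω) φ ψ)

theorem ofTest_smul (c : ℝ) (φ : 𝓓(Ω, ℝ)) : ofTest (c • φ) = c • ofTest φ :=
  Subtype.ext (map_smul (testGraph Ω) c φ)

theorem norm_sq (u : H10 Ω) : ‖u‖ ^ 2 = ‖fnL u‖ ^ 2 + ‖gradL u‖ ^ 2 :=
  WithLp.prod_norm_sq_eq_of_L2 (u : L2Pair Ω)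

theorem norm_gradL_le (u : H10 Ω) : ‖gradL u‖ ≤ ‖u‖ := by
  have := norm_sq u
  exact (sq_le_sq₀ (norm_nonneg _) (norm_nonneg _)).1 (by nlinarith [sq_nonneg ‖fnL u‖])

theorem norm_le (u : H10 Ω) : ‖u‖ ≤ ‖fnL u‖ + ‖gradL u‖ := by
  have := norm_sq u
  refine (sq_le_sq₀ (norm_nonneg _) (by positivity)).1 ?_
  nlinarith [norm_nonneg (fnL u), norm_nonneg (gradL u),
    mul_nonneg (norm_nonneg (fnL u)) (norm_nonneg (gradL u))]

theorem denseRange_ofTest : DenseRange (ofTest : 𝓓(Ω, ℝ) → H10 Ω) := by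
  intro u
  rw [closure_subtype]
  have h : (Subtype.val '' Set.range (ofTest : 𝓓(Ω, ℝ) → H10 Ω))
      = (LinearMap.range (testGraph Ω) : Set (L2Pair Ω)) := by
    ext x
    constructor
    · rintro ⟨_, ⟨φ, rfl⟩, rfl⟩
      exact ⟨φ, rfl⟩
    · rintro ⟨φ, rfl⟩
      exact ⟨_, ⟨φ, rfl⟩, rfl⟩
  rw [h]
  exact u.2

theorem exists_ofTest_near (u : H10 Ω) {ε : ℝ} (hε : 0 < ε) : ∃ φ : 𝓓(Ω, ℝ), ‖ofTest φ - u‖ < ε := by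
  obtain ⟨φ, hφ⟩ := denseRange_ofTest.exists_dist_lt u hε
  exact ⟨φ, by rwa [dist_comm, dist_eq_norm] at hφ⟩

theorem exists_seq_ofTest (u : H10 Ω) :
    ∃ φ : ℕ → 𝓓(Ω, ℝ), Tendsto (fun n => ofTest (φ n)) atTop (𝓝 u) := by
  choose φ hφ using fun n : ℕ => exists_ofTest_near u (ε := 1 / ((n : ℝ) + 1)) (by positivity)
  refine ⟨φ, tendsto_iff_norm_sub_tendsto_zero.2 ?_⟩
  exact squeeze_zero (fun _ => norm_nonneg _) (fun n => (hφ n).le)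
    tendsto_one_div_add_atTop_nhds_zero_nat

theorem dirichlet_eq (u : H10 Ω) : dirichlet u = ENNReal.ofReal (‖gradL u‖ ^ 2) := by
  have h : ‖gradL u‖ₑ ^ 2 = dirichlet u := by
    rw [Lp.enorm_def, eLpNorm_eq_lintegral_rpow_enorm_toReal (by simp) (by simp)]
    simp only [ENNReal.toReal_ofNat, dirichlet, coe_gradL]
    rw [← ENNReal.rpow_natCast, ← ENNReal.rpow_mul]
    simp
  rw [← h, ENNReal.ofReal_pow (norm_nonneg _), ofReal_norm]

/-- Since `sobolevH10 Ω` is closed in the product of the two `L²` spaces, convergence of functions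
and gradients separately is enough. This is how elements with prescribed function and gradient are
constructed below. -/
theorem exists_tendsto_of_tendsto_eLpNorm (u : ℕ → H10 Ω) {f : Euc d → ℝ} {g : Euc d → Euc d}
    (hf : MemLp f 2 (leb Ω)) (hg : MemLp g 2 (leb Ω))
    (h1 : Tendsto (fun n => eLpNorm ((u n).fn - f) 2 (leb Ω)) atTop (𝓝 0))
    (h2 : Tendsto (fun n => eLpNorm ((u n).grad - g) 2 (leb Ω)) atTop (𝓝 0)) :
    ∃ w : H10 Ω, w.fn =ᵐ[leb Ω] f ∧ w.grad =ᵐ[leb Ω] g ∧ Tendsto u atTop (𝓝 w) := by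
  set P : L2Pair Ω := WithLp.toLp 2 (hf.toLp f, hg.toLp g) with hP
  have t1 : Tendsto (fun n => fnL (u n)) atTop (𝓝 (hf.toLp f)) := by
    rw [Lp.tendsto_Lp_iff_tendsto_eLpNorm']
    refine h1.congr fun n => eLpNorm_congr_ae ?_
    filter_upwards [hf.coeFn_toLp] with x hx
    simp only [Pi.sub_apply, hx, coe_fnL]
  have t2 : Tendsto (fun n => gradL (u n)) atTop (𝓝 (hg.toLp g)) := by
    rw [Lp.tendsto_Lp_iff_tendsto_eLpNorm']
    refine h2.congr fun n => eLpNorm_congr_ae ?_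
    filter_upwards [hg.coeFn_toLp] with x hx
    simp only [Pi.sub_apply, hx, coe_gradL]
  have t : Tendsto (fun n => ((u n : H10 Ω) : L2Pair Ω)) atTop (𝓝 P) :=
    ((WithLp.prod_continuous_toLp 2 _ _).tendsto _).comp (t1.prodMk_nhds t2)
  have hm : P ∈ sobolevH10 Ω :=
    (Submodule.isClosed_topologicalClosure (LinearMap.range (testGraph Ω))).mem_of_tendsto t
      (Eventually.of_forall fun n => (u n).2)
  exact ⟨⟨P, hm⟩, hf.coeFn_toLp, hg.coeFn_toLp, tendsto_subtype_rng.2 t⟩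

end H10

/-! ### Dominated convergence in `L²`, and the Poincaré inequality. -/

theorem tendsto_eLpNorm_two_of_dominated {α E : Type*} [MeasurableSpace α] [NormedAddCommGroup E]
    {μ : Measure α} {f : ℕ → α → E} {b : α → ℝ} (hb : MemLp b 2 μ)
    (hf : ∀ n, AEStronglyMeasurable (f n) μ) (hfb : ∀ n, ∀ᵐ x ∂μ, ‖f n x‖ ≤ b x)
    (hlim : ∀ᵐ x ∂μ, Tendsto (fun n => f n x) atTop (𝓝 0)) :
    Tendsto (fun n => eLpNorm (f n) 2 μ) atTop (𝓝 0) := by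
  have h : Tendsto (fun n => ∫⁻ x, ‖f n x‖ₑ ^ (2 : ℝ) ∂μ) atTop (𝓝 (∫⁻ x, 0 ∂μ)) := by
    refine tendsto_lintegral_of_dominated_convergence' (fun x => ‖b x‖ₑ ^ (2 : ℝ))
      (fun n => (hf n).enorm.pow_const _) ?_ ?_ ?_
    · intro n
      filter_upwards [hfb n] with x hx
      gcongr
      rw [enorm_le_iff_norm_le]
      exact hx.trans (le_abs_self _)
    · have := lintegral_rpow_enorm_lt_top_of_eLpNorm_lt_top (by simp) (by simp) hb.2
      simpa using this.ne
    · filter_upwards [hlim] with x hx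
      have := (ENNReal.continuous_rpow_const (y := (2 : ℝ))).tendsto _ |>.comp hx.enorm
      simpa [Function.comp_def] using this
  have h2 := (ENNReal.continuous_rpow_const (y := (1 / 2 : ℝ))).tendsto _ |>.comp h
  simp only [lintegral_const, zero_mul] at h2
  rw [ENNReal.zero_rpow_of_pos (by norm_num)] at h2
  refine h2.congr fun n => ?_
  rw [eLpNorm_eq_lintegral_rpow_enorm_toReal (by simp) (by simp)]
  simp

namespace H10

variable {Ω : Opens (Euc d)}

theorem norm_fnL_ofTest_sq (φ : 𝓓(Ω, ℝ)) : ‖fnL (ofTest φ)‖ ^ 2 = ∫ x, φ x ^ 2 := by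
  rw [← real_inner_self_eq_norm_sq, L2.inner_def]
  rw [← setIntegral_eq_integral_of_forall_compl_eq_zero (s := (Ω : Set (Euc d)))
    (f := fun x => φ x ^ 2) (fun x hx => by rw [test_eq_zero φ hx]; simp)]
  refine integral_congr_ae ?_
  filter_upwards [ofTest_fn φ] with x hx
  rw [coe_fnL, hx]
  simp [sq]

theorem gradient_test_eq_zero (φ : 𝓓(Ω, ℝ)) {x : Euc d} (hx : x ∉ Ω) :
    ∇ (φ : Euc d → ℝ) x = 0 := by
  have h : fderiv ℝ (φ : Euc d → ℝ) x = 0 :=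
    image_eq_zero_of_notMem_tsupport fun h => hx (φ.tsupport_subset (tsupport_fderiv_subset ℝ h))
  simp [gradient, h]

theorem norm_gradL_ofTest_sq (φ : 𝓓(Ω, ℝ)) :
    ‖gradL (ofTest φ)‖ ^ 2 = ∫ x, ‖∇ (φ : Euc d → ℝ) x‖ ^ 2 := by
  rw [← real_inner_self_eq_norm_sq, L2.inner_def]
  rw [← setIntegral_eq_integral_of_forall_compl_eq_zero (s := (Ω : Set (Euc d)))
    (f := fun x => ‖∇ (φ : Euc d → ℝ) x‖ ^ 2) (fun x hx => by rw [gradient_test_eq_zero φ hx]; simp)]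
  refine integral_congr_ae ?_
  filter_upwards [ofTest_grad φ] with x hx
  rw [coe_gradL, hx]
  simp

theorem testFunction_gradient_hasCompactSupport (φ : 𝓓(Ω, ℝ)) :
    HasCompactSupport (∇ (φ : Euc d → ℝ)) :=
  (φ.hasCompactSupport.fderiv ℝ).comp_left
    (g := (InnerProductSpace.toDual ℝ (Euc d)).symm) (map_zero _)

theorem integrable_test_sq (φ : 𝓓(Ω, ℝ)) : Integrable (fun x => φ x ^ 2) := by
  have h : HasCompactSupport (fun x => φ x ^ 2) := by
    refine φ.hasCompactSupport.mono fun x hx h0 => hx ?_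
    simp [h0]
  have hc : Continuous (fun x => φ x ^ 2) := φ.continuous.pow 2
  exact hc.integrable_of_hasCompactSupport h

theorem integrable_gradient_test_sq (φ : 𝓓(Ω, ℝ)) :
    Integrable (fun x => ‖∇ (φ : Euc d → ℝ) x‖ ^ 2) := by
  have h : HasCompactSupport (fun x => ‖∇ (φ : Euc d → ℝ) x‖ ^ 2) := by
    refine (testFunction_gradient_hasCompactSupport φ).mono fun x hx h0 => hx ?_
    simp [h0]
  have hc : Continuous (fun x => ‖∇ (φ : Euc d → ℝ) x‖ ^ 2) :=
    (continuous_gradient (test_contDiff φ)).norm.pow 2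
  exact hc.integrable_of_hasCompactSupport h

/-- Integration by parts against the first coordinate `P` writes `∫ φ²` as `-∫ 2 P φ ∂φ`. On `Ω` one
has `|P| ≤ R`, so Young's inequality bounds the integrand by `φ² / 2 + 2 R² |∇φ|²`, and the first
term is absorbed. -/
theorem norm_fnL_ofTest_sq_le (hd : 1 ≤ d) {R : ℝ} (hR : (Ω : Set (Euc d)) ⊆ Metric.ball 0 R)
    (φ : 𝓓(Ω, ℝ)) :
    ‖fnL (ofTest φ)‖ ^ 2 ≤ (2 * R) ^ 2 * ‖gradL (ofTest φ)‖ ^ 2 := by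
  rw [norm_fnL_ofTest_sq, norm_gradL_ofTest_sq]
  let i : Fin d := ⟨0, hd⟩
  let e : Euc d := EuclideanSpace.single i 1
  let P : Euc d →L[ℝ] ℝ := EuclideanSpace.proj i
  have hPe : P e = 1 := by simp [P, e]
  have hφd := testFunction_differentiable φ
  have hsq : ContDiff ℝ ∞ (fun x => φ x ^ 2) := (test_contDiff φ).pow 2
  have hsc : HasCompactSupport (fun x => φ x ^ 2) :=
    φ.hasCompactSupport.comp_left (g := fun t : ℝ => t ^ 2) (by simp)
  have hfd : ∀ x, fderiv ℝ (fun x => φ x ^ 2) x e = 2 * φ x * fderiv ℝ φ x e := by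
    intro x
    have : HasFDerivAt (fun x => φ x ^ 2) _ x := (hφd x).hasFDerivAt.pow 2
    rw [this.fderiv]
    simp
  have hcf : Continuous fun x => fderiv ℝ φ x e :=
    ((test_contDiff φ).continuous_fderiv (by simp)).clm_apply continuous_const
  have i1 := integrable_test_sq φ
  have i2 := integrable_gradient_test_sq φ
  have i3 : Integrable (fun x => P x * fderiv ℝ (fun x => φ x ^ 2) x e) := by
    simp only [hfd]
    refine Continuous.integrable_of_hasCompactSupport
      (P.continuous.mul ((continuous_const.mul φ.continuous).mul hcf)) ?_
    exact (φ.hasCompactSupport.mul_left (f := fun _ => (2 : ℝ))).mul_right.mul_left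
  have hparts := integral_mul_fderiv_eq_neg_fderiv_mul_of_integrable (μ := volume) (f := P)
    (g := fun x => φ x ^ 2) (v := e) (by simpa [hPe] using i1) i3
    (Continuous.integrable_of_hasCompactSupport (P.continuous.mul hsq.continuous) hsc.mul_left)
    (fun x _ => P.differentiableAt) (fun x _ => hsq.differentiable (by simp) x)
  simp only [ContinuousLinearMap.fderiv, hPe, one_mul] at hparts
  have key : ∫ x, φ x ^ 2 ≤ ∫ x, (φ x ^ 2 / 2 + 2 * R ^ 2 * ‖∇ (φ : Euc d → ℝ) x‖ ^ 2) := by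
    have : ∫ x, φ x ^ 2 = ∫ x, -(P x * fderiv ℝ (fun x => φ x ^ 2) x e) := by
      rw [integral_neg, hparts, neg_neg]
    rw [this]
    refine integral_mono i3.neg ((i1.div_const 2).add (i2.const_mul _)) fun x => ?_
    by_cases hx : x ∈ Ω
    · have h1 : |P x| ≤ R := by
        have hxR := hR hx
        rw [mem_ball_zero_iff] at hxR
        exact (PiLp.norm_apply_le x i).trans hxR.le
      have h2 : |fderiv ℝ φ x e| ≤ ‖∇ (φ : Euc d → ℝ) x‖ := by
        rw [← inner_gradient_left]
        refine (abs_real_inner_le_norm _ _).trans ?_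
        simp [e]
      have h3 : |P x * fderiv ℝ φ x e| ≤ R * ‖∇ (φ : Euc d → ℝ) x‖ := by
        rw [abs_mul]
        exact mul_le_mul h1 h2 (abs_nonneg _) ((abs_nonneg _).trans h1)
      have h4 := sq_le_sq' (abs_le.1 h3).1 (abs_le.1 h3).2
      simp only [hfd]
      nlinarith [sq_nonneg (φ x + 2 * (P x * fderiv ℝ φ x e))]
    · simp only [hfd, test_eq_zero φ hx]
      simp only [mul_zero, zero_mul, neg_zero]
      positivity
  rw [integral_add (i1.div_const 2) (i2.const_mul _), integral_div, integral_const_mul] at key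
  nlinarith

theorem exists_norm_fnL_le (hd : 1 ≤ d) (hΩ : Bornology.IsBounded (Ω : Set (Euc d))) :
    ∃ C : ℝ, 0 < C ∧ ∀ u : H10 Ω, ‖fnL u‖ ≤ C * ‖gradL u‖ := by
  obtain ⟨R, hR0, hR⟩ := hΩ.subset_ball_lt 0 0
  refine ⟨2 * R, by positivity, fun u => ?_⟩
  refine isClosed_property (p := fun u : H10 Ω => ‖fnL u‖ ≤ 2 * R * ‖gradL u‖) denseRange_ofTest
    (isClosed_le (by fun_prop) (by fun_prop)) (fun φ => ?_) u
  refine (sq_le_sq₀ (norm_nonneg _) (by positivity)).1 ?_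
  rw [mul_pow]
  exact norm_fnL_ofTest_sq_le hd hR φ

theorem exists_norm_le (hd : 1 ≤ d) (hΩ : Bornology.IsBounded (Ω : Set (Euc d))) :
    ∃ C : ℝ, 0 < C ∧ ∀ u : H10 Ω, ‖u‖ ≤ C * ‖gradL u‖ := by
  obtain ⟨C, hC, h⟩ := exists_norm_fnL_le hd hΩ
  exact ⟨C + 1, by positivity, fun u => (norm_le u).trans (by linarith [h u])⟩

theorem exists_subseq_ae {u : ℕ → H10 Ω} {w : H10 Ω} (h : Tendsto u atTop (𝓝 w)) :
    ∃ ns : ℕ → ℕ, StrictMono ns ∧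
      ∀ᵐ x ∂(leb Ω), Tendsto (fun n => (u (ns n)).fn x) atTop (𝓝 (w.fn x)) :=
  (tendstoInMeasure_of_tendsto_Lp ((fnL.continuous.tendsto w).comp h)).exists_seq_tendsto_ae

theorem tendsto_eLpNorm_fn {u : ℕ → H10 Ω} {w : H10 Ω} (h : Tendsto u atTop (𝓝 w)) :
    Tendsto (fun n => eLpNorm ((u n).fn - w.fn) 2 (leb Ω)) atTop (𝓝 0) :=
  (Lp.tendsto_Lp_iff_tendsto_eLpNorm' _ _).1 ((fnL.continuous.tendsto w).comp h)

theorem tendsto_eLpNorm_grad {u : ℕ → H10 Ω} {w : H10 Ω} (h : Tendsto u atTop (𝓝 w)) :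
    Tendsto (fun n => eLpNorm ((u n).grad - w.grad) 2 (leb Ω)) atTop (𝓝 0) :=
  (Lp.tendsto_Lp_iff_tendsto_eLpNorm' _ _).1 ((gradL.continuous.tendsto w).comp h)

end H10

/-! ### Chain rule in `H10 Ω`. -/

namespace H10

variable {Ω : Opens (Euc d)}

theorem ext_ae {u v : H10 Ω} (h1 : u.fn =ᵐ[leb Ω] v.fn) (h2 : u.grad =ᵐ[leb Ω] v.grad) : u = v :=
  Subtype.ext (WithLp.ofLp_injective 2 (Prod.ext (Lp.ext h1) (Lp.ext h2)))

theorem tendsto_of_tendsto_eLpNorm {u : ℕ → H10 Ω} {w : H10 Ω}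
    (h1 : Tendsto (fun n => eLpNorm ((u n).fn - w.fn) 2 (leb Ω)) atTop (𝓝 0))
    (h2 : Tendsto (fun n => eLpNorm ((u n).grad - w.grad) 2 (leb Ω)) atTop (𝓝 0)) :
    Tendsto u atTop (𝓝 w) := by
  obtain ⟨v, hv1, hv2, hv⟩ := exists_tendsto_of_tendsto_eLpNorm u (fn_memLp w) (grad_memLp w) h1 h2
  rwa [ext_ae hv1 hv2] at hv

theorem compTest_grad {T : ℝ → ℝ} (hT : ContDiff ℝ ∞ T) (hT0 : T 0 = 0) (φ : 𝓓(Ω, ℝ)) :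
    (ofTest (compTest T hT hT0 φ)).grad =ᵐ[leb Ω] fun x => deriv T (φ x) • ∇ (φ : Euc d → ℝ) x := by
  filter_upwards [ofTest_grad (compTest T hT hT0 φ)] with x hx
  rw [hx]
  exact gradient_comp (hT.differentiable (by simp) _) (testFunction_differentiable φ x)

/-- The gradient error is `T'(φ)(∇φ - ∇u) + (T'(φ) - T'(u))∇u`. The first term is small because `T'`
is bounded. The second is handled by dominated convergence, which needs a.e. convergence and hence
the subsequence `ns`. -/
theorem exists_comp_tendsto {T : ℝ → ℝ} (hT : ContDiff ℝ ∞ T) (hT0 : T 0 = 0) {C : ℝ}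
    (hC : ∀ t, |deriv T t| ≤ C) {u : H10 Ω} {φ : ℕ → 𝓓(Ω, ℝ)}
    (hφ : Tendsto (fun n => ofTest (φ n)) atTop (𝓝 u)) :
    ∃ (w : H10 Ω) (ns : ℕ → ℕ), w.fn =ᵐ[leb Ω] (fun x => T (u.fn x)) ∧
      w.grad =ᵐ[leb Ω] (fun x => deriv T (u.fn x) • u.grad x) ∧ StrictMono ns ∧
      Tendsto (fun n => ofTest (compTest T hT hT0 (φ (ns n)))) atTop (𝓝 w) := by
  obtain ⟨ns, hns, hae⟩ := exists_subseq_ae hφ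
  have hC0 : 0 ≤ C := (abs_nonneg _).trans (hC 0)
  have hTl : ∀ a b, |T a - T b| ≤ C * |a - b| := fun a b =>
    convex_univ.norm_image_sub_le_of_norm_deriv_le (f := T)
      (fun x _ => hT.differentiable (by simp) x) (fun x _ => hC x) (Set.mem_univ b) (Set.mem_univ a)
  have hT'c : Continuous (deriv T) := hT.continuous_deriv (by simp)
  have hum := (fn_memLp u).1
  have hf : MemLp (fun x => T (u.fn x)) 2 (leb Ω) := by
    refine MemLp.of_le_mul (c := C) (fn_memLp u) (hT.continuous.comp_aestronglyMeasurable hum) ?_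
    refine Eventually.of_forall fun x => ?_
    simpa [hT0] using hTl (u.fn x) 0
  have hg : MemLp (fun x => deriv T (u.fn x) • u.grad x) 2 (leb Ω) := by
    refine MemLp.of_le_mul (c := C) (grad_memLp u)
      ((hT'c.comp_aestronglyMeasurable hum).smul (grad_memLp u).1) ?_
    refine Eventually.of_forall fun x => ?_
    rw [norm_smul]
    exact mul_le_mul_of_nonneg_right (hC _) (norm_nonneg _)
  have hφ' := hφ.comp hns.tendsto_atTop
  have hlim0 : ∀ {a : ℕ → ℝ≥0∞}, Tendsto a atTop (𝓝 0) →
      Tendsto (fun n => ENNReal.ofReal C * a n) atTop (𝓝 0) := fun h => by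
    simpa using ENNReal.Tendsto.const_mul h (Or.inr ENNReal.ofReal_ne_top)
  suffices H : ∃ w : H10 Ω, w.fn =ᵐ[leb Ω] (fun x => T (u.fn x)) ∧
      w.grad =ᵐ[leb Ω] (fun x => deriv T (u.fn x) • u.grad x) ∧
      Tendsto (fun n => ofTest (compTest T hT hT0 (φ (ns n)))) atTop (𝓝 w) by
    obtain ⟨w, h1, h2, h3⟩ := H
    exact ⟨w, ns, h1, h2, hns, h3⟩
  refine exists_tendsto_of_tendsto_eLpNorm _ hf hg ?_ ?_
  · refine tendsto_of_tendsto_of_tendsto_of_le_of_le tendsto_const_nhds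
      (hlim0 (tendsto_eLpNorm_fn hφ')) (fun _ => zero_le) fun n => ?_
    refine eLpNorm_le_mul_eLpNorm_of_ae_le_mul ?_ 2
    filter_upwards [ofTest_fn (compTest T hT hT0 (φ (ns n))), ofTest_fn (φ (ns n))] with x hx hx'
    simp only [Pi.sub_apply, Function.comp_apply, hx, hx']
    exact hTl _ _
  · have ha : Tendsto (fun n => eLpNorm
        (fun x => (deriv T (φ (ns n) x) - deriv T (u.fn x)) • u.grad x) 2 (leb Ω)) atTop (𝓝 0) := by
      refine tendsto_eLpNorm_two_of_dominated (b := fun x => 2 * C * ‖u.grad x‖)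
        ((grad_memLp u).norm.const_mul _) (fun n => ?_) (fun n => ?_) ?_
      · exact ((hT'c.comp (φ (ns n)).continuous).aestronglyMeasurable.sub
          (hT'c.comp_aestronglyMeasurable hum)).smul (grad_memLp u).1
      · refine Eventually.of_forall fun x => ?_
        rw [norm_smul]
        refine mul_le_mul_of_nonneg_right ?_ (norm_nonneg _)
        have := norm_sub_le (deriv T (φ (ns n) x)) (deriv T (u.fn x))
        simp only [Real.norm_eq_abs] at this ⊢
        linarith [hC (φ (ns n) x), hC (u.fn x)]
      · filter_upwards [hae, ae_all_iff.2 fun n => ofTest_fn (φ (ns n))] with x hx hx'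
        simp only [hx'] at hx
        have := ((hT'c.tendsto _).comp hx).sub_const (deriv T (u.fn x))
        simpa using this.smul_const (u.grad x)
    have hb := hlim0 (tendsto_eLpNorm_grad hφ')
    have hab := hb.add ha
    rw [add_zero] at hab
    refine tendsto_of_tendsto_of_tendsto_of_le_of_le tendsto_const_nhds hab
      (fun _ => zero_le) fun n => ?_
    have hm1 : AEStronglyMeasurable (fun x => deriv T (φ (ns n) x) •
        ((ofTest (φ (ns n))).grad x - u.grad x)) (leb Ω) :=
      (hT'c.comp (φ (ns n)).continuous).aestronglyMeasurable.smul
        ((grad_memLp _).1.sub (grad_memLp u).1)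
    have hm2 : AEStronglyMeasurable
        (fun x => (deriv T (φ (ns n) x) - deriv T (u.fn x)) • u.grad x) (leb Ω) :=
      ((hT'c.comp (φ (ns n)).continuous).aestronglyMeasurable.sub
          (hT'c.comp_aestronglyMeasurable hum)).smul (grad_memLp u).1
    have heq : (ofTest (compTest T hT hT0 (φ (ns n)))).grad
          - (fun x => deriv T (u.fn x) • u.grad x) =ᵐ[leb Ω]
        (fun x => deriv T (φ (ns n) x) • ((ofTest (φ (ns n))).grad x - u.grad x)) +
        (fun x => (deriv T (φ (ns n) x) - deriv T (u.fn x)) • u.grad x) := by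
      filter_upwards [compTest_grad hT hT0 (φ (ns n)), ofTest_grad (φ (ns n))] with x hx hx'
      simp only [Pi.sub_apply, Pi.add_apply, hx, hx', smul_sub, sub_smul]
      abel
    rw [eLpNorm_congr_ae heq]
    refine (eLpNorm_add_le hm1 hm2 (by norm_num)).trans ?_
    gcongr
    refine eLpNorm_le_mul_eLpNorm_of_ae_le_mul (Eventually.of_forall fun x => ?_) 2
    simp only [Function.comp_apply, Pi.sub_apply, norm_smul]
    exact mul_le_mul_of_nonneg_right (hC _) (norm_nonneg _)

theorem exists_comp_tendsto_of_fn {T : ℝ → ℝ} (hT : ContDiff ℝ ∞ T) (hT0 : T 0 = 0) {C : ℝ}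
    (hC : ∀ t, |deriv T t| ≤ C) {u w : H10 Ω} {φ : ℕ → 𝓓(Ω, ℝ)}
    (hφ : Tendsto (fun n => ofTest (φ n)) atTop (𝓝 u))
    (hw1 : w.fn =ᵐ[leb Ω] (fun x => T (u.fn x)))
    (hw2 : w.grad =ᵐ[leb Ω] (fun x => deriv T (u.fn x) • u.grad x)) :
    ∃ ns : ℕ → ℕ, StrictMono ns ∧
      Tendsto (fun n => ofTest (compTest T hT hT0 (φ (ns n)))) atTop (𝓝 w) := by
  obtain ⟨w', ns, h1, h2, h3, h4⟩ := exists_comp_tendsto hT hT0 hC hφ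
  rw [ext_ae (h1.trans hw1.symm) (h2.trans hw2.symm)] at h4
  exact ⟨ns, h3, h4⟩

theorem exists_comp {T : ℝ → ℝ} (hT : ContDiff ℝ ∞ T) (hT0 : T 0 = 0) {C : ℝ}
    (hC : ∀ t, |deriv T t| ≤ C) (u : H10 Ω) :
    ∃ w : H10 Ω, w.fn =ᵐ[leb Ω] (fun x => T (u.fn x)) ∧
      w.grad =ᵐ[leb Ω] (fun x => deriv T (u.fn x) • u.grad x) := by
  obtain ⟨φ, hφ⟩ := exists_seq_ofTest u
  obtain ⟨w, _, h1, h2, _⟩ := exists_comp_tendsto hT hT0 hC hφ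
  exact ⟨w, h1, h2⟩

/-- Reaches nonsmooth compositions: `q` is only the pointwise limit of the derivatives, and the
common bound `C` dominates both the functions and the gradients. -/
theorem exists_comp_limit {T : ℕ → ℝ → ℝ} (hT : ∀ k, ContDiff ℝ ∞ (T k)) (hT0 : ∀ k, T k 0 = 0)
    {C : ℝ} (hC : ∀ k t, |deriv (T k) t| ≤ C) {p q : ℝ → ℝ}
    (hp : ∀ t, Tendsto (fun k => T k t) atTop (𝓝 (p t)))
    (hq : ∀ t, Tendsto (fun k => deriv (T k) t) atTop (𝓝 (q t))) {u : H10 Ω} {v : ℕ → H10 Ω}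
    (hv1 : ∀ k, (v k).fn =ᵐ[leb Ω] fun x => T k (u.fn x))
    (hv2 : ∀ k, (v k).grad =ᵐ[leb Ω] fun x => deriv (T k) (u.fn x) • u.grad x) :
    ∃ w : H10 Ω, w.fn =ᵐ[leb Ω] (fun x => p (u.fn x)) ∧
      w.grad =ᵐ[leb Ω] (fun x => q (u.fn x) • u.grad x) ∧ Tendsto v atTop (𝓝 w) := by
  have hTl : ∀ k a, |T k a| ≤ C * |a| := fun k a => by
    have := convex_univ.norm_image_sub_le_of_norm_deriv_le (f := T k)
      (fun x _ => (hT k).differentiable (by simp) x) (fun x _ => hC k x)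
      (Set.mem_univ 0) (Set.mem_univ a)
    simpa [hT0] using this
  have hpl : ∀ a, |p a| ≤ C * |a| := fun a => le_of_tendsto (hp a).abs (Eventually.of_forall
    fun k => hTl k a)
  have hql : ∀ a, |q a| ≤ C := fun a => le_of_tendsto (hq a).abs (Eventually.of_forall
    fun k => hC k a)
  have hum := (fn_memLp u).1
  have hTm : ∀ k, AEStronglyMeasurable (fun x => T k (u.fn x)) (leb Ω) := fun k =>
    (hT k).continuous.comp_aestronglyMeasurable hum
  have hT'm : ∀ k, AEStronglyMeasurable (fun x => deriv (T k) (u.fn x) • u.grad x) (leb Ω) :=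
    fun k => (((hT k).continuous_deriv (by simp)).comp_aestronglyMeasurable hum).smul
      (grad_memLp u).1
  have hpm : AEStronglyMeasurable (fun x => p (u.fn x)) (leb Ω) :=
    aestronglyMeasurable_of_tendsto_ae atTop hTm (Eventually.of_forall fun x => hp _)
  have hqm : AEStronglyMeasurable (fun x => q (u.fn x) • u.grad x) (leb Ω) :=
    aestronglyMeasurable_of_tendsto_ae atTop hT'm
      (Eventually.of_forall fun x => (hq _).smul_const _)
  have hf : MemLp (fun x => p (u.fn x)) 2 (leb Ω) :=
    MemLp.of_le_mul (c := C) (fn_memLp u) hpm (Eventually.of_forall fun x => hpl _)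
  have hg : MemLp (fun x => q (u.fn x) • u.grad x) 2 (leb Ω) := by
    refine MemLp.of_le_mul (c := C) (grad_memLp u) hqm (Eventually.of_forall fun x => ?_)
    rw [norm_smul]
    exact mul_le_mul_of_nonneg_right (hql _) (norm_nonneg _)
  refine exists_tendsto_of_tendsto_eLpNorm v hf hg ?_ ?_
  · have := tendsto_eLpNorm_two_of_dominated (μ := leb Ω)
      (f := fun k x => T k (u.fn x) - p (u.fn x)) (b := fun x => 2 * C * ‖u.fn x‖)
      ((fn_memLp u).norm.const_mul _) (fun k => (hTm k).sub hpm)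
      (fun k => Eventually.of_forall fun x => ?_) (Eventually.of_forall fun x => ?_)
    · refine this.congr fun k => eLpNorm_congr_ae ?_
      filter_upwards [hv1 k] with x hx
      simp [hx]
    · refine (norm_sub_le _ _).trans ?_
      have h1 := hTl k (u.fn x)
      have h2 := hpl (u.fn x)
      simp only [Real.norm_eq_abs]
      linarith
    · simpa using (hp (u.fn x)).sub_const (p (u.fn x))
  · have := tendsto_eLpNorm_two_of_dominated (μ := leb Ω)
      (f := fun k x => deriv (T k) (u.fn x) • u.grad x - q (u.fn x) • u.grad x)
      (b := fun x => 2 * C * ‖u.grad x‖)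
      ((grad_memLp u).norm.const_mul _) (fun k => (hT'm k).sub hqm)
      (fun k => Eventually.of_forall fun x => ?_) (Eventually.of_forall fun x => ?_)
    · refine this.congr fun k => eLpNorm_congr_ae ?_
      filter_upwards [hv2 k] with x hx
      simp [hx]
    · refine (norm_sub_le _ _).trans ?_
      rw [norm_smul, norm_smul]
      have h1 := mul_le_mul_of_nonneg_right (hC k (u.fn x)) (norm_nonneg (u.grad x))
      have h2 := mul_le_mul_of_nonneg_right (hql (u.fn x)) (norm_nonneg (u.grad x))
      simp only [Real.norm_eq_abs] at h1 h2 ⊢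
      linarith
    · simpa using ((hq (u.fn x)).smul_const (u.grad x)).sub_const (q (u.fn x) • u.grad x)

end H10

/-! ### Smooth approximations of the positive part and of truncations. -/

theorem deriv_smoothTransition_of_neg {t : ℝ} (ht : t < 0) : deriv Real.smoothTransition t = 0 := by
  have : Real.smoothTransition =ᶠ[𝓝 t] fun _ => 0 := by
    filter_upwards [Iio_mem_nhds ht] with s hs
    exact Real.smoothTransition.zero_of_nonpos (le_of_lt hs)
  rw [this.deriv_eq, deriv_const]

theorem deriv_smoothTransition_of_one_lt {t : ℝ} (ht : 1 < t) :
    deriv Real.smoothTransition t = 0 := by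
  have : Real.smoothTransition =ᶠ[𝓝 t] fun _ => 1 := by
    filter_upwards [Ioi_mem_nhds ht] with s hs
    exact Real.smoothTransition.one_of_one_le (le_of_lt hs)
  rw [this.deriv_eq, deriv_const]

theorem smoothTransition_contDiff : ContDiff ℝ ∞ Real.smoothTransition :=
  Real.smoothTransition.contDiff

theorem exists_deriv_smoothTransition_le :
    ∃ C : ℝ, 0 < C ∧ ∀ t, |deriv Real.smoothTransition t| ≤ C := by
  obtain ⟨C, hC⟩ := (isCompact_Icc (a := (0 : ℝ)) (b := 1)).exists_bound_of_continuousOn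
    (smoothTransition_contDiff.continuous_deriv (by simp)).continuousOn
  refine ⟨|C| + 1, by positivity, fun t => ?_⟩
  rcases lt_or_ge t 0 with h | h
  · rw [deriv_smoothTransition_of_neg h, abs_zero]; positivity
  rcases lt_or_ge 1 t with h' | h'
  · rw [deriv_smoothTransition_of_one_lt h', abs_zero]; positivity
  · exact (hC t ⟨h, h'⟩).trans ((le_abs_self C).trans (by linarith))

/-- A smooth approximation of the positive part. -/
def smoothPos (k : ℕ) (t : ℝ) : ℝ := t * Real.smoothTransition ((k + 1) * t - 1)

theorem smoothPos_contDiff (k : ℕ) : ContDiff ℝ ∞ (smoothPos k) :=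
  contDiff_id.mul (smoothTransition_contDiff.comp
    ((contDiff_const.mul contDiff_id).sub contDiff_const))

theorem smoothPos_of_le {k : ℕ} {t : ℝ} (ht : (k + 1) * t ≤ 1) : smoothPos k t = 0 := by
  rw [smoothPos, Real.smoothTransition.zero_of_nonpos (by linarith), mul_zero]

theorem smoothPos_of_nonpos {k : ℕ} {t : ℝ} (ht : t ≤ 0) : smoothPos k t = 0 :=
  smoothPos_of_le (by nlinarith [(Nat.cast_nonneg k : (0 : ℝ) ≤ k)])

theorem deriv_smoothPos (k : ℕ) (t : ℝ) : deriv (smoothPos k) t =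
    Real.smoothTransition ((k + 1) * t - 1) +
      (k + 1) * t * deriv Real.smoothTransition ((k + 1) * t - 1) := by
  have h1 : HasDerivAt (fun t : ℝ => ((k : ℝ) + 1) * t - 1) (k + 1) t := by
    simpa using ((hasDerivAt_id t).const_mul ((k : ℝ) + 1)).sub_const 1
  have h2 := ((smoothTransition_contDiff.differentiable (by simp)
    (((k : ℝ) + 1) * t - 1)).hasDerivAt).comp t h1
  have h3 : HasDerivAt (smoothPos k) _ t := (hasDerivAt_id t).mul h2
  rw [h3.deriv]
  simp
  ring

/-- Uniformity in `k` is scale invariance: in terms of `s = (k + 1) * t` the derivative is `S(s - 1)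
+ s S'(s - 1)`, with `S` the smooth transition, and `S'(s - 1)` vanishes unless `1 ≤ s ≤ 2`. -/
theorem exists_deriv_smoothPos_le : ∃ C : ℝ, 0 < C ∧ ∀ k t, |deriv (smoothPos k) t| ≤ C := by
  obtain ⟨C, hC, h⟩ := exists_deriv_smoothTransition_le
  refine ⟨1 + 2 * C, by positivity, fun k t => ?_⟩
  rw [deriv_smoothPos]
  set s : ℝ := (k + 1) * t
  have h1 : |Real.smoothTransition (s - 1)| ≤ 1 := abs_le.2
    ⟨by linarith [Real.smoothTransition.nonneg (s - 1)], Real.smoothTransition.le_one _⟩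
  have h2 : |s * deriv Real.smoothTransition (s - 1)| ≤ 2 * C := by
    rcases lt_or_ge s 1 with hs | hs
    · rw [deriv_smoothTransition_of_neg (by linarith), mul_zero, abs_zero]; positivity
    rcases lt_or_ge 2 s with hs' | hs'
    · rw [deriv_smoothTransition_of_one_lt (by linarith), mul_zero, abs_zero]; positivity
    · rw [abs_mul]
      exact mul_le_mul (abs_le.2 ⟨by linarith, hs'⟩) (h _) (abs_nonneg _) (by norm_num)
  exact (abs_add_le _ _).trans (add_le_add h1 h2)

theorem eventually_two_lt_mul {t : ℝ} (ht : 0 < t) : ∀ᶠ k : ℕ in atTop, 2 < ((k : ℝ) + 1) * t := by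
  have := (tendsto_atTop_add_const_right atTop (1 : ℝ) tendsto_natCast_atTop_atTop).atTop_mul_const
    ht
  exact this.eventually_gt_atTop 2

theorem tendsto_smoothPos (t : ℝ) : Tendsto (fun k => smoothPos k t) atTop (𝓝 (max t 0)) := by
  rcases le_or_gt t 0 with ht | ht
  · rw [max_eq_right ht]
    simp only [smoothPos_of_nonpos ht]
    exact tendsto_const_nhds
  · rw [max_eq_left ht.le]
    refine tendsto_const_nhds.congr' ?_
    filter_upwards [eventually_two_lt_mul ht] with k hk
    rw [smoothPos, Real.smoothTransition.one_of_one_le (by linarith), mul_one]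

theorem tendsto_deriv_smoothPos (t : ℝ) :
    Tendsto (fun k => deriv (smoothPos k) t) atTop (𝓝 (if 0 < t then 1 else 0)) := by
  split_ifs with ht
  · refine tendsto_const_nhds.congr' ?_
    filter_upwards [eventually_two_lt_mul ht] with k hk
    rw [deriv_smoothPos, Real.smoothTransition.one_of_one_le (by linarith),
      deriv_smoothTransition_of_one_lt (by linarith)]
    simp
  · refine tendsto_const_nhds.congr fun k => ?_
    have : ((k : ℝ) + 1) * t ≤ 0 := mul_nonpos_of_nonneg_of_nonpos (by positivity) (not_lt.1 ht)
    rw [deriv_smoothPos, Real.smoothTransition.zero_of_nonpos (by linarith),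
      deriv_smoothTransition_of_neg (by linarith)]
    simp

/-- The truncation at levels `±m`. -/
def trunc (m t : ℝ) : ℝ := max (min m t) (-m)

/-- A smooth approximation of the truncation at levels `±m`. -/
def smoothTrunc (m : ℝ) (k : ℕ) (t : ℝ) : ℝ :=
  smoothPos k (t + m) - smoothPos k (t - m) - smoothPos k m

theorem smoothTrunc_contDiff (m : ℝ) (k : ℕ) : ContDiff ℝ ∞ (smoothTrunc m k) :=
  (((smoothPos_contDiff k).comp (contDiff_id.add contDiff_const)).sub
    ((smoothPos_contDiff k).comp (contDiff_id.sub contDiff_const))).sub contDiff_const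

/-- The constant subtracted in `smoothTrunc` is there for this normalization, without which a
composition with a test function would lose its compact support. -/
theorem smoothTrunc_zero {m : ℝ} (hm : 0 ≤ m) (k : ℕ) : smoothTrunc m k 0 = 0 := by
  simp [smoothTrunc, smoothPos_of_nonpos (neg_nonpos.2 hm)]

theorem deriv_smoothTrunc (m : ℝ) (k : ℕ) (t : ℝ) :
    deriv (smoothTrunc m k) t = deriv (smoothPos k) (t + m) - deriv (smoothPos k) (t - m) := by
  have hd := (smoothPos_contDiff k).differentiable (by simp)
  have h1 := (hd (t + m)).hasDerivAt.comp_add_const t m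
  have h2 := (hd (t - m)).hasDerivAt.comp_sub_const t m
  exact ((h1.sub h2).sub_const _).deriv

theorem tendsto_smoothTrunc {m : ℝ} (hm : 0 ≤ m) (t : ℝ) :
    Tendsto (fun k => smoothTrunc m k t) atTop (𝓝 (trunc m t)) := by
  have := ((tendsto_smoothPos (t + m)).sub (tendsto_smoothPos (t - m))).sub (tendsto_smoothPos m)
  suffices h : max (t + m) 0 - max (t - m) 0 - max m 0 = trunc m t by rwa [h] at this
  rw [trunc, max_eq_left hm]
  rcases le_total m t with h | h
  · rw [min_eq_left h, max_eq_left (by linarith), max_eq_left (by linarith),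
      max_eq_left (by linarith)]; ring
  · rw [min_eq_right h, max_eq_right (a := t - m) (by linarith)]
    rcases le_total t (-m) with h' | h'
    · rw [max_eq_right h', max_eq_right (by linarith)]; ring
    · rw [max_eq_left h', max_eq_left (by linarith)]; ring

theorem tendsto_deriv_smoothTrunc (m t : ℝ) :
    Tendsto (fun k => deriv (smoothTrunc m k) t) atTop
      (𝓝 ((if 0 < t + m then 1 else 0) - (if 0 < t - m then 1 else 0))) := by
  simp only [deriv_smoothTrunc]
  exact (tendsto_deriv_smoothPos _).sub (tendsto_deriv_smoothPos _)

theorem exists_deriv_smoothTrunc_le : ∃ C : ℝ, ∀ m k t, |deriv (smoothTrunc m k) t| ≤ C := by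
  obtain ⟨C, _, h⟩ := exists_deriv_smoothPos_le
  refine ⟨C + C, fun m k t => ?_⟩
  rw [deriv_smoothTrunc]
  exact (abs_sub _ _).trans (add_le_add (h _ _) (h _ _))

/-! ### Bounds for test functions and their products. -/

section TestFunctions

variable {Ω : Opens (Euc d)}

theorem exists_test_bound (φ : 𝓓(Ω, ℝ)) :
    ∃ C : ℝ, 0 < C ∧ (∀ x, |φ x| ≤ C) ∧ ∀ x, ‖∇ (φ : Euc d → ℝ) x‖ ≤ C := by
  obtain ⟨C, hC⟩ := φ.hasCompactSupport.exists_bound_of_continuous φ.continuous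
  obtain ⟨C', hC'⟩ := (H10.testFunction_gradient_hasCompactSupport φ).exists_bound_of_continuous
    (continuous_gradient (test_contDiff φ))
  refine ⟨|C| + |C'| + 1, by positivity, fun x => (hC x).trans ?_, fun x => (hC' x).trans ?_⟩ <;>
    linarith [le_abs_self C, le_abs_self C', abs_nonneg C, abs_nonneg C']

/-- Ensures that the products `χ * w n` tend to `0` in `H10 Ω` whenever the `w n` do. -/
theorem exists_norm_ofTest_mul_le (χ : 𝓓(Ω, ℝ)) : ∃ C : ℝ, 0 < C ∧
    ∀ w : 𝓓(Ω, ℝ), ‖H10.ofTest (mulTest χ (test_contDiff χ) w)‖ ≤ C * ‖H10.ofTest w‖ := by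
  obtain ⟨C, hC, h1, h2⟩ := exists_test_bound χ
  refine ⟨2 * C, by positivity, fun w => (sq_le_sq₀ (norm_nonneg _) (by positivity)).1 ?_⟩
  rw [mul_pow, H10.norm_sq, H10.norm_sq, H10.norm_fnL_ofTest_sq, H10.norm_gradL_ofTest_sq,
    H10.norm_fnL_ofTest_sq, H10.norm_gradL_ofTest_sq]
  have hi := H10.integrable_test_sq w
  have hi' := H10.integrable_gradient_test_sq w
  have e1 : ∫ x, mulTest χ (test_contDiff χ) w x ^ 2 ≤ ∫ x, C ^ 2 * w x ^ 2 := by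
    refine integral_mono (H10.integrable_test_sq _) (hi.const_mul _) fun x => ?_
    simp only [mulTest, mkTest_apply, mul_pow]
    exact mul_le_mul_of_nonneg_right (sq_le_sq' (abs_le.1 (h1 x)).1 (abs_le.1 (h1 x)).2)
      (sq_nonneg _)
  have e2 : ∫ x, ‖∇ (mulTest χ (test_contDiff χ) w : Euc d → ℝ) x‖ ^ 2 ≤
      ∫ x, (2 * C ^ 2 * ‖∇ (w : Euc d → ℝ) x‖ ^ 2 + 2 * C ^ 2 * w x ^ 2) := by
    refine integral_mono (H10.integrable_gradient_test_sq _)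
      ((hi'.const_mul _).add (hi.const_mul _)) fun x => ?_
    have hg : ∇ (mulTest χ (test_contDiff χ) w : Euc d → ℝ) x =
        χ x • ∇ (w : Euc d → ℝ) x + w x • ∇ (χ : Euc d → ℝ) x :=
      gradient_mul (testFunction_differentiable χ x) (testFunction_differentiable w x)
    have hn : ‖∇ (mulTest χ (test_contDiff χ) w : Euc d → ℝ) x‖ ≤
        C * ‖∇ (w : Euc d → ℝ) x‖ + C * |w x| := by
      rw [hg]
      refine (norm_add_le _ _).trans ?_
      rw [norm_smul, norm_smul, mul_comm ‖w x‖]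
      exact add_le_add (mul_le_mul_of_nonneg_right (h1 x) (norm_nonneg _))
        (mul_le_mul_of_nonneg_right (h2 x) (norm_nonneg _))
    have h3 := pow_le_pow_left₀ (norm_nonneg _) hn 2
    have h4 : w x ^ 2 = |w x| ^ 2 := (sq_abs _).symm
    simp only [h4]
    nlinarith [sq_nonneg (C * ‖∇ (w : Euc d → ℝ) x‖ - C * |w x|)]
  rw [integral_const_mul] at e1
  rw [integral_add (hi'.const_mul _) (hi.const_mul _), integral_const_mul,
    integral_const_mul] at e2
  have : 0 ≤ ∫ x, ‖∇ (w : Euc d → ℝ) x‖ ^ 2 := integral_nonneg fun x => by positivity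
  have : 0 ≤ ∫ x, w x ^ 2 := integral_nonneg fun x => by positivity
  nlinarith [mul_nonneg (sq_nonneg C) this]

/-- A test function as a bounded continuous function on `Ω`. -/
def testBCF (φ : 𝓓(Ω, ℝ)) : BoundedContinuousFunction Ω ℝ :=
  BoundedContinuousFunction.ofNormedAddCommGroup (fun x : Ω => φ x)
    (φ.continuous.comp continuous_subtype_val) (exists_test_bound φ).choose
    fun x => (exists_test_bound φ).choose_spec.2.1 x

@[simp] theorem testBCF_apply (φ : 𝓓(Ω, ℝ)) (x : Ω) : testBCF φ x = φ x := rfl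

end TestFunctions

/-! ### The bilinear form on test functions and lower semicontinuity of `F`. -/

section Form

variable {Ω : Opens (Euc d)} (μ : Measure (Ω × Ω)) (ν : Measure Ω)

/-- The bilinear form of the nonlocal and killing parts. -/
def cform (f g : BoundedContinuousFunction Ω ℝ) : ℝ :=
  (∫ p : Ω × Ω, (f p.1 - f p.2) * (g p.1 - g p.2) ∂μ) + ∫ x, f x * g x ∂ν

/-- The difference `f(x) - f(y)`. -/
def diffBCF (f : BoundedContinuousFunction Ω ℝ) : BoundedContinuousFunction (Ω × Ω) ℝ :=
  f.compContinuous ⟨Prod.fst, continuous_fst⟩ - f.compContinuous ⟨Prod.snd, continuous_snd⟩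

/-- The sum `f(x) + f(y)`. -/
def sumBCF (f : BoundedContinuousFunction Ω ℝ) : BoundedContinuousFunction (Ω × Ω) ℝ :=
  f.compContinuous ⟨Prod.fst, continuous_fst⟩ + f.compContinuous ⟨Prod.snd, continuous_snd⟩

variable [IsFiniteMeasure μ] [IsFiniteMeasure ν]

theorem integrable_diff_mul (f g : BoundedContinuousFunction Ω ℝ) :
    Integrable (fun p : Ω × Ω => (f p.1 - f p.2) * (g p.1 - g p.2)) μ :=
  (diffBCF f * diffBCF g).integrable μ

theorem integrable_mul (f g : BoundedContinuousFunction Ω ℝ) :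
    Integrable (fun x => f x * g x) ν := (f * g).integrable ν

theorem cform_add_smul_self (f g : BoundedContinuousFunction Ω ℝ) (t : ℝ) :
    cform μ ν (f + t • g) (f + t • g) =
      cform μ ν f f + 2 * t * cform μ ν f g + t ^ 2 * cform μ ν g g := by
  have h1 := integrable_diff_mul μ f f
  have h2 := (integrable_diff_mul μ f g).const_mul (2 * t)
  have h3 := (integrable_diff_mul μ g g).const_mul (t ^ 2)
  have k1 := integrable_mul ν f f
  have k2 := (integrable_mul ν f g).const_mul (2 * t)
  have k3 := (integrable_mul ν g g).const_mul (t ^ 2)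
  have e1 : ∫ p : Ω × Ω, ((f + t • g) p.1 - (f + t • g) p.2) * ((f + t • g) p.1 - (f + t • g) p.2) ∂μ
      = ∫ p : Ω × Ω, ((f p.1 - f p.2) * (f p.1 - f p.2) +
        2 * t * ((f p.1 - f p.2) * (g p.1 - g p.2)) +
        t ^ 2 * ((g p.1 - g p.2) * (g p.1 - g p.2))) ∂μ :=
    integral_congr_ae (Eventually.of_forall fun p => by simp; ring)
  have e2 : ∫ x, (f + t • g) x * (f + t • g) x ∂ν =
      ∫ x, (f x * f x + 2 * t * (f x * g x) + t ^ 2 * (g x * g x)) ∂ν :=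
    integral_congr_ae (Eventually.of_forall fun p => by simp; ring)
  have h12 : Integrable (fun p : Ω × Ω => (f p.1 - f p.2) * (f p.1 - f p.2) +
      2 * t * ((f p.1 - f p.2) * (g p.1 - g p.2))) μ := h1.add h2
  have k12 : Integrable (fun x => f x * f x + 2 * t * (f x * g x)) ν := k1.add k2
  rw [integral_add h12 h3, integral_add h1 h2, integral_const_mul, integral_const_mul] at e1
  rw [integral_add k12 k3, integral_add k1 k2, integral_const_mul, integral_const_mul] at e2
  simp only [cform, e1, e2]
  ring

/-- The carré du champ identity. Its right-hand side is nonnegative for `g ≥ 0`, so weak information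
on cross terms becomes smallness of integrals of positive functions. -/
theorem cform_mul_sub (f g : BoundedContinuousFunction Ω ℝ) :
    cform μ ν f (f * g) - cform μ ν (f * f) g / 2 =
      (∫ p : Ω × Ω, (f p.1 - f p.2) ^ 2 * (g p.1 + g p.2) ∂μ) / 2 + (∫ x, f x ^ 2 * g x ∂ν) / 2 := by
  have h1 := integrable_diff_mul μ f (f * g)
  have h2 := (integrable_diff_mul μ (f * f) g).div_const 2
  have k1 := integrable_mul ν f (f * g)
  have k2 := (integrable_mul ν (f * f) g).div_const 2
  simp only [cform, add_div, ← integral_div]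
  rw [add_sub_add_comm, ← integral_sub h1 h2, ← integral_sub k1 k2]
  congr 1
  · exact integral_congr_ae (Eventually.of_forall fun p => by simp; ring)
  · exact integral_congr_ae (Eventually.of_forall fun p => by simp; ring)

theorem cform_self_le {g : BoundedContinuousFunction Ω ℝ} {C : ℝ} (hC : ∀ x, |g x| ≤ C) :
    cform μ ν g g ≤ (2 * C) ^ 2 * μ.real Set.univ + C ^ 2 * ν.real Set.univ := by
  refine add_le_add ?_ ?_
  · calc _ ≤ ∫ _, (2 * C) ^ 2 ∂μ := by
          refine integral_mono (integrable_diff_mul μ g g) (integrable_const _) fun p => ?_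
          have h1 := abs_le.1 (hC p.1)
          have h2 := abs_le.1 (hC p.2)
          have := sq_le_sq' (a := g p.1 - g p.2) (b := 2 * C) (by linarith) (by linarith)
          simp only
          linarith
      _ = _ := by simp [mul_comm]
  · calc _ ≤ ∫ _, C ^ 2 ∂ν := by
          refine integral_mono (integrable_mul ν g g) (integrable_const _) fun x => ?_
          have h1 := abs_le.1 (hC x)
          have := sq_le_sq' h1.1 h1.2
          simp only
          linarith
      _ = _ := by simp [mul_comm]

/-- The standing assumptions: `F` is strongly lower semicontinuous and is represented on test
functions by the measures `μ` and `ν`, where `μ` does not charge the diagonal. -/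
structure IsRepresented (F : H10 Ω → ℝ≥0) : Prop where
  lsc : LowerSemicontinuous F
  rep : ∀ φ : 𝓓(Ω, ℝ), (F (H10.ofTest φ) : ℝ≥0∞) = formValue μ ν φ (H10.ofTest φ)
  diag : μ {p : Ω × Ω | p.1 = p.2} = 0

theorem formValue_test (φ : 𝓓(Ω, ℝ)) (u : H10 Ω) : formValue μ ν φ u =
    ENNReal.ofReal (cform μ ν (testBCF φ) (testBCF φ) + ‖H10.gradL u‖ ^ 2) := by
  have h1 : ∫⁻ p : Ω × Ω, ‖φ p.1 - φ p.2‖ₑ ^ 2 ∂μ = ENNReal.ofReal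
      (∫ p : Ω × Ω, (testBCF φ p.1 - testBCF φ p.2) * (testBCF φ p.1 - testBCF φ p.2) ∂μ) := by
    rw [ofReal_integral_eq_lintegral_ofReal (integrable_diff_mul μ _ _)
      (Eventually.of_forall fun p => mul_self_nonneg _)]
    refine lintegral_congr fun p => ?_
    rw [← ofReal_norm, ← ENNReal.ofReal_pow (norm_nonneg _), Real.norm_eq_abs, sq_abs, sq]
    rfl
  have h2 : ∫⁻ x : Ω, ‖φ x‖ₑ ^ 2 ∂ν = ENNReal.ofReal (∫ x, testBCF φ x * testBCF φ x ∂ν) := by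
    rw [ofReal_integral_eq_lintegral_ofReal (integrable_mul ν _ _)
      (Eventually.of_forall fun p => mul_self_nonneg _)]
    refine lintegral_congr fun p => ?_
    rw [← ofReal_norm, ← ENNReal.ofReal_pow (norm_nonneg _), Real.norm_eq_abs, sq_abs, sq]
    rfl
  have n1 := integral_nonneg (μ := μ) (f := fun p : Ω × Ω =>
    (testBCF φ p.1 - testBCF φ p.2) * (testBCF φ p.1 - testBCF φ p.2)) fun p => mul_self_nonneg _
  have n2 := integral_nonneg (μ := ν) (f := fun x : Ω => testBCF φ x * testBCF φ x)
    fun p => mul_self_nonneg _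
  rw [formValue, h1, h2, H10.dirichlet_eq, ← ENNReal.ofReal_add n1 n2,
    ← ENNReal.ofReal_add (add_nonneg n1 n2) (sq_nonneg _)]
  rfl

variable {μ ν} {F : H10 Ω → ℝ≥0}

theorem IsRepresented.coe_eq (hF : IsRepresented μ ν F) (φ : 𝓓(Ω, ℝ)) :
    (F (H10.ofTest φ) : ℝ) =
      cform μ ν (testBCF φ) (testBCF φ) + ‖H10.gradL (H10.ofTest φ)‖ ^ 2 := by
  have h := hF.rep φ
  rw [formValue_test] at h
  have h0 : 0 ≤ cform μ ν (testBCF φ) (testBCF φ) + ‖H10.gradL (H10.ofTest φ)‖ ^ 2 :=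
    add_nonneg (add_nonneg (integral_nonneg fun p => mul_self_nonneg _)
      (integral_nonneg fun p => mul_self_nonneg _)) (sq_nonneg _)
  have := congrArg ENNReal.toReal h
  rwa [ENNReal.coe_toReal, ENNReal.toReal_ofReal h0] at this

/-- First-order perturbation. `F` of `φ + t • g n` is asymptotically at least `F` of `φ`, while the
Dirichlet parts converge and the term quadratic in `g n` is at most `t² K`. So the linear term `2 t
cform` cannot be much below `-t² K`, for either sign of `t`. -/
theorem IsRepresented.tendsto_cform (hF : IsRepresented μ ν F) (φ : 𝓓(Ω, ℝ)) {g : ℕ → 𝓓(Ω, ℝ)}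
    {C : ℝ} (hC : ∀ n x, |g n x| ≤ C) (hg : Tendsto (fun n => H10.ofTest (g n)) atTop (𝓝 0)) :
    Tendsto (fun n => cform μ ν (testBCF φ) (testBCF (g n))) atTop (𝓝 0) := by
  set K : ℝ := (2 * C) ^ 2 * μ.real Set.univ + C ^ 2 * ν.real Set.univ with hK
  have hK0 : 0 ≤ K := by positivity
  -- In `K + 2`, one unit is the slack `t²` in the Dirichlet integrals and the other the slack `t²`
  -- in lower semicontinuity.
  have key : ∀ t : ℝ, t ≠ 0 → ∀ᶠ n in atTop,
      -(t ^ 2 * (K + 2)) < 2 * t * cform μ ν (testBCF φ) (testBCF (g n)) := by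
    intro t ht
    have ht2 : 0 < t ^ 2 := by positivity
    have hlim : Tendsto (fun n => H10.ofTest (φ + t • g n)) atTop (𝓝 (H10.ofTest φ)) := by
      have := (hg.const_smul t).const_add (H10.ofTest φ)
      simpa [H10.ofTest_add, H10.ofTest_smul] using this
    have hD : ∀ᶠ n in atTop, ‖H10.gradL (H10.ofTest (φ + t • g n))‖ ^ 2 <
        ‖H10.gradL (H10.ofTest φ)‖ ^ 2 + t ^ 2 :=
      (((H10.gradL.continuous.tendsto _).comp hlim).norm.pow 2).eventually_lt_const (by linarith)
    have hFl : ∀ᶠ n in atTop, (F (H10.ofTest φ) : ℝ) - t ^ 2 < F (H10.ofTest (φ + t • g n)) := by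
      have hl : LowerSemicontinuous fun u => (F u : ℝ) := fun u y hy => by
        rcases lt_or_ge y 0 with h | h
        · exact Eventually.of_forall fun v => h.trans_le (F v).2
        · have := hF.lsc u ⟨y, h⟩ (by exact_mod_cast hy)
          exact this.mono fun v hv => by exact_mod_cast hv
      exact hlim.eventually (hl _ _ (by linarith))
    filter_upwards [hD, hFl] with n h1 h2
    rw [hF.coe_eq, hF.coe_eq] at h2
    have e : testBCF (φ + t • g n) = testBCF φ + t • testBCF (g n) := rfl
    rw [e, cform_add_smul_self] at h2
    have h3 : cform μ ν (testBCF (g n)) (testBCF (g n)) ≤ K :=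
      cform_self_le μ ν fun x => hC n x
    have h4 := mul_le_mul_of_nonneg_left h3 ht2.le
    linarith
  rw [Metric.tendsto_atTop']
  intro ε hε
  -- With this choice `t² (K + 2) = t ε`, so `key` at `t` and `-t` confines the cross term to
  -- `(-ε/2, ε/2)`.
  set t : ℝ := ε / (K + 2) with htd
  have ht : 0 < t := by positivity
  have htK : t * (K + 2) = ε := by rw [htd]; field_simp
  obtain ⟨N, hN⟩ := eventually_atTop.1 ((key t ht.ne').and (key (-t) (by simpa using ht.ne')))
  refine ⟨N, fun n hn => ?_⟩
  obtain ⟨h1, h2⟩ := hN n hn.le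
  rw [Real.dist_eq, sub_zero, abs_lt]
  have e1 : t ^ 2 * (K + 2) = t * ε := by rw [← htK]; ring
  rw [e1] at h1
  rw [neg_sq, e1] at h2
  constructor <;> nlinarith

end Form

/-! ### The measure `mass μ ν` along test functions tending to zero. -/

section Mass

variable {Ω : Opens (Euc d)} (μ : Measure (Ω × Ω)) (ν : Measure Ω)

/-- The sum of `ν` and the two marginals of `μ`. -/
def mass : Measure Ω := ν + (μ.map Prod.fst + μ.map Prod.snd)

instance [IsFiniteMeasure μ] [IsFiniteMeasure ν] : IsFiniteMeasure (mass μ ν) := by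
  unfold mass; infer_instance

theorem integral_mass [IsFiniteMeasure μ] [IsFiniteMeasure ν]
    (f : BoundedContinuousFunction Ω ℝ) :
    ∫ x, f x ∂(mass μ ν) = ∫ x, f x ∂ν + ∫ p : Ω × Ω, (f p.1 + f p.2) ∂μ := by
  have h1 : Integrable (fun p : Ω × Ω => f p.1) μ :=
    (f.compContinuous ⟨Prod.fst, continuous_fst⟩).integrable μ
  have h2 : Integrable (fun p : Ω × Ω => f p.2) μ :=
    (f.compContinuous ⟨Prod.snd, continuous_snd⟩).integrable μ
  rw [mass, integral_add_measure (f.integrable ν)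
    ((f.integrable _).add_measure (f.integrable _)),
    integral_add_measure (f.integrable _) (f.integrable _),
    integral_map measurable_fst.aemeasurable f.continuous.aestronglyMeasurable,
    integral_map measurable_snd.aemeasurable f.continuous.aestronglyMeasurable,
    integral_add h1 h2]

variable {μ ν}

theorem ae_of_ae_mass {P : Ω → Prop} (h : ∀ᵐ x ∂(mass μ ν), P x) :
    (∀ᵐ x ∂ν, P x) ∧ ∀ᵐ p ∂μ, P p.1 ∧ P p.2 := by
  rw [mass, ae_add_measure_iff, ae_add_measure_iff] at h
  exact ⟨h.1, (ae_of_ae_map measurable_fst.aemeasurable h.2.1).and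
    (ae_of_ae_map measurable_snd.aemeasurable h.2.2)⟩

theorem exists_isCompact_measure_diff_lt (m : Measure Ω) [IsFiniteMeasure m] {E : Set (Euc d)}
    (hE : MeasurableSet E) {ε : ℝ≥0∞} (hε : ε ≠ 0) :
    ∃ K ⊆ E, IsCompact K ∧ m {x : Ω | (x : Euc d) ∈ E ∧ (x : Euc d) ∉ K} < ε := by
  obtain ⟨K, hKE, hK, h⟩ := hE.exists_isCompact_sdiff_lt (μ := m.map Subtype.val)
    (measure_ne_top _ _) hε
  rw [Measure.map_apply measurable_subtype_coe (hE.diff hK.measurableSet)] at h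
  exact ⟨K, hKE, hK, h⟩

/-- Continuity from above of the finite measure `μ`: the neighbourhoods of the diagonal decrease to
the diagonal itself. -/
theorem exists_measure_dist_lt [IsFiniteMeasure μ] (hdiag : μ {p : Ω × Ω | p.1 = p.2} = 0)
    {ε : ℝ≥0∞} (hε : ε ≠ 0) :
    ∃ δ : ℝ, 0 < δ ∧ μ {p : Ω × Ω | dist p.1 p.2 < δ} < ε := by
  have hm : ∀ n : ℕ, MeasurableSet {p : Ω × Ω | dist p.1 p.2 < 1 / ((n : ℝ) + 1)} := fun n =>
    (isOpen_lt continuous_dist continuous_const).measurableSet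
  have h := tendsto_measure_iInter_atTop (μ := μ) (fun n => (hm n).nullMeasurableSet)
    (fun m n hmn p (hp : dist p.1 p.2 < _) => lt_of_lt_of_le hp
      (Nat.one_div_le_one_div (α := ℝ) hmn)) ⟨0, measure_ne_top _ _⟩
  have hI : (⋂ n : ℕ, {p : Ω × Ω | dist p.1 p.2 < 1 / ((n : ℝ) + 1)}) = {p | p.1 = p.2} := by
    ext p
    simp only [Set.mem_iInter, Set.mem_ofPred_eq]
    constructor
    · intro hp
      refine dist_le_zero.1 (ge_of_tendsto' tendsto_one_div_add_atTop_nhds_zero_nat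
        fun n => (hp n).le)
    · intro hp n
      rw [hp, dist_self]
      positivity
  rw [hI, hdiag] at h
  obtain ⟨n, hn⟩ := (h.eventually_lt_const (pos_iff_ne_zero.2 hε)).exists
  exact ⟨_, by positivity, hn⟩

variable [IsFiniteMeasure μ] [IsFiniteMeasure ν] {F : H10 Ω → ℝ≥0}

/-- `IsRepresented.tendsto_cform` is used twice, for `φ` against `φ * w n` and for `φ²` against `w
n`. By `cform_mul_sub` the combination is the sum of the two integrals, both nonnegative, so each
tends to `0`. -/
theorem IsRepresented.tendsto_integral_sq (hF : IsRepresented μ ν F) (φ : 𝓓(Ω, ℝ))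
    {w : ℕ → 𝓓(Ω, ℝ)} (hw : ∀ n x, 0 ≤ w n x ∧ w n x ≤ 1)
    (hlim : Tendsto (fun n => H10.ofTest (w n)) atTop (𝓝 0)) :
    Tendsto (fun n => ∫ p : Ω × Ω, (φ p.1 - φ p.2) ^ 2 * (w n p.1 + w n p.2) ∂μ) atTop (𝓝 0) ∧
      Tendsto (fun n => ∫ x : Ω, φ x ^ 2 * w n x ∂ν) atTop (𝓝 0) := by
  obtain ⟨C, hC, hC1, -⟩ := exists_test_bound φ
  obtain ⟨D, hD, hD1⟩ := exists_norm_ofTest_mul_le φ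
  have hw1 : ∀ n x, |w n x| ≤ 1 := fun n x => abs_le.2 ⟨by linarith [(hw n x).1], (hw n x).2⟩
  have t1 := hF.tendsto_cform φ (g := fun n => mulTest φ (test_contDiff φ) (w n)) (C := C)
    (fun n x => by
      simp only [mulTest, mkTest_apply, abs_mul]
      exact (mul_le_mul (hC1 x) (hw1 n x) (abs_nonneg _) hC.le).trans (by linarith))
    (squeeze_zero_norm (fun n => hD1 (w n)) (by simpa using hlim.norm.const_mul D))
  have t2 := hF.tendsto_cform (mulTest φ (test_contDiff φ) φ) (g := w) hw1 hlim
  have t := (t1.sub (t2.div_const 2)).mul_const 2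
  simp only [zero_div, sub_zero, zero_mul] at t
  have e : ∀ n, (cform μ ν (testBCF φ) (testBCF (mulTest φ (test_contDiff φ) (w n))) -
      cform μ ν (testBCF (mulTest φ (test_contDiff φ) φ)) (testBCF (w n)) / 2) * 2 =
      (∫ p : Ω × Ω, (φ p.1 - φ p.2) ^ 2 * (w n p.1 + w n p.2) ∂μ) +
        ∫ x : Ω, φ x ^ 2 * w n x ∂ν := fun n => by
    have := cform_mul_sub μ ν (testBCF φ) (testBCF (w n))
    simp only [testBCF_apply] at this
    have e1 : testBCF (mulTest φ (test_contDiff φ) (w n)) = testBCF φ * testBCF (w n) := by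
      ext x; rfl
    have e2 : testBCF (mulTest φ (test_contDiff φ) φ) = testBCF φ * testBCF φ := by
      ext x; rfl
    rw [e1, e2, this]
    ring
  simp only [e] at t
  have p1 : ∀ n, 0 ≤ ∫ p : Ω × Ω, (φ p.1 - φ p.2) ^ 2 * (w n p.1 + w n p.2) ∂μ := fun n =>
    integral_nonneg fun p => mul_nonneg (sq_nonneg _) (add_nonneg (hw n _).1 (hw n _).1)
  have p2 : ∀ n, 0 ≤ ∫ x : Ω, φ x ^ 2 * w n x ∂ν := fun n =>
    integral_nonneg fun p => mul_nonneg (sq_nonneg _) (hw n _).1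
  exact ⟨squeeze_zero p1 (fun n => by linarith [p2 n]) t,
    squeeze_zero p2 (fun n => by linarith [p1 n]) t⟩

/-- The weights `φ²` and `(φ x - φ y)²` must be removed. For `ν` a cutoff equal to `1` on a large
compact `K` suffices. For `μ` the squared differences of the localized coordinates add up to `|x -
y|²` on `K × K`, which is bounded below away from the diagonal. The exceptional sets have small
measure. -/
theorem IsRepresented.tendsto_integral_mass (hF : IsRepresented μ ν F)
    {w : ℕ → 𝓓(Ω, ℝ)} (hw : ∀ n x, 0 ≤ w n x ∧ w n x ≤ 1)
    (hlim : Tendsto (fun n => H10.ofTest (w n)) atTop (𝓝 0)) :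
    Tendsto (fun n => ∫ x : Ω, w n x ∂(mass μ ν)) atTop (𝓝 0) := by
  have hpos : ∀ n, 0 ≤ ∫ x : Ω, w n x ∂(mass μ ν) := fun n => integral_nonneg fun x => (hw n x).1
  rw [Metric.tendsto_atTop']
  intro ε hε
  -- The final estimate costs less than `6 η`: one for each of the two limits, two for the
  -- complement of `K`, two for the strip `S` around the diagonal.
  set η : ℝ := ε / 8 with hη
  have hη0 : 0 < η := by positivity
  obtain ⟨K, hKΩ, hK, hmK⟩ := exists_isCompact_measure_diff_lt (mass μ ν) Ω.isOpen.measurableSet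
    (ENNReal.ofReal_pos.2 hη0).ne'
  obtain ⟨δ, hδ, hμδ⟩ := exists_measure_dist_lt hF.diag (ENNReal.ofReal_pos.2 hη0).ne'
  obtain ⟨χ, hχ, hχc, hχs, hχ1, hχ01⟩ := exists_cutoff hK Ω.isOpen hKΩ
  let X : 𝓓(Ω, ℝ) := mkTest χ hχ hχc hχs
  -- The coordinate functions multiplied by the cutoff; they agree with the coordinates on `K`.
  let P : Fin d → 𝓓(Ω, ℝ) := fun i => mulTest (fun x => x i)
    (EuclideanSpace.proj (𝕜 := ℝ) i : Euc d →L[ℝ] ℝ).contDiff X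
  have t1 := (hF.tendsto_integral_sq X hw hlim).2
  have t2 := tendsto_finsetSum Finset.univ fun i _ => (hF.tendsto_integral_sq (P i) hw hlim).1
  simp only [Finset.sum_const_zero] at t2
  have t3 := t2.const_mul ((δ ^ 2)⁻¹)
  simp only [mul_zero] at t3
  set A : Set Ω := {x | (x : Euc d) ∉ K} with hA
  have hAm : MeasurableSet A := (hK.measurableSet.preimage measurable_subtype_coe).compl
  have hA' : A = {x : Ω | (x : Euc d) ∈ (Ω : Set (Euc d)) ∧ (x : Euc d) ∉ K} := by
    ext x; simp [hA]
  set S : Set (Ω × Ω) := {p | dist p.1 p.2 < δ} with hS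
  have hSm : MeasurableSet S := (isOpen_lt continuous_dist continuous_const).measurableSet
  have hmA : (mass μ ν).real A < η := by
    rw [hA']
    exact ENNReal.toReal_lt_of_lt_ofReal hmK
  have hmS : μ.real S < η := ENNReal.toReal_lt_of_lt_ofReal hμδ
  have hAsum : (mass μ ν).real A =
      ν.real A + (μ.real (Prod.fst ⁻¹' A) + μ.real (Prod.snd ⁻¹' A)) := by
    simp only [Measure.real, mass, Measure.add_apply]
    rw [Measure.map_apply measurable_fst hAm, Measure.map_apply measurable_snd hAm,
      ENNReal.toReal_add (measure_ne_top _ _) (by finiteness),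
      ENNReal.toReal_add (measure_ne_top _ _) (measure_ne_top _ _)]
  have hnn : 0 ≤ ν.real A ∧ 0 ≤ μ.real (Prod.fst ⁻¹' A) ∧ 0 ≤ μ.real (Prod.snd ⁻¹' A) :=
    ⟨measureReal_nonneg, measureReal_nonneg, measureReal_nonneg⟩
  have b1 : ∀ n, ∫ x : Ω, w n x ∂ν ≤ (∫ x : Ω, X x ^ 2 * w n x ∂ν) + ν.real A := fun n => by
    have i1 : Integrable (fun x : Ω => X x ^ 2 * w n x) ν :=
      (testBCF X ^ 2 * testBCF (w n)).integrable ν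
    have i2 : Integrable (A.indicator fun _ => (1 : ℝ)) ν := (integrable_const _).indicator hAm
    have : ∫ x, A.indicator (fun _ => (1 : ℝ)) x ∂ν = ν.real A := by
      rw [integral_indicator hAm]; simp
    rw [← this, ← integral_add i1 i2]
    refine integral_mono ((testBCF (w n)).integrable ν) (i1.add i2) fun x => ?_
    by_cases hx : x ∈ A
    · simp only [Set.indicator_of_mem hx]
      nlinarith [(hw n x).2, mul_nonneg (sq_nonneg (X x)) (hw n x).1]
    · simp only [Set.indicator_of_notMem hx]
      have : X x = 1 := hχ1 x (by simpa [hA] using hx)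
      rw [this]; simp
  have b2 : ∀ n, ∫ p : Ω × Ω, (w n p.1 + w n p.2) ∂μ ≤
      (δ ^ 2)⁻¹ * (∑ i, ∫ p : Ω × Ω, (P i p.1 - P i p.2) ^ 2 * (w n p.1 + w n p.2) ∂μ) +
        2 * (μ.real (Prod.fst ⁻¹' A) + μ.real (Prod.snd ⁻¹' A) + μ.real S) := fun n => by
    have i1 : ∀ i ∈ Finset.univ, Integrable
        (fun p : Ω × Ω => (P i p.1 - P i p.2) ^ 2 * (w n p.1 + w n p.2)) μ := fun i _ =>
      (diffBCF (testBCF (P i)) ^ 2 * sumBCF (testBCF (w n))).integrable μ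
    have hm1 : MeasurableSet (Prod.fst ⁻¹' A : Set (Ω × Ω)) := measurable_fst hAm
    have hm2 : MeasurableSet (Prod.snd ⁻¹' A : Set (Ω × Ω)) := measurable_snd hAm
    have ii : ∀ B : Set (Ω × Ω), MeasurableSet B →
        Integrable (B.indicator fun _ => (1 : ℝ)) μ ∧
          ∫ x, B.indicator (fun _ => (1 : ℝ)) x ∂μ = μ.real B := fun B hB =>
      ⟨(integrable_const _).indicator hB, by rw [integral_indicator hB]; simp⟩
    have j1 : Integrable (fun p : Ω × Ω => (δ ^ 2)⁻¹ *
        ∑ i, (P i p.1 - P i p.2) ^ 2 * (w n p.1 + w n p.2)) μ :=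
      (integrable_finsetSum _ i1).const_mul _
    have j2 : Integrable (fun p : Ω × Ω => (Prod.fst ⁻¹' A).indicator (fun _ => (1 : ℝ)) p +
        (Prod.snd ⁻¹' A).indicator (fun _ => (1 : ℝ)) p) μ := (ii _ hm1).1.add (ii _ hm2).1
    have j3 : Integrable (fun p : Ω × Ω => 2 * ((Prod.fst ⁻¹' A).indicator (fun _ => (1 : ℝ)) p +
        (Prod.snd ⁻¹' A).indicator (fun _ => (1 : ℝ)) p + S.indicator (fun _ => (1 : ℝ)) p)) μ :=
      (j2.add (ii _ hSm).1).const_mul 2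
    rw [← integral_finsetSum _ i1, ← integral_const_mul, ← (ii _ hm1).2, ← (ii _ hm2).2,
      ← (ii _ hSm).2, ← integral_add (ii _ hm1).1 (ii _ hm2).1, ← integral_add j2 (ii _ hSm).1,
      ← integral_const_mul, ← integral_add j1 j3]
    refine integral_mono ((sumBCF (testBCF (w n))).integrable μ) (j1.add j3) fun p => ?_
    have hs0 : 0 ≤ w n p.1 + w n p.2 := add_nonneg (hw n _).1 (hw n _).1
    have hs2 : w n p.1 + w n p.2 ≤ 2 := by linarith [(hw n p.1).2, (hw n p.2).2]
    have hq : 0 ≤ (δ ^ 2)⁻¹ * ∑ i, (P i p.1 - P i p.2) ^ 2 * (w n p.1 + w n p.2) :=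
      mul_nonneg (by positivity) (Finset.sum_nonneg fun i _ => mul_nonneg (sq_nonneg _) hs0)
    have hi : ∀ B : Set (Ω × Ω), 0 ≤ B.indicator (fun _ => (1 : ℝ)) p := fun B =>
      Set.indicator_nonneg (fun _ _ => zero_le_one) p
    have k1 := hi (Prod.fst ⁻¹' A)
    have k2 := hi (Prod.snd ⁻¹' A)
    have k3 := hi S
    change w n p.1 + w n p.2 ≤ _ + _
    by_cases h1 : p ∈ Prod.fst ⁻¹' A
    · rw [Set.indicator_of_mem h1] at k1 ⊢; linarith
    by_cases h2 : p ∈ Prod.snd ⁻¹' A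
    · rw [Set.indicator_of_mem h2] at k2 ⊢; linarith
    by_cases h3 : p ∈ S
    · rw [Set.indicator_of_mem h3] at k3 ⊢; linarith
    have x1 : χ p.1 = 1 := hχ1 _ (by simpa [hA] using h1)
    have x2 : χ p.2 = 1 := hχ1 _ (by simpa [hA] using h2)
    have hdist : δ ≤ dist p.1 p.2 := by simpa [hS] using h3
    have hsum : ∑ i, (P i p.1 - P i p.2) ^ 2 * (w n p.1 + w n p.2) =
        dist p.1 p.2 ^ 2 * (w n p.1 + w n p.2) := by
      rw [← Finset.sum_mul, Subtype.dist_eq, EuclideanSpace.dist_eq,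
        Real.sq_sqrt (Finset.sum_nonneg fun i _ => sq_nonneg _)]
      congr 1
      refine Finset.sum_congr rfl fun i _ => ?_
      simp [P, X, mulTest, x1, x2, Real.dist_eq, sq_abs]
    rw [hsum]
    have : w n p.1 + w n p.2 ≤ (δ ^ 2)⁻¹ * (dist p.1 p.2 ^ 2 * (w n p.1 + w n p.2)) := by
      rw [← mul_assoc]
      refine le_mul_of_one_le_left hs0 ?_
      rw [inv_mul_eq_div, one_le_div (by positivity)]
      exact pow_le_pow_left₀ hδ.le hdist 2
    linarith
  obtain ⟨N, hN⟩ := eventually_atTop.1 ((t1.eventually_lt_const hη0).and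
    (t3.eventually_lt_const hη0))
  refine ⟨N, fun n hn => ?_⟩
  rw [Real.dist_eq, sub_zero, abs_of_nonneg (hpos n)]
  have := integral_mass μ ν (testBCF (w n))
  simp only [testBCF_apply] at this
  rw [this]
  have h1 := b1 n
  have h2 := b2 n
  obtain ⟨h3, h4⟩ := hN n hn.le
  linarith

/-- A sequence of counterexamples with gradients tending to `0` would, by Poincaré, tend to `0` in
`H10 Ω`, contradicting the sequential statement. -/
theorem IsRepresented.exists_integral_mass_le (hF : IsRepresented μ ν F) (hd : 1 ≤ d)
    (hΩ : Bornology.IsBounded (Ω : Set (Euc d))) {ε : ℝ} (hε : 0 < ε) :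
    ∃ δ : ℝ, 0 < δ ∧ ∀ w : 𝓓(Ω, ℝ), (∀ x, 0 ≤ w x ∧ w x ≤ 1) →
      ‖H10.gradL (H10.ofTest w)‖ ≤ δ → ∫ x : Ω, w x ∂(mass μ ν) ≤ ε := by
  by_contra! h
  choose w hw1 hw2 hw3 using fun n : ℕ => h (1 / ((n : ℝ) + 1)) (by positivity)
  obtain ⟨C, hC, hC'⟩ := H10.exists_norm_le (Ω := Ω) hd hΩ
  have hlim : Tendsto (fun n => H10.ofTest (w n)) atTop (𝓝 0) := by
    refine squeeze_zero_norm (a := fun n : ℕ => C * (1 / ((n : ℝ) + 1))) (fun n => ?_) ?_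
    · exact (hC' _).trans (mul_le_mul_of_nonneg_left (hw2 n) hC.le)
    · simpa using (tendsto_one_div_add_atTop_nhds_zero_nat (𝕜 := ℝ)).const_mul C
  obtain ⟨n, hn⟩ := ((hF.tendsto_integral_mass hw1 hlim).eventually_lt_const hε).exists
  exact absurd hn (not_lt.2 (hw3 n).le)

end Mass

/-! ### Mass of open sets controlled by energy; sets of zero capacity. -/

theorem Lp.norm_le_add_mul {α E G : Type*} [MeasurableSpace α] {m : Measure α}
    [NormedAddCommGroup E] [NormedAddCommGroup G] {f g : Lp E 2 m} {h : Lp G 2 m} {C : ℝ}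
    (hC : 0 ≤ C) (hle : ∀ᵐ x ∂m, ‖f x‖ ≤ ‖g x‖ + C * ‖h x‖) : ‖f‖ ≤ ‖g‖ + C * ‖h‖ := by
  have h1 : eLpNorm f 2 m ≤ eLpNorm g 2 m + ENNReal.ofReal C * eLpNorm h 2 m := by
    calc eLpNorm f 2 m ≤ eLpNorm ((fun x => ‖g x‖) + fun x => C * ‖h x‖) 2 m :=
          eLpNorm_mono_ae_real hle
      _ ≤ eLpNorm (fun x => ‖g x‖) 2 m + eLpNorm (fun x => C * ‖h x‖) 2 m :=
          eLpNorm_add_le (Lp.aestronglyMeasurable g).norm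
            ((Lp.aestronglyMeasurable h).norm.const_mul C) (by norm_num)
      _ ≤ _ := by
          rw [eLpNorm_norm]
          gcongr
          refine eLpNorm_le_mul_eLpNorm_of_ae_le_mul (Eventually.of_forall fun x => ?_) 2
          simp [abs_of_nonneg hC]
  have h2 := ENNReal.toReal_mono
    (ENNReal.add_ne_top.2 ⟨Lp.eLpNorm_ne_top g, ENNReal.mul_ne_top ENNReal.ofReal_ne_top
      (Lp.eLpNorm_ne_top h)⟩) h1
  rwa [ENNReal.toReal_add (Lp.eLpNorm_ne_top g) (ENNReal.mul_ne_top ENNReal.ofReal_ne_top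
    (Lp.eLpNorm_ne_top h)), ENNReal.toReal_mul, ENNReal.toReal_ofReal hC, ← Lp.norm_def,
    ← Lp.norm_def, ← Lp.norm_def] at h2

section OpenSets

variable {Ω : Opens (Euc d)} {μ : Measure (Ω × Ω)} {ν : Measure Ω} [IsFiniteMeasure μ]
  [IsFiniteMeasure ν] {F : H10 Ω → ℝ≥0}

theorem ae_of_ae_restrict_inter {E : Set (Euc d)} (hE : IsOpen E) {P : Euc d → Prop}
    (h : ∀ᵐ x ∂(volume.restrict (E ∩ Ω)), P x) : ∀ᵐ x ∂(leb Ω), x ∈ E → P x := by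
  rwa [← ae_restrict_iff' hE.measurableSet, Measure.restrict_restrict hE.measurableSet]

/-- Near a compact subset of an open set on which `z ≥ 1` one can pass to test functions. -/
theorem exists_test_eq_one {z : H10 Ω} {E K : Set (Euc d)} (hE : IsOpen E) (hEΩ : E ⊆ Ω)
    (hz : ∀ᵐ x ∂(leb Ω), x ∈ E → 1 ≤ z.fn x) (hK : IsCompact K) (hKE : K ⊆ E) {C δ : ℝ}
    (hC : ∀ t, |deriv Real.smoothTransition t| ≤ C) (hδ : C * ‖H10.gradL z‖ < δ) :
    ∃ w : 𝓓(Ω, ℝ), (∀ x, 0 ≤ w x ∧ w x ≤ 1) ∧ (∀ x ∈ K, w x = 1) ∧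
      ‖H10.gradL (H10.ofTest w)‖ ≤ δ := by
  obtain ⟨η, hη, hηc, hηs, hη1, hη01⟩ := exists_cutoff hK hE hKE
  obtain ⟨u, hu⟩ := H10.exists_seq_ofTest z
  have hS0 : Real.smoothTransition 0 = 0 := Real.smoothTransition.zero_of_nonpos le_rfl
  obtain ⟨y, ns, hy1, hy2, -, hlim⟩ := H10.exists_comp_tendsto smoothTransition_contDiff hS0 hC hu
  set a : ℕ → 𝓓(Ω, ℝ) := fun n => compTest _ smoothTransition_contDiff hS0 (u (ns n)) with ha
  have ha01 : ∀ n x, 0 ≤ a n x ∧ a n x ≤ 1 := fun n x =>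
    ⟨Real.smoothTransition.nonneg _, Real.smoothTransition.le_one _⟩
  let H : 𝓓(Ω, ℝ) := mkTest η hη hηc (hηs.trans hEΩ)
  -- Here `1 - w n = (1 - a n) * (1 - η)`, so `w n` stays in `[0, 1]` and equals `1` on `K`. Its
  -- gradient is `(1 - η)∇(a n) + (1 - a n)∇η`. The last term is small in `L²` because `∇η` lives in
  -- `E`, where the limit `y` of `a n` equals `1`.
  let w : ℕ → 𝓓(Ω, ℝ) := fun n =>
    a n + mulTest (fun x => 1 - a n x) (contDiff_const.sub (test_contDiff (a n))) H
  have hw : ∀ n x, w n x = a n x + (1 - a n x) * η x := fun n x => rfl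
  obtain ⟨D, hD, -, hD2⟩ := exists_test_bound H
  have hy1' : ∀ᵐ x ∂(leb Ω), x ∈ E → y.fn x = 1 := by
    filter_upwards [hy1, hz] with x hx hx' hxE
    rw [hx, Real.smoothTransition.one_of_one_le (hx' hxE)]
  have hyn : ‖H10.gradL y‖ ≤ C * ‖H10.gradL z‖ := by
    refine Lp.norm_le_mul_norm_of_ae_le_mul ?_
    filter_upwards [hy2] with x hx
    rw [H10.coe_gradL, hx, norm_smul]
    exact mul_le_mul_of_nonneg_right (hC _) (norm_nonneg _)
  have hle : ∀ n, ‖H10.gradL (H10.ofTest (w n))‖ ≤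
      ‖H10.gradL (H10.ofTest (a n))‖ + D * ‖H10.fnL (H10.ofTest (a n) - y)‖ := fun n => by
    refine Lp.norm_le_add_mul hD.le ?_
    filter_upwards [H10.ofTest_grad (w n), H10.ofTest_grad (a n), H10.ofTest_fn (a n),
      H10.fn_sub (H10.ofTest (a n)) y, hy1'] with x h1 h2 h3 h4 h5
    simp only [H10.coe_gradL, H10.coe_fnL, h1, h2, h4, Pi.sub_apply, h3]
    have hda := testFunction_differentiable (a n) x
    have hdH := testFunction_differentiable H x
    have hgrad : ∇ (w n : Euc d → ℝ) x =
        (1 - η x) • ∇ (a n : Euc d → ℝ) x + (1 - a n x) • ∇ (H : Euc d → ℝ) x := by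
      have e : (w n : Euc d → ℝ) = fun x => 1 - (1 - a n x) * (1 - H x) := by
        funext x
        rw [hw]
        change a n x + (1 - a n x) * η x = 1 - (1 - a n x) * (1 - η x)
        ring
      have f1 := (hda.hasFDerivAt.const_sub 1).mul (hdH.hasFDerivAt.const_sub 1)
      have f2 : fderiv ℝ (w n : Euc d → ℝ) x =
          (1 - η x) • fderiv ℝ (a n) x + (1 - a n x) • fderiv ℝ H x := by
        rw [e]
        refine (f1.const_sub 1).fderiv.trans ?_
        change -((1 - a n x) • -fderiv ℝ H x + (1 - η x) • -fderiv ℝ (a n) x) = _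
        simp only [smul_neg, neg_add, neg_neg]
        abel
      simp only [gradient, f2, map_add, map_smulₛₗ]
      simp
    rw [hgrad]
    refine (norm_add_le _ _).trans (add_le_add ?_ ?_)
    · rw [norm_smul]
      refine mul_le_of_le_one_left (norm_nonneg _) ?_
      rw [Real.norm_eq_abs, abs_le]
      constructor <;> linarith [(hη01 x).1, (hη01 x).2]
    · rw [norm_smul, mul_comm]
      by_cases hx : x ∈ E
      · rw [h5 hx, ← norm_neg (1 - a n x), neg_sub]
        exact mul_le_mul_of_nonneg_right (hD2 x) (norm_nonneg _)
      · have : ∇ (H : Euc d → ℝ) x = 0 := by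
          have h : fderiv ℝ η x = 0 :=
            image_eq_zero_of_notMem_tsupport fun h => hx (hηs (tsupport_fderiv_subset ℝ h))
          change ∇ η x = 0
          simp [gradient, h]
        rw [this, norm_zero, zero_mul]
        positivity
  have hlim2 : Tendsto (fun n => ‖H10.gradL (H10.ofTest (a n))‖ +
      D * ‖H10.fnL (H10.ofTest (a n) - y)‖) atTop (𝓝 (‖H10.gradL y‖ + D * ‖H10.fnL (y - y)‖)) :=
    (((H10.gradL.continuous.tendsto _).comp hlim).norm).add
      ((((H10.fnL.continuous.tendsto _).comp (hlim.sub_const y)).norm).const_mul D)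
  rw [sub_self, map_zero, norm_zero, mul_zero, add_zero] at hlim2
  obtain ⟨n, hn⟩ := (hlim2.eventually_lt_const (hyn.trans_lt hδ)).exists
  refine ⟨w n, fun x => ?_, fun x hx => ?_, (hle n).trans hn.le⟩
  · rw [hw]
    have h1 := ha01 n x
    have h2 := hη01 x
    have h3 := mul_nonneg (sub_nonneg.2 h1.2) h2.1
    have h4 := mul_nonneg (sub_nonneg.2 h1.2) (sub_nonneg.2 h2.2)
    constructor <;> nlinarith
  · rw [hw, hη1 x hx]
    ring

/-- Quantitative absolute continuity of `mass μ ν` with respect to capacity. Inner regularity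
replaces `E ∩ Ω` by a compact `K`, on which a test function of small energy equals `1`; its integral
bounds the mass of `K`. -/
theorem IsRepresented.exists_mass_open_le (hF : IsRepresented μ ν F) (hd : 1 ≤ d)
    (hΩ : Bornology.IsBounded (Ω : Set (Euc d))) {ε : ℝ} (hε : 0 < ε) :
    ∃ δ : ℝ, 0 < δ ∧ ∀ (z : H10 Ω) (E : Set (Euc d)), IsOpen E →
      (∀ᵐ x ∂(leb Ω), x ∈ E → 1 ≤ z.fn x) → ‖H10.gradL z‖ ≤ δ →
      mass μ ν {x : Ω | (x : Euc d) ∈ E} ≤ ENNReal.ofReal ε := by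
  obtain ⟨C, hC0, hC⟩ := exists_deriv_smoothTransition_le
  obtain ⟨δ, hδ, h⟩ := hF.exists_integral_mass_le hd hΩ (half_pos hε)
  -- Clamping `z` by the smooth transition multiplies the gradient by at most `C`; the factor `2`
  -- leaves the strict inequality that `exists_test_eq_one` needs.
  refine ⟨δ / (2 * C), by positivity, fun z E hE hz hzn => ?_⟩
  have hE' : IsOpen (E ∩ Ω) := hE.inter Ω.isOpen
  obtain ⟨K, hKE, hK, hmK⟩ := exists_isCompact_measure_diff_lt (mass μ ν) hE'.measurableSet
    (ENNReal.ofReal_pos.2 (half_pos hε)).ne'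
  obtain ⟨w, hw01, hwK, hwn⟩ := exists_test_eq_one hE' Set.inter_subset_right
    (hz.mono fun x hx hxE => hx hxE.1) hK hKE hC (δ := δ) (by
      calc C * ‖H10.gradL z‖ ≤ C * (δ / (2 * C)) := by gcongr
        _ = δ / 2 := by field_simp
        _ < δ := half_lt_self hδ)
  have hKm : MeasurableSet {x : Ω | (x : Euc d) ∈ K} :=
    hK.measurableSet.preimage measurable_subtype_coe
  have hK1 : (mass μ ν).real {x : Ω | (x : Euc d) ∈ K} ≤ ε / 2 := by
    refine le_trans ?_ (h w hw01 hwn)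
    have : ∫ x, ({x : Ω | (x : Euc d) ∈ K}).indicator (fun _ => (1 : ℝ)) x ∂(mass μ ν) =
        (mass μ ν).real {x : Ω | (x : Euc d) ∈ K} := by
      rw [integral_indicator hKm]; simp
    rw [← this]
    refine integral_mono ((integrable_const _).indicator hKm) ((testBCF w).integrable _)
      fun x => ?_
    by_cases hx : (x : Euc d) ∈ K
    · rw [Set.indicator_of_mem (by exact hx), hwK x hx]
    · rw [Set.indicator_of_notMem (by exact hx)]
      exact (hw01 x).1
  have hK2 : mass μ ν {x : Ω | (x : Euc d) ∈ K} ≤ ENNReal.ofReal (ε / 2) := by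
    rw [← ENNReal.ofReal_toReal (measure_ne_top (mass μ ν) {x : Ω | (x : Euc d) ∈ K})]
    exact ENNReal.ofReal_le_ofReal hK1
  calc mass μ ν {x : Ω | (x : Euc d) ∈ E}
      ≤ mass μ ν ({x : Ω | (x : Euc d) ∈ K} ∪ {x : Ω | (x : Euc d) ∈ E ∩ Ω ∧ (x : Euc d) ∉ K}) := by
        refine measure_mono fun x hx => ?_
        by_cases hxK : (x : Euc d) ∈ K
        · exact Or.inl hxK
        · exact Or.inr ⟨⟨hx, x.2⟩, hxK⟩
    _ ≤ _ := measure_union_le _ _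
    _ ≤ ENNReal.ofReal (ε / 2) + ENNReal.ofReal (ε / 2) := add_le_add hK2 hmK.le
    _ = ENNReal.ofReal ε := by
        rw [← ENNReal.ofReal_add (by positivity) (by positivity), add_halves]

theorem IsRepresented.mass_eq_zero (hF : IsRepresented μ ν F) (hd : 1 ≤ d)
    (hΩ : Bornology.IsBounded (Ω : Set (Euc d))) {A : Set (Euc d)} (hA : capacity Ω A = 0) :
    mass μ ν {x : Ω | (x : Euc d) ∈ A} = 0 := by
  refine le_antisymm (ENNReal.le_of_forall_pos_le_add fun ε hε _ => ?_) zero_le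
  rw [zero_add]
  obtain ⟨δ, hδ, h⟩ := hF.exists_mass_open_le hd hΩ (ε := ε) (by exact_mod_cast hε)
  have hlt : capacity Ω A < ENNReal.ofReal (δ ^ 2) := by
    rw [hA]; exact ENNReal.ofReal_pos.2 (by positivity)
  simp only [capacity, iInf_lt_iff] at hlt
  obtain ⟨u, ⟨U, hU, hAU, hu⟩, hlt⟩ := hlt
  rw [H10.dirichlet_eq, ENNReal.ofReal_lt_ofReal_iff (by positivity)] at hlt
  have := h u U hU (ae_of_ae_restrict_inter hU hu)
    ((sq_lt_sq₀ (norm_nonneg _) hδ.le).1 hlt).le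
  rw [ENNReal.ofReal_coe_nnreal] at this
  exact le_trans (measure_mono (fun x (hx : (x : Euc d) ∈ A) => hAU hx)) this

end OpenSets

/-! ### Ball means and the mean value inequality for superharmonic functions. -/

section BallMeans

variable {Ω : Opens (Euc d)}

/-- Rescaling to the unit ball fixes the domain, so that means can be differentiated in the radius
under the integral. -/
theorem setIntegral_ball_eq (f : Euc d → ℝ) (x : Euc d) {r : ℝ} (hr : 0 < r) :
    ∫ z in Metric.ball x r, f z = r ^ d * ∫ y in Metric.ball (0 : Euc d) 1, f (x + r • y) := by
  have h1 := Measure.setIntegral_comp_smul (volume : Measure (Euc d)) (fun z => f (x + z))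
    (R := r) (Metric.ball 0 1) hr.ne'
  rw [smul_unitBall_of_pos hr, finrank_euclideanSpace_fin, abs_of_pos (by positivity)] at h1
  have h2 := (measurePreserving_add_left (volume : Measure (Euc d)) x).setIntegral_preimage_emb
    (measurableEmbedding_addLeft x) f (Metric.ball x r)
  have h3 : (fun z => x + z) ⁻¹' Metric.ball x r = Metric.ball 0 r := by
    ext z; simp
  rw [h3] at h2
  rw [h1, h2, smul_eq_mul, mul_inv_cancel_left₀ (by positivity)]

theorem volume_real_ball_eq (x : Euc d) {r : ℝ} (hr : 0 < r) :
    volume.real (Metric.ball x r) = r ^ d * volume.real (Metric.ball (0 : Euc d) 1) := by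
  simpa using setIntegral_ball_eq (fun _ => 1) x hr

theorem volume_real_unitBall_pos : 0 < volume.real (Metric.ball (0 : Euc d) 1) :=
  ENNReal.toReal_pos (Metric.measure_ball_pos _ _ one_pos).ne' measure_ball_lt_top.ne

theorem average_ball_eq (f : Euc d → ℝ) (x : Euc d) {r : ℝ} (hr : 0 < r) :
    ⨍ z in Metric.ball x r, f z =
      (volume.real (Metric.ball (0 : Euc d) 1))⁻¹ *
        ∫ y in Metric.ball (0 : Euc d) 1, f (x + r • y) := by
  have := volume_real_unitBall_pos (d := d)
  rw [setAverage_eq, volume_real_ball_eq x hr, setIntegral_ball_eq f x hr, smul_eq_mul]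
  field_simp

/-- A mean over a ball inside `Ω` is an `L²` inner product with an indicator, hence continuous. -/
theorem tendsto_average_ball {u : ℕ → H10 Ω} {v : H10 Ω} (h : Tendsto u atTop (𝓝 v))
    {x : Euc d} {r : ℝ} (hx : Metric.ball x r ⊆ Ω) :
    Tendsto (fun n => ⨍ z in Metric.ball x r, (u n).fn z) atTop
      (𝓝 (⨍ z in Metric.ball x r, v.fn z)) := by
  have hm : leb Ω (Metric.ball x r) ≠ ⊤ :=
    ((Measure.restrict_apply_le _ _).trans_lt measure_ball_lt_top).ne
  have key : ∀ w : H10 Ω, ∫ z in Metric.ball x r, w.fn z =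
      inner ℝ (indicatorConstLp 2 measurableSet_ball hm (1 : ℝ)) (H10.fnL w) := fun w => by
    rw [L2.inner_indicatorConstLp_one, Measure.restrict_restrict measurableSet_ball,
      Set.inter_eq_left.2 hx]
    rfl
  simp only [setAverage_eq, key]
  exact (((continuous_const.inner H10.fnL.continuous).tendsto v).comp h).const_smul _

theorem isFiniteMeasure_leb (hΩ : Bornology.IsBounded (Ω : Set (Euc d))) :
    IsFiniteMeasure (leb Ω) :=
  ⟨by simpa using hΩ.measure_lt_top⟩

/-- The truncated paraboloid `z ↦ (t² - |z - x|²)₊ / 2`. -/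
theorem exists_paraboloid (hΩ : Bornology.IsBounded (Ω : Set (Euc d))) {x : Euc d} {t : ℝ}
    (ht : 0 < t) (hx : Metric.closedBall x t ⊆ Ω) :
    ∃ ζ : H10 Ω, (∀ᵐ z ∂(leb Ω), 0 ≤ ζ.fn z) ∧
      ζ.grad =ᵐ[leb Ω] (Metric.ball x t).indicator fun z => -(z - x) := by
  have := isFiniteMeasure_leb hΩ
  obtain ⟨C, hC0, hC⟩ := exists_deriv_smoothPos_le
  set q : Euc d → ℝ := fun z => (t ^ 2 - ‖z - x‖ ^ 2) / 2 with hq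
  have hqs : ContDiff ℝ ∞ q :=
    (contDiff_const.sub ((contDiff_id.sub contDiff_const).norm_sq ℝ)).div_const 2
  have hqg : ∀ z, ∇ q z = -(z - x) := fun z => by
    refine gradient_eq_of_hasFDerivAt_inner ?_
    have h1 : HasFDerivAt (fun z : Euc d => ‖z - x‖ ^ 2) _ z :=
      ((hasFDerivAt_id z).sub_const x).norm_sq
    have h2 := (h1.const_sub (t ^ 2)).mul_const (2⁻¹ : ℝ)
    refine h2.congr_fderiv ?_
    ext w
    simp
  have hqpos : ∀ z, 0 < q z ↔ z ∈ Metric.ball x t := fun z => by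
    rw [mem_ball_iff_norm, hq]
    simp only
    rw [← sq_lt_sq₀ (norm_nonneg _) ht.le]
    constructor <;> intro h <;> linarith
  have hqt : ∀ z, max (q z) 0 ≤ t ^ 2 := fun z =>
    max_le (by simp only [hq]; nlinarith [sq_nonneg ‖z - x‖]) (sq_nonneg t)
  have hzero : ∀ k z, z ∉ Metric.ball x t → smoothPos k (q z) = 0 := fun k z hz =>
    smoothPos_of_nonpos (not_lt.1 fun h => hz ((hqpos z).1 h))
  have hts : ∀ k, tsupport (fun z => smoothPos k (q z)) ⊆ Metric.closedBall x t := fun k =>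
    closure_minimal (fun z hz => Metric.ball_subset_closedBall
      (by_contra fun h => hz (hzero k z h))) Metric.isClosed_closedBall
  let φ : ℕ → 𝓓(Ω, ℝ) := fun k => mkTest (fun z => smoothPos k (q z))
    ((smoothPos_contDiff k).comp hqs)
    ((isCompact_closedBall x t).of_isClosed_subset (isClosed_tsupport _) (hts k))
    ((hts k).trans hx)
  have hφg : ∀ k z, ∇ (φ k : Euc d → ℝ) z = deriv (smoothPos k) (q z) • -(z - x) := fun k z => by
    rw [← hqg]
    exact gradient_comp ((smoothPos_contDiff k).differentiable (by simp) _)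
      (hqs.differentiable (by simp) z)
  have hlip : ∀ k s, |smoothPos k s| ≤ C * max s 0 := fun k s => by
    rcases le_or_gt s 0 with hs | hs
    · rw [smoothPos_of_nonpos hs, abs_zero]; positivity
    · have := convex_univ.norm_image_sub_le_of_norm_deriv_le (f := smoothPos k)
        (fun x _ => (smoothPos_contDiff k).differentiable (by simp) x) (fun x _ => hC k x)
        (Set.mem_univ 0) (Set.mem_univ s)
      rw [max_eq_left hs.le]
      simpa [smoothPos_of_nonpos le_rfl, abs_of_pos hs] using this
  have hd0 : ∀ k s, s ≤ 0 → deriv (smoothPos k) s = 0 := fun k s hs => by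
    have hk : ((k : ℝ) + 1) * s ≤ 0 := mul_nonpos_of_nonneg_of_nonpos (by positivity) hs
    rw [deriv_smoothPos, Real.smoothTransition.zero_of_nonpos (by linarith),
      deriv_smoothTransition_of_neg (by linarith)]
    simp
  have hgm : AEStronglyMeasurable ((Metric.ball x t).indicator fun z : Euc d => -(z - x))
      (leb Ω) := by
    refine AEStronglyMeasurable.indicator ?_ measurableSet_ball
    exact (continuous_id.sub continuous_const).neg.aestronglyMeasurable
  have hgb : ∀ z, ‖(Metric.ball x t).indicator (fun z : Euc d => -(z - x)) z‖ ≤ t := fun z => by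
    by_cases hz : z ∈ Metric.ball x t
    · rw [Set.indicator_of_mem hz, norm_neg]
      exact (mem_ball_iff_norm.1 hz).le
    · rw [Set.indicator_of_notMem hz, norm_zero]
      exact ht.le
  have hfm : AEStronglyMeasurable (fun z => max (q z) 0) (leb Ω) :=
    (hqs.continuous.max continuous_const).aestronglyMeasurable
  have hf : MemLp (fun z => max (q z) 0) 2 (leb Ω) :=
    MemLp.of_bound hfm (t ^ 2) (Eventually.of_forall fun z => by
      rw [Real.norm_eq_abs, abs_of_nonneg (le_max_right _ _)]; exact hqt z)
  have hg : MemLp ((Metric.ball x t).indicator fun z : Euc d => -(z - x)) 2 (leb Ω) :=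
    MemLp.of_bound hgm t (Eventually.of_forall hgb)
  suffices H : ∃ ζ : H10 Ω, ζ.fn =ᵐ[leb Ω] (fun z => max (q z) 0) ∧
      ζ.grad =ᵐ[leb Ω] ((Metric.ball x t).indicator fun z : Euc d => -(z - x)) ∧
      Tendsto (fun k => H10.ofTest (φ k)) atTop (𝓝 ζ) by
    obtain ⟨ζ, h1, h2, -⟩ := H
    exact ⟨ζ, h1.mono fun z hz => by rw [hz]; exact le_max_right _ _, h2⟩
  refine H10.exists_tendsto_of_tendsto_eLpNorm _ hf hg ?_ ?_
  · have := tendsto_eLpNorm_two_of_dominated (μ := leb Ω)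
      (f := fun k z => φ k z - max (q z) 0) (b := fun _ => C * t ^ 2 + t ^ 2) (memLp_const _)
      (fun k => (φ k).continuous.aestronglyMeasurable.sub hfm)
      (fun k => Eventually.of_forall fun z => ?_) (Eventually.of_forall fun z => ?_)
    · refine this.congr fun k => eLpNorm_congr_ae ?_
      filter_upwards [H10.ofTest_fn (φ k)] with z hz
      simp [hz]
    · refine (norm_sub_le _ _).trans (add_le_add ?_ ?_)
      · exact (hlip k _).trans (mul_le_mul_of_nonneg_left (hqt z) hC0.le)
      · rw [Real.norm_eq_abs, abs_of_nonneg (le_max_right _ _)]; exact hqt z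
    · have h1 := (tendsto_smoothPos (q z)).sub_const (max (q z) 0)
      rwa [sub_self] at h1
  · have := tendsto_eLpNorm_two_of_dominated (μ := leb Ω)
      (f := fun k z => ∇ (φ k : Euc d → ℝ) z - (Metric.ball x t).indicator (fun z => -(z - x)) z)
      (b := fun _ => C * t + t) (memLp_const _)
      (fun k => (continuous_gradient (test_contDiff (φ k))).aestronglyMeasurable.sub hgm)
      (fun k => Eventually.of_forall fun z => ?_) (Eventually.of_forall fun z => ?_)
    · refine this.congr fun k => eLpNorm_congr_ae ?_
      filter_upwards [H10.ofTest_grad (φ k)] with z hz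
      simp [hz]
    · refine (norm_sub_le _ _).trans (add_le_add ?_ (hgb z))
      rw [hφg, norm_smul, norm_neg]
      by_cases hz : z ∈ Metric.ball x t
      · exact mul_le_mul (hC k _) (mem_ball_iff_norm.1 hz).le (norm_nonneg _) hC0.le
      · rw [hd0 k _ (not_lt.1 fun h => hz ((hqpos z).1 h)), norm_zero, zero_mul]
        positivity
    · simp only [hφg]
      have h1 := (tendsto_deriv_smoothPos (q z)).smul_const (-(z - x))
      have h2 : (if 0 < q z then (1 : ℝ) else 0) • -(z - x) =
          (Metric.ball x t).indicator (fun z => -(z - x)) z := by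
        by_cases hz : z ∈ Metric.ball x t
        · rw [if_pos ((hqpos z).2 hz), one_smul, Set.indicator_of_mem hz]
        · rw [if_neg fun h => hz ((hqpos z).1 h), zero_smul, Set.indicator_of_notMem hz]
      rw [h2] at h1
      simpa using h1.sub_const ((Metric.ball x t).indicator (fun z => -(z - x)) z)

theorem hasDerivAt_integral_unitBall (φ : 𝓓(Ω, ℝ)) (x : Euc d) (t : ℝ) :
    HasDerivAt (fun t : ℝ => ∫ y in Metric.ball (0 : Euc d) 1, φ (x + t • y))
      (∫ y in Metric.ball (0 : Euc d) 1, inner ℝ (∇ (φ : Euc d → ℝ) (x + t • y)) y) t := by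
  obtain ⟨C, hC, h1, h2⟩ := exists_test_bound φ
  have : IsFiniteMeasure (volume.restrict (Metric.ball (0 : Euc d) 1)) :=
    ⟨by simpa using measure_ball_lt_top⟩
  have hgc := continuous_gradient (test_contDiff φ)
  refine (hasDerivAt_integral_of_dominated_loc_of_deriv_le (bound := fun _ => C) (s := Set.univ)
    (F := fun (t : ℝ) y => φ (x + t • y))
    (F' := fun (t : ℝ) y => inner ℝ (∇ (φ : Euc d → ℝ) (x + t • y)) y)
    univ_mem (Eventually.of_forall fun s => ?_) ?_ ?_ ?_ (integrable_const _) ?_).2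
  · exact (φ.continuous.comp (by fun_prop)).aestronglyMeasurable
  · exact Integrable.of_bound (φ.continuous.comp (by fun_prop)).aestronglyMeasurable C
      (Eventually.of_forall fun y => h1 _)
  · exact ((hgc.comp (by fun_prop)).inner continuous_id).aestronglyMeasurable
  · filter_upwards [ae_restrict_mem measurableSet_ball] with y hy s _
    refine (norm_inner_le_norm _ _).trans ?_
    have := (mem_ball_zero_iff.1 hy).le
    calc _ ≤ C * 1 := mul_le_mul (h2 _) this (norm_nonneg _) hC.le
      _ = C := mul_one C
  · refine Eventually.of_forall fun y s _ => ?_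
    rw [inner_gradient_left]
    have hl : HasDerivAt (fun s : ℝ => x + s • y) y s := by
      simpa using ((hasDerivAt_id s).smul_const y).const_add x
    exact (testFunction_differentiable φ (x + s • y)).hasFDerivAt.comp_hasDerivAt s hl

/-- Weak superharmonicity. -/
def IsSuperharmonic (v : H10 Ω) : Prop :=
  ∀ ζ : H10 Ω, (∀ᵐ z ∂(leb Ω), 0 ≤ ζ.fn z) → 0 ≤ inner ℝ (H10.gradL v) (H10.gradL ζ)

/-- Formally, the radial derivative of `∫ v (x + t • y)` over the unit ball is `t ^ (-(d + 1))`
times the integral of `∇v · (z - x)` over the ball of radius `t`. That integral is minus the inner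
product of `∇v` with the gradient of the truncated paraboloid, so the derivative is nonpositive. As
`v` is not smooth, this is done for test functions `φ` with an error proportional to `‖φ - v‖`,
which vanishes in the limit. -/
theorem IsSuperharmonic.average_le (hΩ : Bornology.IsBounded (Ω : Set (Euc d))) {v : H10 Ω}
    (hv : IsSuperharmonic v) {x : Euc d} {s r : ℝ} (hs : 0 < s) (hsr : s ≤ r)
    (hx : Metric.closedBall x r ⊆ Ω) :
    ⨍ z in Metric.ball x r, v.fn z ≤ ⨍ z in Metric.ball x s, v.fn z := by
  have := isFiniteMeasure_leb hΩ
  have hr : 0 < r := hs.trans_le hsr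
  set V := (leb Ω Set.univ).toReal ^ (2 : ℝ≥0∞).toReal⁻¹ with hV
  have hV0 : 0 ≤ V := by positivity
  set a : 𝓓(Ω, ℝ) → ℝ → ℝ := fun φ t => ∫ y in Metric.ball (0 : Euc d) 1, φ (x + t • y) with ha
  -- Uniform in `t ∈ (s, r)`: `V * r` bounds the `L²` norm of the paraboloid's gradient, and `t ^ (d
  -- + 1)` is at least `s ^ (d + 1)`.
  set L : ℝ := (s ^ (d + 1))⁻¹ * (V * r) with hL
  have hderiv : ∀ φ : 𝓓(Ω, ℝ), ∀ t ∈ Set.Ioo s r, deriv (a φ) t ≤ L * ‖H10.ofTest φ - v‖ := by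
    intro φ t ht
    have ht0 : 0 < t := hs.trans ht.1
    have hxt : Metric.closedBall x t ⊆ Ω := (Metric.closedBall_subset_closedBall ht.2.le).trans hx
    obtain ⟨ζ, hζ0, hζg⟩ := exists_paraboloid hΩ ht0 hxt
    have hζn : ‖H10.gradL ζ‖ ≤ V * r := by
      refine Lp.norm_le_of_ae_bound hr.le ?_
      filter_upwards [hζg] with z hz
      rw [H10.coe_gradL, hz]
      by_cases hzb : z ∈ Metric.ball x t
      · rw [Set.indicator_of_mem hzb, norm_neg]
        exact ((mem_ball_iff_norm.1 hzb).trans ht.2).le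
      · rw [Set.indicator_of_notMem hzb, norm_zero]
        exact hr.le
    have hin : inner ℝ (H10.gradL (H10.ofTest φ)) (H10.gradL ζ) =
        -∫ z in Metric.ball x t, inner ℝ (∇ (φ : Euc d → ℝ) z) (z - x) := by
      rw [L2.inner_def, ← integral_neg, ← integral_indicator measurableSet_ball,
        ← setIntegral_eq_integral_of_forall_compl_eq_zero (s := (Ω : Set (Euc d)))
          (fun z hz => Set.indicator_of_notMem
            (fun h => hz (hxt (Metric.ball_subset_closedBall h))) _)]
      refine integral_congr_ae ?_
      filter_upwards [hζg, H10.ofTest_grad φ] with z h1 h2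
      rw [H10.coe_gradL, H10.coe_gradL, h1, h2]
      by_cases hzb : z ∈ Metric.ball x t
      · rw [Set.indicator_of_mem hzb, Set.indicator_of_mem hzb, inner_neg_right]
      · rw [Set.indicator_of_notMem hzb, Set.indicator_of_notMem hzb, inner_zero_right]
    have hcov := setIntegral_ball_eq (fun z => inner ℝ (∇ (φ : Euc d → ℝ) z) (z - x)) x ht0
    simp only [add_sub_cancel_left, inner_smul_right] at hcov
    rw [integral_const_mul] at hcov
    rw [(hasDerivAt_integral_unitBall φ x t).deriv]
    set I := ∫ y in Metric.ball (0 : Euc d) 1, inner ℝ (∇ (φ : Euc d → ℝ) (x + t • y)) y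
    have h1 := hv ζ hζ0
    have h2 : inner ℝ (H10.gradL (H10.ofTest φ - v)) (H10.gradL ζ) =
        -(t ^ (d + 1) * I) - inner ℝ (H10.gradL v) (H10.gradL ζ) := by
      rw [map_sub, inner_sub_left, hin, hcov]
      ring
    have h3 := abs_le.1 (abs_real_inner_le_norm (H10.gradL (H10.ofTest φ - v)) (H10.gradL ζ))
    have h4 : ‖H10.gradL (H10.ofTest φ - v)‖ * ‖H10.gradL ζ‖ ≤ ‖H10.ofTest φ - v‖ * (V * r) :=
      mul_le_mul (H10.norm_gradL_le _) hζn (norm_nonneg _) (norm_nonneg _)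
    have h5 : t ^ (d + 1) * I ≤ ‖H10.ofTest φ - v‖ * (V * r) := by linarith [h3.1]
    have h6 : I ≤ (t ^ (d + 1))⁻¹ * (‖H10.ofTest φ - v‖ * (V * r)) := by
      rw [inv_mul_eq_div, le_div_iff₀ (by positivity)]
      linarith
    refine h6.trans ?_
    rw [hL]
    have h7 : (t ^ (d + 1))⁻¹ ≤ (s ^ (d + 1))⁻¹ :=
      inv_anti₀ (by positivity) (pow_le_pow_left₀ hs.le ht.1.le _)
    have h8 : 0 ≤ ‖H10.ofTest φ - v‖ * (V * r) := by positivity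
    nlinarith [mul_le_mul_of_nonneg_right h7 h8]
  have hmono : ∀ φ : 𝓓(Ω, ℝ), a φ r - a φ s ≤ L * ‖H10.ofTest φ - v‖ * (r - s) := fun φ =>
    (convex_Icc s r).image_sub_le_mul_sub_of_deriv_le
      (fun t _ => (hasDerivAt_integral_unitBall φ x t).continuousAt.continuousWithinAt)
      (fun t _ => (hasDerivAt_integral_unitBall φ x t).differentiableAt.differentiableWithinAt)
      (fun t ht => hderiv φ t (by rwa [interior_Icc] at ht)) s ⟨le_rfl, hsr⟩ r ⟨hsr, le_rfl⟩ hsr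
  obtain ⟨φ, hφ⟩ := H10.exists_seq_ofTest v
  have hav : ∀ n t, 0 < t → Metric.closedBall x t ⊆ Ω →
      ⨍ z in Metric.ball x t, (H10.ofTest (φ n)).fn z =
        (volume.real (Metric.ball (0 : Euc d) 1))⁻¹ * a (φ n) t := fun n t ht hxt => by
    rw [← average_ball_eq _ _ ht]
    refine setAverage_congr_fun measurableSet_ball ?_
    have := H10.ofTest_fn (φ n)
    have h2 := (ae_restrict_iff' Ω.isOpen.measurableSet).1 this
    filter_upwards [h2] with z hz hzb
    exact hz (hxt (Metric.ball_subset_closedBall hzb))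
  have hxs : Metric.closedBall x s ⊆ Ω := (Metric.closedBall_subset_closedBall hsr).trans hx
  have t1 := tendsto_average_ball hφ (Metric.ball_subset_closedBall.trans hx)
  have t2 := tendsto_average_ball hφ (Metric.ball_subset_closedBall.trans hxs)
  have t3 : Tendsto (fun n => (volume.real (Metric.ball (0 : Euc d) 1))⁻¹ *
      (L * ‖H10.ofTest (φ n) - v‖ * (r - s))) atTop (𝓝 0) := by
    have := (tendsto_iff_norm_sub_tendsto_zero.1 hφ)
    simpa using ((this.const_mul L).mul_const (r - s)).const_mul
      (volume.real (Metric.ball (0 : Euc d) 1))⁻¹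
  have := le_of_tendsto_of_tendsto' (t1.sub t2) t3 fun n => by
    rw [hav n r hr hx, hav n s hs hxs, ← mul_sub]
    exact mul_le_mul_of_nonneg_left (hmono (φ n))
      (inv_nonneg.2 volume_real_unitBall_pos.le)
  linarith

end BallMeans

/-! ### Superharmonic majorants and a maximal inequality for ball means. -/

section Majorants

variable {Ω : Opens (Euc d)}

theorem H10.fn_le_iff {u v : H10 Ω} :
    H10.fnL u ≤ H10.fnL v ↔ ∀ᵐ x ∂(leb Ω), u.fn x ≤ v.fn x :=
  (Lp.coeFn_le _ _).symm

/-- The solution of the obstacle problem is a superharmonic majorant of least energy. -/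
theorem exists_superharmonic_majorant (hd : 1 ≤ d) (hΩ : Bornology.IsBounded (Ω : Set (Euc d)))
    (w : H10 Ω) : ∃ v : H10 Ω, IsSuperharmonic v ∧ (∀ᵐ x ∂(leb Ω), w.fn x ≤ v.fn x) ∧
      ‖H10.gradL v‖ ≤ ‖H10.gradL w‖ := by
  obtain ⟨C, hC, hPoinc⟩ := H10.exists_norm_le (Ω := Ω) hd hΩ
  set K : Set (H10 Ω) := {z | H10.fnL w ≤ H10.fnL z} with hK
  have hwK : w ∈ K := le_refl (H10.fnL w)
  have hKc : IsClosed K := isClosed_le continuous_const H10.fnL.continuous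
  have hKconv : Convex ℝ K := by
    intro x hx y hy a b ha hb hab
    have hx' := H10.fn_le_iff.1 hx
    have hy' := H10.fn_le_iff.1 hy
    refine H10.fn_le_iff.2 ?_
    filter_upwards [hx', hy', H10.fn_add (a • x) (b • y), H10.fn_smul a x, H10.fn_smul b y]
      with z h1 h2 h3 h4 h5
    rw [h3, Pi.add_apply, h4, h5]
    simp only [Pi.smul_apply, smul_eq_mul]
    calc w.fn z = a * w.fn z + b * w.fn z := by rw [← add_mul, hab, one_mul]
      _ ≤ _ := add_le_add (mul_le_mul_of_nonneg_left h1 ha) (mul_le_mul_of_nonneg_left h2 hb)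
  -- By Poincaré the gradients of the closed convex set `K` form a complete convex set in `L²`, so a
  -- minimizer of the energy exists as the projection of `0`.
  have hanti : AntilipschitzWith ⟨C, hC.le⟩ (H10.gradL (Ω := Ω)) :=
    AddMonoidHomClass.antilipschitz_of_bound _ hPoinc
  have hcomp : IsComplete (H10.gradL '' K) :=
    (isComplete_image_iff (hanti.isUniformInducing H10.gradL.uniformContinuous)).2 hKc.isComplete
  have hconv : Convex ℝ (H10.gradL '' K) := hKconv.is_linear_image H10.gradL.isLinear
  obtain ⟨_, ⟨v, hvK, rfl⟩, hv⟩ :=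
    exists_norm_eq_iInf_of_complete_convex (Set.Nonempty.image _ ⟨w, hwK⟩) hcomp hconv 0
  have hvi := (norm_eq_iInf_iff_real_inner_le_zero hconv ⟨v, hvK, rfl⟩).1 hv
  refine ⟨v, fun ζ hζ => ?_, H10.fn_le_iff.1 hvK, ?_⟩
  · have hmem : v + ζ ∈ K := by
      refine H10.fn_le_iff.2 ?_
      filter_upwards [H10.fn_le_iff.1 hvK, hζ, H10.fn_add v ζ] with z h1 h2 h3
      rw [h3, Pi.add_apply]
      linarith
    have := hvi _ ⟨_, hmem, rfl⟩
    rw [map_add, add_sub_cancel_left, zero_sub, inner_neg_left] at this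
    linarith
  -- The projection inequality at the competitor `w` reads `‖∇v‖² ≤ ⟨∇v, ∇w⟩`.
  · have := hvi _ ⟨w, hwK, rfl⟩
    rw [zero_sub, inner_neg_left, inner_sub_right, real_inner_self_eq_norm_sq] at this
    have h2 := real_inner_le_norm (H10.gradL v) (H10.gradL w)
    rcases (norm_nonneg (H10.gradL v)).eq_or_lt with h0 | h0
    · rw [← h0]; exact norm_nonneg _
    · exact le_of_mul_le_mul_left (by nlinarith) h0

theorem H10.integrable_fn (hΩ : Bornology.IsBounded (Ω : Set (Euc d))) (u : H10 Ω) :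
    IntegrableOn u.fn Ω := by
  have := isFiniteMeasure_leb hΩ
  exact (H10.fn_memLp u).integrable (by norm_num)

/-- The set where some ball mean of `v` exceeds `c`. -/
def exceedSet (v : H10 Ω) (c : ℝ) : Set (Euc d) :=
  {x | ∃ r : ℝ, 0 < r ∧ Metric.closedBall x r ⊆ Ω ∧ c < ⨍ z in Metric.ball x r, v.fn z}

theorem nontrivial_euc (hd : 1 ≤ d) : Nontrivial (Euc d) := by
  have : Nonempty (Fin d) := ⟨⟨0, hd⟩⟩
  infer_instance

/-- Dominated convergence: the indicators of the moving balls converge off the sphere, which is a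
null set. -/
theorem continuousAt_average_ball (hd : 1 ≤ d) {f : Euc d → ℝ} (hf : Integrable f) (x : Euc d)
    {r : ℝ} (hr : 0 < r) : ContinuousAt (fun x => ⨍ z in Metric.ball x r, f z) x := by
  have := nontrivial_euc hd
  simp only [setAverage_eq, volume_real_ball_eq _ hr, ← integral_indicator measurableSet_ball]
  suffices H : ContinuousAt (fun x => ∫ z, (Metric.ball x r).indicator f z) x from
    H.const_smul (r ^ d * volume.real (Metric.ball (0 : Euc d) 1))⁻¹
  refine continuousAt_of_dominated (bound := fun z => ‖f z‖)
    (Eventually.of_forall fun y => hf.1.indicator measurableSet_ball)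
    (Eventually.of_forall fun y => Eventually.of_forall fun z => norm_indicator_le_norm_self _ _)
    hf.norm ?_
  have hs : ∀ᵐ z : Euc d, z ∉ Metric.sphere x r :=
    measure_eq_zero_iff_ae_notMem.1 (Measure.addHaar_sphere volume x r)
  filter_upwards [hs] with z hz
  have hne : dist z x ≠ r := hz
  have hdc : Continuous fun y => dist z y := by fun_prop
  rcases lt_or_gt_of_ne hne with h | h
  · refine (continuousAt_const (X := Euc d) (y := f z)).congr ?_
    filter_upwards [(hdc.tendsto x).eventually_lt_const h] with y hy
    exact (Set.indicator_of_mem (Metric.mem_ball.2 hy) _).symm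
  · refine (continuousAt_const (X := Euc d) (y := (0 : ℝ))).congr ?_
    filter_upwards [(hdc.tendsto x).eventually_const_lt h] with y hy
    exact (Set.indicator_of_notMem (fun h' => absurd (Metric.mem_ball.1 h') hy.not_gt) _).symm

theorem average_indicator_eq {x : Euc d} {r : ℝ} (hx : Metric.closedBall x r ⊆ Ω)
    (f : Euc d → ℝ) : ⨍ z in Metric.ball x r, (Ω : Set (Euc d)).indicator f z =
      ⨍ z in Metric.ball x r, f z :=
  setAverage_congr_fun measurableSet_ball (Eventually.of_forall fun _ hz =>
    Set.indicator_of_mem (hx (Metric.ball_subset_closedBall hz)) f)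

theorem isOpen_exceedSet (hd : 1 ≤ d) (hΩ : Bornology.IsBounded (Ω : Set (Euc d))) (v : H10 Ω)
    (c : ℝ) : IsOpen (exceedSet v c) := by
  rw [isOpen_iff_mem_nhds]
  rintro x ⟨r, hr, hx, hc⟩
  have hi : Integrable ((Ω : Set (Euc d)).indicator v.fn) :=
    (integrable_indicator_iff Ω.isOpen.measurableSet).2 (H10.integrable_fn hΩ v)
  rw [← average_indicator_eq hx] at hc
  obtain ⟨δ, hδ, hδΩ⟩ := (isCompact_closedBall x r).exists_thickening_subset_open Ω.isOpen hx
  filter_upwards [(continuousAt_average_ball hd hi x hr).eventually_const_lt hc,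
    Metric.ball_mem_nhds x hδ] with y h1 h2
  have hy : Metric.closedBall y r ⊆ Ω := by
    refine Set.Subset.trans (fun z hz => ?_) hδΩ
    rw [Metric.mem_thickening_iff]
    refine ⟨z - y + x, ?_, ?_⟩
    · rw [mem_closedBall_iff_norm] at hz ⊢
      simpa using hz
    · rw [dist_eq_norm]
      rw [mem_ball_iff_norm] at h2
      convert h2 using 2
      abel
  exact ⟨r, hr, hy, by rwa [← average_indicator_eq hy]⟩

theorem eventually_closedBall_subset {x : Euc d} (hx : x ∈ Ω) :
    ∀ᶠ r : ℝ in 𝓝[>] 0, Metric.closedBall x r ⊆ Ω := by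
  obtain ⟨r, hr, h⟩ := Metric.nhds_basis_closedBall.mem_iff.1 (Ω.isOpen.mem_nhds hx)
  filter_upwards [Ioo_mem_nhdsGT hr] with s hs
  exact (Metric.closedBall_subset_closedBall hs.2.le).trans h

theorem ae_tendsto_average_ball (hd : 1 ≤ d) (hΩ : Bornology.IsBounded (Ω : Set (Euc d)))
    (v : H10 Ω) : ∀ᵐ x ∂(leb Ω),
      Tendsto (fun r : ℝ => ⨍ z in Metric.ball x r, v.fn z) (𝓝[>] 0) (𝓝 (v.fn x)) := by
  have := nontrivial_euc hd
  have hi : Integrable ((Ω : Set (Euc d)).indicator v.fn) :=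
    (integrable_indicator_iff Ω.isOpen.measurableSet).2 (H10.integrable_fn hΩ v)
  have h := IsUnifLocDoublingMeasure.ae_tendsto_average (volume : Measure (Euc d))
    hi.locallyIntegrable 1
  refine (ae_restrict_iff' Ω.isOpen.measurableSet).2 ?_
  filter_upwards [h] with x hx hxΩ
  have h1 := hx (fun _ : ℝ => x) (fun r => r) (l := 𝓝[>] (0 : ℝ)) tendsto_id (by
    filter_upwards [self_mem_nhdsWithin] with r (hr : 0 < r)
    exact Metric.mem_closedBall_self (by linarith))
  rw [Set.indicator_of_mem hxΩ] at h1
  refine h1.congr' ?_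
  filter_upwards [eventually_closedBall_subset hxΩ] with r hr
  have hae : Metric.closedBall x r =ᵐ[volume] Metric.ball x r :=
    (ae_eq_of_subset_of_measure_ge Metric.ball_subset_closedBall
      (Measure.addHaar_closedBall_eq_addHaar_ball _ _ _).le measurableSet_ball.nullMeasurableSet
      measure_closedBall_lt_top.ne).symm
  rw [Measure.restrict_congr_set hae, average_indicator_eq hr]

/-- A mean above `c` at one radius stays above `c` at all smaller radii, and at almost every point
these means tend to `v`. Thus the open set `exceedSet v c` is one where `c⁻¹ • v` is at least `1`.
-/
theorem IsSuperharmonic.le_of_mem_exceedSet (hd : 1 ≤ d)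
    (hΩ : Bornology.IsBounded (Ω : Set (Euc d))) {v : H10 Ω} (hv : IsSuperharmonic v) (c : ℝ) :
    ∀ᵐ x ∂(leb Ω), x ∈ exceedSet v c → c ≤ v.fn x := by
  filter_upwards [ae_tendsto_average_ball hd hΩ v] with x hx
  rintro ⟨r, hr, hxr, hc⟩
  refine ge_of_tendsto hx ?_
  filter_upwards [Ioo_mem_nhdsGT hr] with s hs
  exact hc.le.trans (hv.average_le hΩ hs.1 hs.2.le hxr)

theorem tendsto_average_test (φ : 𝓓(Ω, ℝ)) (x : Euc d) :
    Tendsto (fun r : ℝ => ⨍ z in Metric.ball x r, φ z) (𝓝[>] 0) (𝓝 (φ x)) := by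
  have h := (hasDerivAt_integral_unitBall φ x 0).continuousAt.tendsto
  have h2 := (h.mono_left (nhdsWithin_le_nhds (s := Set.Ioi 0))).const_mul
    (volume.real (Metric.ball (0 : Euc d) 1))⁻¹
  have := volume_real_unitBall_pos (d := d)
  have e : (volume.real (Metric.ball (0 : Euc d) 1))⁻¹ *
      ∫ y in Metric.ball (0 : Euc d) 1, φ (x + (0 : ℝ) • y) = φ x := by
    simp only [zero_smul, add_zero, setIntegral_const, smul_eq_mul]
    field_simp
  rw [e] at h2
  refine h2.congr' ?_
  filter_upwards [self_mem_nhdsWithin] with r hr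
  rw [average_ball_eq _ _ hr]

variable {μ : Measure (Ω × Ω)} {ν : Measure Ω} [IsFiniteMeasure μ]
  [IsFiniteMeasure ν] {F : H10 Ω → ℝ≥0}

/-- A maximal inequality with mass in place of Lebesgue measure. The functions `u - φ` and `φ - u`
have superharmonic majorants of small energy, and the sets where a ball mean of a majorant exceeds
`ε / 2` have small mass. Off these sets every mean of `u - φ` over a ball compactly inside `Ω` is at
most `ε / 2` in absolute value, and the means of `φ` converge. -/
theorem IsRepresented.exists_test_average_near (hF : IsRepresented μ ν F) (hd : 1 ≤ d)
    (hΩ : Bornology.IsBounded (Ω : Set (Euc d))) (u : H10 Ω) {ε : ℝ} (hε : 0 < ε) :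
    ∃ φ : 𝓓(Ω, ℝ), ‖H10.ofTest φ - u‖ < ε ∧
      mass μ ν {x : Ω | ¬ ∀ᶠ r : ℝ in 𝓝[>] 0,
        |(⨍ y in Metric.ball (x : Euc d) r ∩ Ω, u.fn y) - φ x| ≤ ε} ≤ ENNReal.ofReal ε := by
  obtain ⟨δ, hδ, h⟩ := hF.exists_mass_open_le hd hΩ (half_pos hε)
  -- The bound `ε / 2 * δ` leaves gradient norm at most `δ` after the majorant is divided by the
  -- level `ε / 2`.
  obtain ⟨φ, hφ⟩ := H10.exists_ofTest_near u (lt_min hε (mul_pos (half_pos hε) hδ))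
  have key : ∀ w : H10 Ω, ‖w‖ ≤ ε / 2 * δ → ∃ v : H10 Ω, (∀ᵐ x ∂(leb Ω), w.fn x ≤ v.fn x) ∧
      mass μ ν {x : Ω | (x : Euc d) ∈ exceedSet v (ε / 2)} ≤ ENNReal.ofReal (ε / 2) := by
    intro w hw
    obtain ⟨v, hv, hwv, hvn⟩ := exists_superharmonic_majorant hd hΩ w
    refine ⟨v, hwv, h ((ε / 2)⁻¹ • v) _ (isOpen_exceedSet hd hΩ v _) ?_ ?_⟩
    · filter_upwards [hv.le_of_mem_exceedSet hd hΩ (ε / 2), H10.fn_smul (ε / 2)⁻¹ v] with x h1 h2 h3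
      rw [h2, Pi.smul_apply, smul_eq_mul, inv_mul_eq_div, one_le_div (by positivity)]
      exact h1 h3
    · rw [map_smul, norm_smul, norm_inv, Real.norm_of_nonneg (by positivity), inv_mul_eq_div,
        div_le_iff₀ (by positivity), mul_comm]
      exact (hvn.trans (H10.norm_gradL_le w)).trans hw
  have hφ2 := (hφ.trans_le (min_le_right _ _)).le
  obtain ⟨v₁, hv₁, hm₁⟩ := key (u - H10.ofTest φ) (by rwa [norm_sub_rev])
  obtain ⟨v₂, hv₂, hm₂⟩ := key (H10.ofTest φ - u) hφ2
  refine ⟨φ, hφ.trans_le (min_le_left _ _), ?_⟩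
  have hsub : {x : Ω | ¬ ∀ᶠ r : ℝ in 𝓝[>] 0,
      |(⨍ y in Metric.ball (x : Euc d) r ∩ Ω, u.fn y) - φ x| ≤ ε} ⊆
      {x : Ω | (x : Euc d) ∈ exceedSet v₁ (ε / 2)} ∪
        {x : Ω | (x : Euc d) ∈ exceedSet v₂ (ε / 2)} := by
    intro x hx
    by_contra hcon
    refine hx ?_
    have hx1 : (x : Euc d) ∉ exceedSet v₁ (ε / 2) := fun h => hcon (Or.inl h)
    have hx2 : (x : Euc d) ∉ exceedSet v₂ (ε / 2) := fun h => hcon (Or.inr h)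
    filter_upwards [eventually_closedBall_subset x.2, self_mem_nhdsWithin,
      (tendsto_average_test φ x).eventually (Metric.closedBall_mem_nhds _ (half_pos hε))]
      with r hr hr0 hφr
    have hr0 : 0 < r := hr0
    have hsub : Metric.ball (x : Euc d) r ⊆ Ω := Metric.ball_subset_closedBall.trans hr
    rw [Set.inter_eq_left.2 hsub]
    have hint : ∀ w : H10 Ω, IntegrableOn w.fn (Metric.ball (x : Euc d) r) := fun w =>
      (H10.integrable_fn hΩ w).mono_set hsub
    have hφi : IntegrableOn φ (Metric.ball (x : Euc d) r) :=
      (φ.continuous.integrable_of_hasCompactSupport φ.hasCompactSupport).integrableOn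
    have hle : ∀ {f g : Euc d → ℝ}, IntegrableOn f (Metric.ball (x : Euc d) r) →
        IntegrableOn g (Metric.ball (x : Euc d) r) → (∀ᵐ z ∂(leb Ω), f z ≤ g z) →
        ⨍ z in Metric.ball (x : Euc d) r, f z ≤ ⨍ z in Metric.ball (x : Euc d) r, g z := by
      intro f g hf hg hfg
      rw [setAverage_eq, setAverage_eq]
      refine smul_le_smul_of_nonneg_left (integral_mono_ae hf hg ?_)
        (inv_nonneg.2 measureReal_nonneg)
      exact ae_mono (Measure.restrict_mono_set _ hsub) hfg
    have b1 : ⨍ z in Metric.ball (x : Euc d) r, v₁.fn z ≤ ε / 2 :=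
      not_lt.1 fun h => hx1 ⟨r, hr0, hr, h⟩
    have b2 : ⨍ z in Metric.ball (x : Euc d) r, v₂.fn z ≤ ε / 2 :=
      not_lt.1 fun h => hx2 ⟨r, hr0, hr, h⟩
    have c1 := hle ((hint u).sub hφi) (hint v₁) (by
      filter_upwards [hv₁, H10.fn_sub u (H10.ofTest φ), H10.ofTest_fn φ] with z h1 h2 h3
      rwa [h2, Pi.sub_apply, h3] at h1)
    have c2 := hle (hφi.sub (hint u)) (hint v₂) (by
      filter_upwards [hv₂, H10.fn_sub (H10.ofTest φ) u, H10.ofTest_fn φ] with z h1 h2 h3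
      rwa [h2, Pi.sub_apply, h3] at h1)
    have s1 : ⨍ z in Metric.ball (x : Euc d) r, (u.fn - φ) z =
        (⨍ z in Metric.ball (x : Euc d) r, u.fn z) - ⨍ z in Metric.ball (x : Euc d) r, φ z := by
      simp only [setAverage_eq, ← smul_sub]
      rw [← integral_sub (hint u) hφi]
      rfl
    have s2 : ⨍ z in Metric.ball (x : Euc d) r, (φ - u.fn) z =
        (⨍ z in Metric.ball (x : Euc d) r, φ z) - ⨍ z in Metric.ball (x : Euc d) r, u.fn z := by
      simp only [setAverage_eq, ← smul_sub]
      rw [← integral_sub hφi (hint u)]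
      rfl
    rw [s1] at c1
    rw [s2] at c2
    rw [Real.dist_eq, abs_le] at hφr
    rw [abs_le]
    constructor <;> linarith [hφr.1, hφr.2]
  calc _ ≤ _ := measure_mono hsub
    _ ≤ _ := measure_union_le _ _
    _ ≤ ENNReal.ofReal (ε / 2) + ENNReal.ofReal (ε / 2) := add_le_add hm₁ hm₂
    _ = ENNReal.ofReal ε := by
        rw [← ENNReal.ofReal_add (by positivity) (by positivity), add_halves]

end Majorants

/-! ### Representatives determined up to `mass`-null sets. -/

section QuasiRep

variable {Ω : Opens (Euc d)} (μ : Measure (Ω × Ω)) (ν : Measure Ω)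

/-- `f` is a limit in measure, with respect to `ν` and the marginals of `μ`, of test functions
that approximate `u` in `H¹₀(Ω)`. -/
def QuasiRep (u : H10 Ω) (f : Euc d → ℝ) : Prop :=
  ∀ ε : ℝ, 0 < ε → ∃ φ : 𝓓(Ω, ℝ), ‖H10.ofTest φ - u‖ < ε ∧
    mass μ ν {x : Ω | ε < |φ x - f x|} ≤ ENNReal.ofReal ε

variable {μ ν}

theorem measure_eq_zero_of_le_ofReal {α : Type*} [MeasurableSpace α] {m : Measure α} {s : Set α}
    {c : ℝ} (hc : 0 < c) (h : ∀ ε : ℝ, 0 < ε → ε ≤ c → m s ≤ ENNReal.ofReal ε) : m s = 0 := by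
  refine le_antisymm (ENNReal.le_of_forall_pos_le_add fun ε hε _ => ?_) zero_le
  rw [zero_add]
  have hε' : (0 : ℝ) < ε := by exact_mod_cast hε
  refine (h _ (lt_min hε' hc) (min_le_right _ _)).trans ?_
  rw [← ENNReal.ofReal_coe_nnreal]
  exact ENNReal.ofReal_le_ofReal (min_le_left _ _)

theorem QuasiRep.ofTest (φ : 𝓓(Ω, ℝ)) : QuasiRep μ ν (H10.ofTest φ) φ := fun ε hε =>
  ⟨φ, by simpa using hε, by simp [not_lt.2 hε.le]⟩

theorem QuasiRep.congr {u : H10 Ω} {f g : Euc d → ℝ} (h : QuasiRep μ ν u f)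
    (hfg : ∀ᵐ x : Ω ∂(mass μ ν), f x = g x) : QuasiRep μ ν u g := fun ε hε => by
  obtain ⟨φ, h1, h2⟩ := h ε hε
  refine ⟨φ, h1, le_trans (measure_mono_ae ?_) h2⟩
  filter_upwards [hfg] with x hx (hx' : ε < |φ x - g x|)
  change ε < |φ x - f x|
  rwa [hx]

theorem QuasiRep.sub_test {u : H10 Ω} {f : Euc d → ℝ} (h : QuasiRep μ ν u f) (ψ : 𝓓(Ω, ℝ)) :
    QuasiRep μ ν (H10.ofTest ψ - u) (fun x => ψ x - f x) := fun ε hε => by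
  obtain ⟨φ, h1, h2⟩ := h ε hε
  refine ⟨ψ - φ, ?_, ?_⟩
  · rwa [H10.ofTest_sub, sub_sub_sub_cancel_left, norm_sub_rev]
  · refine le_trans (measure_mono fun x (hx : ε < |(ψ x - φ x) - (ψ x - f x)|) => ?_) h2
    rw [sub_sub_sub_cancel_left, abs_sub_comm] at hx
    exact hx

/-- Borel–Cantelli along tolerances `(1 / 2) ^ n`. -/
theorem QuasiRep.exists_seq {u : H10 Ω} {f : Euc d → ℝ} (h : QuasiRep μ ν u f) :
    ∃ φ : ℕ → 𝓓(Ω, ℝ), Tendsto (fun n => H10.ofTest (φ n)) atTop (𝓝 u) ∧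
      ∀ᵐ x : Ω ∂(mass μ ν), Tendsto (fun n => φ n x) atTop (𝓝 (f x)) := by
  choose φ h1 h2 using fun n : ℕ => h ((1 / 2) ^ n) (by positivity)
  have hgeom : Tendsto (fun n : ℕ => (1 / 2 : ℝ) ^ n) atTop (𝓝 0) :=
    tendsto_pow_atTop_nhds_zero_of_lt_one (by norm_num) (by norm_num)
  refine ⟨φ, tendsto_iff_norm_sub_tendsto_zero.2 (squeeze_zero (fun _ => norm_nonneg _)
    (fun n => (h1 n).le) hgeom), ?_⟩
  have hsum : ∑' n, mass μ ν {x : Ω | (1 / 2 : ℝ) ^ n < |φ n x - f x|} ≠ ⊤ := by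
    refine ne_top_of_le_ne_top ?_ (ENNReal.tsum_le_tsum h2)
    rw [← ENNReal.ofReal_tsum_of_nonneg (fun n => by positivity)
      (summable_geometric_of_lt_one (by norm_num) (by norm_num))]
    exact ENNReal.ofReal_ne_top
  filter_upwards [ae_eventually_notMem hsum] with x hx
  refine tendsto_iff_norm_sub_tendsto_zero.2 (squeeze_zero' (Eventually.of_forall
    fun _ => norm_nonneg _) ?_ hgeom)
  exact hx.mono fun n hn => not_lt.1 hn

theorem QuasiRep.aestronglyMeasurable {u : H10 Ω} {f : Euc d → ℝ} (h : QuasiRep μ ν u f) :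
    AEStronglyMeasurable (fun x : Ω => f x) (mass μ ν) := by
  obtain ⟨φ, -, hφ⟩ := h.exists_seq
  exact aestronglyMeasurable_of_tendsto_ae atTop
    (fun n => ((φ n).continuous.comp continuous_subtype_val).aestronglyMeasurable) hφ

variable [IsFiniteMeasure μ] [IsFiniteMeasure ν] {F : H10 Ω → ℝ≥0}

theorem QuasiRep.of_tendsto {u : ℕ → H10 Ω} {v : H10 Ω} {f : ℕ → Euc d → ℝ} {g : Euc d → ℝ}
    (h : ∀ n, QuasiRep μ ν (u n) (f n)) (hu : Tendsto u atTop (𝓝 v))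
    (hf : ∀ᵐ x : Ω ∂(mass μ ν), Tendsto (fun n => f n x) atTop (𝓝 (g x))) :
    QuasiRep μ ν v g := fun ε hε => by
  have hm := tendstoInMeasure_of_tendsto_ae (fun n => (h n).aestronglyMeasurable) hf
  have hm' := tendstoInMeasure_iff_norm.1 hm (ε / 2) (half_pos hε)
  have e1 := hm'.eventually_lt_const (ENNReal.ofReal_pos.2 (half_pos hε))
  have e2 := hu.eventually (Metric.ball_mem_nhds v (half_pos hε))
  obtain ⟨n, h1, h2⟩ := (e1.and e2).exists
  obtain ⟨φ, h3, h4⟩ := h n (ε / 2) (half_pos hε)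
  rw [dist_eq_norm] at h2
  refine ⟨φ, ?_, ?_⟩
  · calc ‖H10.ofTest φ - v‖ ≤ ‖H10.ofTest φ - u n‖ + ‖u n - v‖ := norm_sub_le_norm_sub_add_norm_sub ..
      _ < ε / 2 + ε / 2 := add_lt_add h3 h2
      _ = ε := add_halves ε
  · calc mass μ ν {x : Ω | ε < |φ x - g x|}
        ≤ mass μ ν ({x : Ω | ε / 2 < |φ x - f n x|} ∪ {x : Ω | ε / 2 ≤ ‖f n x - g x‖}) := by
          refine measure_mono fun x (hx : ε < |φ x - g x|) => ?_
          by_contra hcon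
          rw [Set.mem_union, not_or] at hcon
          have k1 : |φ x - f n x| ≤ ε / 2 := not_lt.1 hcon.1
          have k2 : |f n x - g x| < ε / 2 := not_le.1 hcon.2
          have := abs_sub_le (φ x) (f n x) (g x)
          linarith
      _ ≤ _ := measure_union_le _ _
      _ ≤ ENNReal.ofReal (ε / 2) + ENNReal.ofReal (ε / 2) := add_le_add h4 h1.le
      _ = ENNReal.ofReal ε := by
          rw [← ENNReal.ofReal_add (by positivity) (by positivity), add_halves]

/-- For every tolerance, the points whose ball means do not eventually stay that close to some
constant form a null set. So the means are Cauchy almost everywhere, and their limit inherits the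
estimate of `IsRepresented.exists_test_average_near`. -/
theorem IsRepresented.quasiRep_preciseRep (hF : IsRepresented μ ν F) (hd : 1 ≤ d)
    (hΩ : Bornology.IsBounded (Ω : Set (Euc d))) (u : H10 Ω) :
    QuasiRep μ ν u (preciseRep u) := by
  let A : Ω → ℝ → ℝ := fun x r => ⨍ y in Metric.ball (x : Euc d) r ∩ Ω, u.fn y
  let B : ℕ → Set Ω := fun n => {x | ¬ ∃ c : ℝ, ∀ᶠ r in 𝓝[>] 0, |A x r - c| ≤ 1 / ((n : ℝ) + 1)}
  have hB : ∀ n, mass μ ν (B n) = 0 := fun n => by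
    refine measure_eq_zero_of_le_ofReal (c := 1 / ((n : ℝ) + 1)) (by positivity) fun ε hε hεc => ?_
    obtain ⟨φ, -, h⟩ := hF.exists_test_average_near hd hΩ u hε
    refine le_trans (measure_mono fun x hx => ?_) h
    have hx : ¬ ∃ c : ℝ, ∀ᶠ r in 𝓝[>] 0, |A x r - c| ≤ 1 / ((n : ℝ) + 1) := hx
    exact fun h' => hx ⟨φ x, h'.mono fun r hr => hr.trans hεc⟩
  have hZ : ∀ᵐ x ∂(mass μ ν), ∃ l : ℝ, Tendsto (A x) (𝓝[>] 0) (𝓝 l) := by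
    filter_upwards [ae_all_iff.2 fun n => measure_eq_zero_iff_ae_notMem.1 (hB n)] with x hx
    rw [← cauchy_map_iff_exists_tendsto, Metric.cauchy_iff]
    refine ⟨inferInstance, fun ε hε => ?_⟩
    obtain ⟨n, hn⟩ := exists_nat_one_div_lt (half_pos hε)
    obtain ⟨c, hc⟩ := not_not.1 (hx n)
    refine ⟨Metric.closedBall c (1 / ((n : ℝ) + 1)), hc, fun a ha b hb => ?_⟩
    have h1 := dist_triangle_right a b c
    rw [Metric.mem_closedBall] at ha hb
    linarith
  intro ε hε
  obtain ⟨φ, h1, h2⟩ := hF.exists_test_average_near hd hΩ u hε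
  refine ⟨φ, h1, le_trans (measure_mono_ae ?_) h2⟩
  filter_upwards [hZ] with x hx (hx' : ε < |φ x - preciseRep u x|)
  change ¬ ∀ᶠ r : ℝ in 𝓝[>] 0, |A x r - φ x| ≤ ε
  intro hcon
  have hp : Tendsto (A x) (𝓝[>] 0) (𝓝 (preciseRep u x)) := by
    rw [preciseRep, dif_pos hx]
    exact hx.choose_spec
  have := le_of_tendsto (hp.sub_const (φ x)).abs hcon
  rw [abs_sub_comm] at this
  linarith

/-- Test functions `φ`, `ψ` approximating the two representatives are close in `H10 Ω`. Since `{c <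
φ - ψ}` is open and `c⁻¹ • (φ - ψ)` exceeds `1` there, its mass is small, and likewise with the
roles exchanged. -/
theorem IsRepresented.quasiRep_unique (hF : IsRepresented μ ν F) (hd : 1 ≤ d)
    (hΩ : Bornology.IsBounded (Ω : Set (Euc d))) {u : H10 Ω} {f g : Euc d → ℝ}
    (hf : QuasiRep μ ν u f) (hg : QuasiRep μ ν u g) : ∀ᵐ x : Ω ∂(mass μ ν), f x = g x := by
  have key : ∀ c : ℝ, 0 < c → mass μ ν {x : Ω | 3 * c < |f x - g x|} = 0 := by
    intro c hc
    refine measure_eq_zero_of_le_ofReal (c := 4 * c) (by positivity) fun ε hε hεc => ?_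
    obtain ⟨δ, hδ, h⟩ := hF.exists_mass_open_le hd hΩ (ε := ε / 4) (by positivity)
    -- Since `ε ≤ 4 * c`, also `η ≤ c`, so off four sets of mass at most `ε / 4` one gets `|f - g| ≤
    -- η + c + η ≤ 3 c`. The second bound puts `φ` and `ψ` within `c * δ` of each other.
    set η := min (ε / 4) (c * δ / 2) with hη
    have hη0 : 0 < η := lt_min (by positivity) (by positivity)
    obtain ⟨φ, p1, p2⟩ := hf η hη0
    obtain ⟨ψ, q1, q2⟩ := hg η hη0
    have hηc : η ≤ c := (min_le_left _ _).trans (by linarith)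
    have hηδ : η ≤ c * δ / 2 := min_le_right _ _
    have hηε : η ≤ ε / 4 := min_le_left _ _
    have hn : ‖H10.ofTest φ - H10.ofTest ψ‖ ≤ c * δ := by
      have := norm_sub_le_norm_sub_add_norm_sub (H10.ofTest φ) u (H10.ofTest ψ)
      rw [norm_sub_rev u] at this
      linarith
    have hop : ∀ χ : 𝓓(Ω, ℝ), ‖H10.ofTest χ‖ ≤ c * δ →
        mass μ ν {x : Ω | c < χ x} ≤ ENNReal.ofReal (ε / 4) := fun χ hχ => by
      refine h (c⁻¹ • H10.ofTest χ) {x | c < χ x} (isOpen_lt continuous_const χ.continuous) ?_ ?_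
      · filter_upwards [H10.fn_smul c⁻¹ (H10.ofTest χ), H10.ofTest_fn χ] with x h1 h2 (h3 : c < χ x)
        rw [h1, Pi.smul_apply, h2, smul_eq_mul, inv_mul_eq_div, one_le_div hc]
        exact h3.le
      · rw [map_smul, norm_smul, norm_inv, Real.norm_of_nonneg hc.le, inv_mul_eq_div,
          div_le_iff₀ hc, mul_comm]
        exact (H10.norm_gradL_le _).trans hχ
    have r1 := hop (φ - ψ) (by rwa [H10.ofTest_sub])
    have r2 := hop (ψ - φ) (by rwa [H10.ofTest_sub, norm_sub_rev])
    have hsub : {x : Ω | 3 * c < |f x - g x|} ⊆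
        ({x : Ω | η < |φ x - f x|} ∪ {x : Ω | η < |ψ x - g x|}) ∪
          ({x : Ω | c < (φ - ψ) x} ∪ {x : Ω | c < (ψ - φ) x}) := by
      intro x (hx : 3 * c < |f x - g x|)
      by_contra hcon
      simp only [Set.mem_union, not_or] at hcon
      obtain ⟨⟨k1, k2⟩, k3, k4⟩ := hcon
      have k1 : |φ x - f x| ≤ η := not_lt.1 k1
      have k2 : |ψ x - g x| ≤ η := not_lt.1 k2
      rw [abs_le] at k1 k2
      have k3 : φ x - ψ x ≤ c := not_lt.1 k3
      have k4 : ψ x - φ x ≤ c := not_lt.1 k4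
      refine absurd hx (not_lt.2 (abs_le.2 ?_))
      constructor <;> linarith [k1.1, k1.2, k2.1, k2.2]
    have hη4 : ENNReal.ofReal η ≤ ENNReal.ofReal (ε / 4) := ENNReal.ofReal_le_ofReal hηε
    calc _ ≤ _ := measure_mono hsub
      _ ≤ _ := (measure_union_le _ _).trans (add_le_add (measure_union_le _ _)
          (measure_union_le _ _))
      _ ≤ (ENNReal.ofReal (ε / 4) + ENNReal.ofReal (ε / 4)) +
          (ENNReal.ofReal (ε / 4) + ENNReal.ofReal (ε / 4)) :=
        add_le_add (add_le_add (p2.trans hη4) (q2.trans hη4)) (add_le_add r1 r2)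
      _ = ENNReal.ofReal ε := by
          rw [← ENNReal.ofReal_add (by positivity) (by positivity),
            ← ENNReal.ofReal_add (by positivity) (by positivity)]
          ring_nf
  filter_upwards [ae_all_iff.2 fun n : ℕ => measure_eq_zero_iff_ae_notMem.1
    (key (1 / ((n : ℝ) + 1)) (by positivity))] with x hx
  have hlim := (tendsto_one_div_add_atTop_nhds_zero_nat (𝕜 := ℝ)).const_mul 3
  rw [mul_zero] at hlim
  have := ge_of_tendsto' hlim fun n => not_lt.1 (hx n)
  exact sub_eq_zero.1 (abs_nonpos_iff.1 this)

theorem QuasiRep.comp {T : ℝ → ℝ} (hT : ContDiff ℝ ∞ T) (hT0 : T 0 = 0) {C : ℝ}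
    (hC : ∀ t, |deriv T t| ≤ C) {u w : H10 Ω} {f : Euc d → ℝ} (h : QuasiRep μ ν u f)
    (hw1 : w.fn =ᵐ[leb Ω] (fun x => T (u.fn x)))
    (hw2 : w.grad =ᵐ[leb Ω] (fun x => deriv T (u.fn x) • u.grad x)) :
    QuasiRep μ ν w (fun x => T (f x)) := by
  obtain ⟨φ, h1, h2⟩ := h.exists_seq
  obtain ⟨ns, hns, h3⟩ := H10.exists_comp_tendsto_of_fn hT hT0 hC h1 hw1 hw2
  refine QuasiRep.of_tendsto (fun n => QuasiRep.ofTest _) h3 ?_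
  filter_upwards [h2] with x hx
  exact (hT.continuous.tendsto _).comp (hx.comp hns.tendsto_atTop)

theorem QuasiRep.exists_trunc {u : H10 Ω} {f : Euc d → ℝ} (h : QuasiRep μ ν u f) {m : ℝ}
    (hm : 0 ≤ m) : ∃ w : H10 Ω, w.fn =ᵐ[leb Ω] (fun x => trunc m (u.fn x)) ∧
      w.grad =ᵐ[leb Ω] (fun x => ((if 0 < u.fn x + m then (1 : ℝ) else 0) -
        (if 0 < u.fn x - m then 1 else 0)) • u.grad x) ∧
      QuasiRep μ ν w (fun x => trunc m (f x)) := by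
  obtain ⟨C, hC⟩ := exists_deriv_smoothTrunc_le
  choose v hv1 hv2 using fun k => H10.exists_comp (smoothTrunc_contDiff m k)
    (smoothTrunc_zero hm k) (hC m k) u
  obtain ⟨w, hw1, hw2, hlim⟩ := H10.exists_comp_limit (fun k => smoothTrunc_contDiff m k)
    (smoothTrunc_zero hm) (hC m) (tendsto_smoothTrunc hm) (tendsto_deriv_smoothTrunc m) hv1 hv2
  refine ⟨w, hw1, hw2, ?_⟩
  exact QuasiRep.of_tendsto (fun k => h.comp (smoothTrunc_contDiff m k)
    (smoothTrunc_zero hm k) (hC m k) (hv1 k) (hv2 k)) hlim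
    (Eventually.of_forall fun x => tendsto_smoothTrunc hm (f x))

theorem smoothPos_zero_bounds (s : ℝ) : max s 0 - 2 ≤ smoothPos 0 s ∧ smoothPos 0 s ≤ max s 0 := by
  rcases le_or_gt s 0 with hs | hs
  · rw [smoothPos_of_nonpos hs, max_eq_right hs]
    norm_num
  · rw [max_eq_left hs.le, smoothPos]
    simp only [Nat.cast_zero, zero_add, one_mul]
    have h0 := Real.smoothTransition.nonneg (s - 1)
    have h1 := Real.smoothTransition.le_one (s - 1)
    refine ⟨?_, by nlinarith⟩
    rcases le_or_gt s 2 with h2 | h2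
    · nlinarith [mul_nonneg hs.le h0]
    · rw [Real.smoothTransition.one_of_one_le (by linarith)]
      linarith

theorem abs_smoothTrunc_zero_le {m : ℝ} (hm : 0 ≤ m) (t : ℝ) : |smoothTrunc m 0 t| ≤ m + 4 := by
  have h1 := smoothPos_zero_bounds (t + m)
  have h2 := smoothPos_zero_bounds (t - m)
  have h3 := smoothPos_zero_bounds m
  rw [max_eq_left hm] at h3
  rw [smoothTrunc, abs_le]
  have h4 : max (t - m) 0 ≤ max (t + m) 0 := max_le_max_right 0 (by linarith)
  have h5 : max (t + m) 0 ≤ max (t - m) 0 + 2 * m :=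
    max_le (by linarith [le_max_left (t - m) 0]) (by linarith [le_max_right (t - m) 0])
  constructor <;> linarith [h1.1, h1.2, h2.1, h2.2, h3.1, h3.2]

theorem smoothTrunc_zero_eq_self {m t : ℝ} (h1 : 2 < t + m) (h2 : t < m) (h3 : 2 < m) :
    smoothTrunc m 0 t = t ∧ deriv (smoothTrunc m 0) t = 1 := by
  constructor
  · rw [smoothTrunc, smoothPos_of_nonpos (t := t - m) (by linarith)]
    simp only [smoothPos, Nat.cast_zero, zero_add, one_mul]
    rw [Real.smoothTransition.one_of_one_le (by linarith),
      Real.smoothTransition.one_of_one_le (by linarith)]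
    ring
  · simp only [deriv_smoothTrunc, deriv_smoothPos, Nat.cast_zero, zero_add, one_mul]
    rw [Real.smoothTransition.one_of_one_le (by linarith),
      deriv_smoothTransition_of_one_lt (by linarith),
      Real.smoothTransition.zero_of_nonpos (by linarith),
      deriv_smoothTransition_of_neg (by linarith)]
    ring

/-- Compose an approximating sequence with a bounded smooth function `T` that is the identity on the
range of `u`. The limit in `H10 Ω` is still `u`. -/
theorem IsRepresented.exists_bounded_seq (hF : IsRepresented μ ν F) (hd : 1 ≤ d)
    (hΩ : Bornology.IsBounded (Ω : Set (Euc d))) {u : H10 Ω} {f : Euc d → ℝ}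
    (h : QuasiRep μ ν u f) (hu : u ∈ H10Bdd Ω) :
    ∃ (C : ℝ) (φ : ℕ → 𝓓(Ω, ℝ)), (∀ n x, |φ n x| ≤ C) ∧
      Tendsto (fun n => H10.ofTest (φ n)) atTop (𝓝 u) ∧
      ∀ᵐ x : Ω ∂(mass μ ν), Tendsto (fun n => φ n x) atTop (𝓝 (f x)) := by
  have hu' : MemLp u.fn ⊤ (leb Ω) := hu
  obtain ⟨b, hb⟩ : ∃ b : ℝ, ∀ᵐ x ∂(leb Ω), |u.fn x| ≤ b := by
    have hfin := hu'.2.ne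
    rw [eLpNorm_exponent_top] at hfin
    refine ⟨(eLpNormEssSup u.fn (leb Ω)).toReal, ?_⟩
    filter_upwards [ae_le_eLpNormEssSup (f := u.fn) (μ := leb Ω)] with x hx
    simpa using ENNReal.toReal_mono hfin hx
  -- `smoothPos 0` is the identity from `2` on; the margin `3` places the range of `u` where
  -- `smoothTrunc m 0` is the identity.
  set m : ℝ := |b| + 3 with hm
  have hm0 : 0 ≤ m := by positivity
  have hb' : ∀ᵐ x ∂(leb Ω), 2 < u.fn x + m ∧ u.fn x < m := hb.mono fun x hx => by
    have h1 := abs_le.1 (hx.trans (le_abs_self b))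
    constructor <;> linarith [h1.1, h1.2]
  have hm2 : 2 < m := by linarith [abs_nonneg b]
  obtain ⟨C, hC⟩ := exists_deriv_smoothTrunc_le
  have hw1 : u.fn =ᵐ[leb Ω] fun x => smoothTrunc m 0 (u.fn x) := hb'.mono fun x hx =>
    (smoothTrunc_zero_eq_self hx.1 hx.2 hm2).1.symm
  have hw2 : u.grad =ᵐ[leb Ω] fun x => deriv (smoothTrunc m 0) (u.fn x) • u.grad x :=
    hb'.mono fun x hx => by
      simp only [(smoothTrunc_zero_eq_self hx.1 hx.2 hm2).2, one_smul]
  obtain ⟨φ, h1, h2⟩ := h.exists_seq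
  obtain ⟨ns, hns, h3⟩ := H10.exists_comp_tendsto_of_fn (smoothTrunc_contDiff m 0)
    (smoothTrunc_zero hm0 0) (hC m 0) h1 hw1 hw2
  refine ⟨m + 4, _, fun n x => abs_smoothTrunc_zero_le hm0 _, h3, ?_⟩
  -- The bound on `u` holds only Lebesgue-a.e., so `T ∘ f = f` has to come from uniqueness: both
  -- represent `u`.
  have hq := hF.quasiRep_unique hd hΩ h (h.comp (smoothTrunc_contDiff m 0)
    (smoothTrunc_zero hm0 0) (hC m 0) hw1 hw2)
  filter_upwards [h2, hq] with x hx hx'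
  rw [hx']
  exact ((smoothTrunc_contDiff m 0).continuous.tendsto _).comp (hx.comp hns.tendsto_atTop)

end QuasiRep

/-! ### The representation formula, for bounded and then for general `u`. -/

section Representation

variable {Ω : Opens (Euc d)} {μ : Measure (Ω × Ω)} {ν : Measure Ω}

theorem aemeasurable_of_mass {f : Euc d → ℝ}
    (hf : AEStronglyMeasurable (fun x : Ω => f x) (mass μ ν)) :
    AEMeasurable (fun p : Ω × Ω => ‖f p.1 - f p.2‖ₑ ^ 2) μ ∧
      AEMeasurable (fun x : Ω => ‖f x‖ₑ ^ 2) ν := by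
  have h1 : AEStronglyMeasurable (fun x : Ω => f x) ν :=
    hf.mono_measure (Measure.le_add_right le_rfl)
  have h2 : AEStronglyMeasurable (fun x : Ω => f x) (μ.map Prod.fst) :=
    hf.mono_measure (Measure.le_add_left (Measure.le_add_right le_rfl))
  have h3 : AEStronglyMeasurable (fun x : Ω => f x) (μ.map Prod.snd) :=
    hf.mono_measure (Measure.le_add_left (Measure.le_add_left le_rfl))
  exact ⟨((h2.comp_measurable measurable_fst).sub (h3.comp_measurable measurable_snd)).enorm.pow_const
    _, h1.enorm.pow_const _⟩

theorem tendsto_dirichlet {u : ℕ → H10 Ω} {v : H10 Ω} (hu : Tendsto u atTop (𝓝 v)) :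
    Tendsto (fun n => dirichlet (u n)) atTop (𝓝 (dirichlet v)) := by
  simp only [H10.dirichlet_eq]
  exact ENNReal.tendsto_ofReal (((H10.gradL.continuous.tendsto v).comp hu).norm.pow 2)

theorem tendsto_enorm_sq {a : ℕ → ℝ} {b : ℝ} (h : Tendsto a atTop (𝓝 b)) :
    Tendsto (fun n => ‖a n‖ₑ ^ 2) atTop (𝓝 (‖b‖ₑ ^ 2)) :=
  ((ENNReal.continuous_pow 2).tendsto _).comp h.enorm

theorem enorm_sq_le {a C : ℝ} (h : |a| ≤ C) : ‖a‖ₑ ^ 2 ≤ ENNReal.ofReal C ^ 2 := by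
  rw [← ofReal_norm]
  exact pow_le_pow_left' (ENNReal.ofReal_le_ofReal h) 2

variable [IsFiniteMeasure μ] [IsFiniteMeasure ν] {F : H10 Ω → ℝ≥0}

theorem tendsto_formValue_of_bounded {f : ℕ → Euc d → ℝ} {g : Euc d → ℝ} {u : ℕ → H10 Ω}
    {v : H10 Ω} {C : ℝ} (hm : ∀ n, AEStronglyMeasurable (fun x : Ω => f n x) (mass μ ν))
    (hC : ∀ n, ∀ᵐ x : Ω ∂(mass μ ν), |f n x| ≤ C)
    (hf : ∀ᵐ x : Ω ∂(mass μ ν), Tendsto (fun n => f n x) atTop (𝓝 (g x)))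
    (hu : Tendsto u atTop (𝓝 v)) :
    Tendsto (fun n => formValue μ ν (f n) (u n)) atTop (𝓝 (formValue μ ν g v)) := by
  obtain ⟨hf1, hf2⟩ := ae_of_ae_mass hf
  refine Tendsto.add (Tendsto.add ?_ ?_) (tendsto_dirichlet hu)
  · refine tendsto_lintegral_of_dominated_convergence' (fun _ => ENNReal.ofReal (2 * C) ^ 2)
      (fun n => (aemeasurable_of_mass (hm n)).1) (fun n => ?_) ?_ ?_
    · filter_upwards [(ae_of_ae_mass (hC n)).2] with p hp
      refine enorm_sq_le ((abs_sub _ _).trans ?_)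
      linarith [hp.1, hp.2]
    · rw [lintegral_const]
      exact ENNReal.mul_ne_top (by finiteness) (measure_ne_top _ _)
    · filter_upwards [hf2] with p hp
      exact tendsto_enorm_sq (hp.1.sub hp.2)
  · refine tendsto_lintegral_of_dominated_convergence' (fun _ => ENNReal.ofReal C ^ 2)
      (fun n => (aemeasurable_of_mass (hm n)).2) (fun n => ?_) ?_ ?_
    · filter_upwards [(ae_of_ae_mass (hC n)).1] with x hx
      exact enorm_sq_le hx
    · rw [lintegral_const]
      exact ENNReal.mul_ne_top (by finiteness) (measure_ne_top _ _)
    · filter_upwards [hf1] with p hp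
      exact tendsto_enorm_sq hp

theorem le_of_lowerSemicontinuous (hF : LowerSemicontinuous F) {u : ℕ → H10 Ω} {v : H10 Ω}
    {a : ℝ≥0∞} (hu : Tendsto u atTop (𝓝 v))
    (ha : Tendsto (fun n => (F (u n) : ℝ≥0∞)) atTop (𝓝 a)) : (F v : ℝ≥0∞) ≤ a := by
  refine le_of_forall_lt fun c hc => ?_
  obtain ⟨b, hcb, hb⟩ := ENNReal.lt_iff_exists_nnreal_btwn.1 hc
  refine hcb.trans_le (ge_of_tendsto ha ?_)
  filter_upwards [hu.eventually (hF v b (by exact_mod_cast hb))] with n hn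
  exact_mod_cast hn.le

theorem ofTest_mem_H10Bdd (φ : 𝓓(Ω, ℝ)) : H10.ofTest φ ∈ H10Bdd Ω :=
  (memLp_congr_ae (H10.ofTest_fn φ)).2
    ((φ.continuous.memLp_of_hasCompactSupport φ.hasCompactSupport).restrict _)

theorem IsRepresented.le_formValue (hF : IsRepresented μ ν F) (hd : 1 ≤ d)
    (hΩ : Bornology.IsBounded (Ω : Set (Euc d))) {u : H10 Ω} {f : Euc d → ℝ}
    (h : QuasiRep μ ν u f) (hu : u ∈ H10Bdd Ω) : (F u : ℝ≥0∞) ≤ formValue μ ν f u := by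
  obtain ⟨C, φ, hC, hlim, hae⟩ := hF.exists_bounded_seq hd hΩ h hu
  refine le_of_lowerSemicontinuous hF.lsc hlim ?_
  simp only [hF.rep]
  exact tendsto_formValue_of_bounded (fun n => (QuasiRep.ofTest (φ n)).aestronglyMeasurable)
    (fun n => Eventually.of_forall fun x => hC n x) hae hlim

theorem parallelogram_of_isQuadraticOnBdd (hQ : IsQuadraticOnBdd F) {u h : H10 Ω}
    (hu : u ∈ H10Bdd Ω) (hh : h ∈ H10Bdd Ω) :
    F (u + h) + F (u - h) = 2 * F u + 2 * F h := by
  obtain ⟨B, hB⟩ := hQ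
  have h1 := hB (⟨u, hu⟩ + ⟨h, hh⟩)
  have h2 := hB (⟨u, hu⟩ - ⟨h, hh⟩)
  have h3 := hB ⟨u, hu⟩
  have h4 := hB ⟨h, hh⟩
  rw [← NNReal.coe_inj]
  push_cast
  simp only [Submodule.coe_add, Submodule.coe_sub] at h1 h2
  rw [h1, h2, h3, h4]
  simp only [map_add, map_sub, LinearMap.add_apply, LinearMap.sub_apply]
  ring

/-- For the lower bound, the parallelogram law reads `F (φ n) + F (2u - φ n) = 2 F u + 2 F (φ n -
u)`. The inequality already proved, applied to `φ n - u`, shows that `F (φ n - u)` tends to `0`.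
Lower semicontinuity gives `F (2u - φ n) ≥ F u - ε` eventually. Hence the limit of `F (φ n)`, which
is the form value, is at most `F u`. -/
theorem IsRepresented.eq_formValue_of_bounded (hF : IsRepresented μ ν F) (hd : 1 ≤ d)
    (hΩ : Bornology.IsBounded (Ω : Set (Euc d))) (hQ : IsQuadraticOnBdd F) {u : H10 Ω}
    {f : Euc d → ℝ} (h : QuasiRep μ ν u f) (hu : u ∈ H10Bdd Ω) :
    (F u : ℝ≥0∞) = formValue μ ν f u := by
  refine le_antisymm (hF.le_formValue hd hΩ h hu) ?_
  obtain ⟨C, φ, hC, hlim, hae⟩ := hF.exists_bounded_seq hd hΩ h hu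
  have hfC : ∀ᵐ x : Ω ∂(mass μ ν), |f x| ≤ C := hae.mono fun x hx =>
    le_of_tendsto' hx.abs fun n => hC n x
  have hG : Tendsto (fun n => (F (H10.ofTest (φ n)) : ℝ≥0∞)) atTop (𝓝 (formValue μ ν f u)) := by
    simp only [hF.rep]
    exact tendsto_formValue_of_bounded (fun n => (QuasiRep.ofTest (φ n)).aestronglyMeasurable)
      (fun n => Eventually.of_forall fun x => hC n x) hae hlim
  have hsubB : ∀ n, H10.ofTest (φ n) - u ∈ H10Bdd Ω := fun n =>
    Submodule.sub_mem _ (ofTest_mem_H10Bdd _) hu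
  have hdiff : Tendsto (fun n => (F (H10.ofTest (φ n) - u) : ℝ≥0∞)) atTop (𝓝 0) := by
    have h0 : formValue μ ν (fun _ => 0) (0 : H10 Ω) = 0 := by
      simp [formValue, H10.dirichlet_eq]
    have h1 := tendsto_formValue_of_bounded (μ := μ) (ν := ν) (f := fun n x => φ n x - f x)
      (g := fun _ => 0) (u := fun n => H10.ofTest (φ n) - u) (v := 0) (C := C + C)
      (fun n => (h.sub_test (φ n)).aestronglyMeasurable)
      (fun n => hfC.mono fun x hx => (abs_sub _ _).trans (add_le_add (hC n x) hx))
      (hae.mono fun x hx => by simpa using hx.sub_const (f x))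
      (by simpa using hlim.sub_const u)
    rw [h0] at h1
    exact tendsto_of_tendsto_of_tendsto_of_le_of_le tendsto_const_nhds h1 (fun _ => zero_le)
      fun n => hF.le_formValue hd hΩ (h.sub_test (φ n)) (hsubB n)
  -- The reflections `2u - φ n` of the approximants through `u`.
  have hrefl : Tendsto (fun n => u - (H10.ofTest (φ n) - u)) atTop (𝓝 u) := by
    simpa using (hlim.sub_const u).const_sub u
  refine ENNReal.le_of_forall_pos_le_add fun ε hε _ => ?_
  have hub : Tendsto (fun n => (F u : ℝ≥0∞) + 2 * (F (H10.ofTest (φ n) - u) : ℝ≥0∞) + ε) atTop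
      (𝓝 ((F u : ℝ≥0∞) + ε)) := by
    have h1 := ENNReal.Tendsto.const_mul (a := 2) hdiff (Or.inr (by finiteness))
    simpa using (h1.const_add (F u : ℝ≥0∞)).add_const (ε : ℝ≥0∞)
  refine le_of_tendsto_of_tendsto hG hub ?_
  have hlow : ∀ᶠ n in atTop, F u ≤ F (u - (H10.ofTest (φ n) - u)) + ε := by
    rcases le_or_gt (F u) ε with hle | hlt
    · exact Eventually.of_forall fun n => hle.trans le_add_self
    · have h1 : F u - ε < F u := tsub_lt_self (hε.trans hlt) hε
      filter_upwards [hrefl.eventually (hF.lsc u _ h1)] with n hn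
      exact tsub_le_iff_right.1 hn.le
  filter_upwards [hlow] with n hn
  have hp := parallelogram_of_isQuadraticOnBdd hQ hu (hsubB n)
  rw [add_sub_cancel] at hp
  have key : F (H10.ofTest (φ n)) ≤ F u + 2 * F (H10.ofTest (φ n) - u) + ε := by
    rw [← NNReal.coe_le_coe] at hn ⊢
    rw [← NNReal.coe_inj] at hp
    push_cast at hp hn ⊢
    linarith
  exact_mod_cast key

theorem abs_trunc_sub_le (m a b : ℝ) : |trunc m a - trunc m b| ≤ |a - b| := by
  have h1 := abs_max_sub_max_le_abs (min m a) (min m b) (-m)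
  have h2 := abs_min_sub_min_le_max m a m b
  simp only [sub_self, abs_zero] at h2
  rw [max_eq_right (abs_nonneg _)] at h2
  exact h1.trans h2

theorem trunc_trunc {m m' : ℝ} (h : m ≤ m') (hm : 0 ≤ m) (a : ℝ) :
    trunc m (trunc m' a) = trunc m a := by
  simp only [trunc, max_def, min_def]
  split_ifs <;> linarith

theorem trunc_eq_self {m t : ℝ} (h : |t| ≤ m) : trunc m t = t := by
  rw [abs_le] at h
  rw [trunc, min_eq_right h.2, max_eq_left h.1]

theorem abs_trunc_le {m : ℝ} (hm : 0 ≤ m) (t : ℝ) : |trunc m t| ≤ m :=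
  abs_le.2 ⟨le_max_right _ _, max_le (min_le_left _ _) (by linarith)⟩

/-- A coarser truncation factors through a finer one and is 1-Lipschitz. Monotone convergence
therefore applies to the truncated form without any prior finiteness. -/
theorem monotone_abs_trunc_sub (a b : ℝ) : Monotone fun m : ℕ => |trunc m a - trunc m b| := by
  intro m m' h
  have h' : (m : ℝ) ≤ m' := by exact_mod_cast h
  simp only
  rw [← trunc_trunc h' m.cast_nonneg a, ← trunc_trunc h' m.cast_nonneg b]
  exact abs_trunc_sub_le _ _ _

theorem eventually_abs_lt_natCast (t : ℝ) : ∀ᶠ m : ℕ in atTop, |t| < m :=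
  tendsto_natCast_atTop_atTop.eventually_gt_atTop |t|

theorem tendsto_trunc (t : ℝ) : Tendsto (fun m : ℕ => trunc m t) atTop (𝓝 t) := by
  refine tendsto_const_nhds.congr' ?_
  filter_upwards [eventually_abs_lt_natCast t] with m hm
  rw [trunc_eq_self hm.le]

theorem tendsto_formValue_trunc {f : Euc d → ℝ} {u : ℕ → H10 Ω} {v : H10 Ω}
    (hm : ∀ m : ℕ, AEStronglyMeasurable (fun x : Ω => trunc m (f x)) (mass μ ν))
    (hu : Tendsto u atTop (𝓝 v)) :
    Tendsto (fun m : ℕ => formValue μ ν (fun x => trunc m (f x)) (u m)) atTop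
      (𝓝 (formValue μ ν f v)) := by
  have hmono : ∀ a b : ℝ, Monotone fun m : ℕ => ‖trunc m a - trunc m b‖ₑ ^ 2 :=
    fun a b m m' h => pow_le_pow_left' (by
      rw [← ofReal_norm, ← ofReal_norm]
      exact ENNReal.ofReal_le_ofReal (monotone_abs_trunc_sub a b h)) 2
  have hpt : ∀ a b : ℝ, Tendsto (fun m : ℕ => ‖trunc m a - trunc m b‖ₑ ^ 2) atTop
      (𝓝 (‖a - b‖ₑ ^ 2)) := fun a b =>
    tendsto_enorm_sq ((tendsto_trunc a).sub (tendsto_trunc b))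
  have h0 : ∀ m : ℕ, trunc m 0 = 0 := fun m => trunc_eq_self (by simp)
  refine Tendsto.add (Tendsto.add ?_ ?_) (tendsto_dirichlet hu)
  · exact lintegral_tendsto_of_tendsto_of_monotone
      (f := fun (m : ℕ) (p : Ω × Ω) => ‖trunc m (f p.1) - trunc m (f p.2)‖ₑ ^ 2)
      (F := fun p : Ω × Ω => ‖f p.1 - f p.2‖ₑ ^ 2)
      (fun m => (aemeasurable_of_mass (f := fun x => trunc m (f x)) (hm m)).1)
      (Eventually.of_forall fun p => hmono (f p.1) (f p.2))
      (Eventually.of_forall fun p => hpt (f p.1) (f p.2))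
  · refine lintegral_tendsto_of_tendsto_of_monotone
      (f := fun (m : ℕ) (x : Ω) => ‖trunc m (f x)‖ₑ ^ 2) (F := fun x : Ω => ‖f x‖ₑ ^ 2)
      (fun m => (aemeasurable_of_mass (f := fun x => trunc m (f x)) (hm m)).2)
      (Eventually.of_forall fun x => ?_) (Eventually.of_forall fun x => ?_)
    · simpa [h0] using hmono (f x) 0
    · exact tendsto_enorm_sq (tendsto_trunc (f x))

theorem tendsto_of_trunc {u : H10 Ω} {w : ℕ → H10 Ω}
    (hw1 : ∀ m : ℕ, (w m).fn =ᵐ[leb Ω] fun x => trunc m (u.fn x))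
    (hw2 : ∀ m : ℕ, (w m).grad =ᵐ[leb Ω] fun x => ((if 0 < u.fn x + m then (1 : ℝ) else 0) -
        (if 0 < u.fn x - m then 1 else 0)) • u.grad x) : Tendsto w atTop (𝓝 u) := by
  refine H10.tendsto_of_tendsto_eLpNorm ?_ ?_
  · refine tendsto_eLpNorm_two_of_dominated (b := fun x => 2 * ‖u.fn x‖)
      ((H10.fn_memLp u).norm.const_mul 2) (fun m => (H10.fn_memLp _).1.sub (H10.fn_memLp u).1)
      (fun m => ?_) ?_
    · filter_upwards [hw1 m] with x hx
      rw [Pi.sub_apply, hx]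
      refine (norm_sub_le _ _).trans ?_
      have h1 := abs_trunc_sub_le m (u.fn x) 0
      rw [trunc_eq_self (t := 0) (by simp), sub_zero, sub_zero] at h1
      simp only [Real.norm_eq_abs]
      linarith
    · filter_upwards [ae_all_iff.2 hw1] with x hx
      simp only [Pi.sub_apply, hx]
      simpa using (tendsto_trunc (u.fn x)).sub_const (u.fn x)
  · refine tendsto_eLpNorm_two_of_dominated (b := fun x => 3 * ‖u.grad x‖)
      ((H10.grad_memLp u).norm.const_mul 3)
      (fun m => (H10.grad_memLp _).1.sub (H10.grad_memLp u).1) (fun m => ?_) ?_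
    · filter_upwards [hw2 m] with x hx
      rw [Pi.sub_apply, hx]
      refine (norm_sub_le _ _).trans ?_
      rw [norm_smul]
      have : ‖(if 0 < u.fn x + m then (1 : ℝ) else 0) - (if 0 < u.fn x - m then 1 else 0)‖ ≤ 2 := by
        split_ifs <;> norm_num
      nlinarith [mul_le_mul_of_nonneg_right this (norm_nonneg (u.grad x))]
    · filter_upwards [ae_all_iff.2 hw2] with x hx
      refine tendsto_const_nhds.congr' ?_
      filter_upwards [eventually_abs_lt_natCast (u.fn x)] with m hm
      rw [abs_lt] at hm
      rw [Pi.sub_apply, hx, if_pos (by linarith), if_neg (by linarith)]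
      simp

/-- The values of `F` at the truncations converge to the form value of `u`. Lower semicontinuity
makes this limit at least `F u`, and decrease under truncation makes it at most `F u`. -/
theorem IsRepresented.eq_formValue (hF : IsRepresented μ ν F) (hd : 1 ≤ d)
    (hΩ : Bornology.IsBounded (Ω : Set (Euc d))) (hQ : IsQuadraticOnBdd F)
    (hT : DecreasesUnderTruncation F) {u : H10 Ω} {f : Euc d → ℝ} (h : QuasiRep μ ν u f) :
    (F u : ℝ≥0∞) = formValue μ ν f u := by
  choose w hw1 hw2 hw3 using fun m : ℕ => h.exists_trunc (m := m) m.cast_nonneg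
  have hlim := tendsto_of_trunc hw1 hw2
  have hwB : ∀ m, w m ∈ H10Bdd Ω := fun m => by
    refine memLp_top_of_bound (H10.fn_memLp (w m)).1 m ?_
    filter_upwards [hw1 m] with x hx
    rw [hx]
    exact abs_trunc_le m.cast_nonneg _
  have hval : ∀ m, (F (w m) : ℝ≥0∞) = formValue μ ν (fun x => trunc m (f x)) (w m) := fun m =>
    hF.eq_formValue_of_bounded hd hΩ hQ (hw3 m) (hwB m)
  have hconv : Tendsto (fun m => (F (w m) : ℝ≥0∞)) atTop (𝓝 (formValue μ ν f u)) := by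
    simp only [hval]
    exact tendsto_formValue_trunc (fun m => (hw3 m).aestronglyMeasurable) hlim
  refine le_antisymm (le_of_lowerSemicontinuous hF.lsc hlim hconv) (le_of_tendsto' hconv fun m => ?_)
  exact_mod_cast hT u (w m) m (hw1 m)

/-- Sets of zero capacity have zero mass, so altering the precise representative on one is harmless.
-/
theorem IsRepresented.quasiRep_of_quasiEq (hF : IsRepresented μ ν F) (hd : 1 ≤ d)
    (hΩ : Bornology.IsBounded (Ω : Set (Euc d))) {u : H10 Ω} {v : Euc d → ℝ}
    (hv : QuasiEq Ω v (preciseRep u)) : QuasiRep μ ν u v := by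
  refine (hF.quasiRep_preciseRep hd hΩ u).congr ?_
  filter_upwards [measure_eq_zero_iff_ae_notMem.1 (hF.mass_eq_zero hd hΩ hv)] with x hx
  by_contra hne
  exact hx ⟨x.2, fun h => hne h.symm⟩

theorem lowerSemicontinuous_of_weaklyLSC (h : WeaklyLSC F) : LowerSemicontinuous F :=
  fun u c hc => (toWeakSpaceCLM ℝ (H10 Ω)).continuous.continuousAt.eventually
    (h (toWeakSpaceCLM ℝ (H10 Ω) u) c hc)

end Representation

end NonlocalForms

end

theorem mainTheorem6 {d : ℕ} (hd : 1 ≤ d) (Ω : Opens (NonlocalForms.Euc d))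
    (hΩc : IsConnected (Ω : Set (NonlocalForms.Euc d)))
    (hΩb : Bornology.IsBounded (Ω : Set (NonlocalForms.Euc d)))
    (F : NonlocalForms.H10 Ω → ℝ≥0)
    (μ : Measure (Ω × Ω)) (ν : Measure Ω) [IsFiniteMeasure μ] [IsFiniteMeasure ν]
    (hrep : ∀ φ : 𝓓(Ω, ℝ), (F (NonlocalForms.H10.ofTest φ) : ℝ≥0∞) =
      NonlocalForms.formValue μ ν φ (NonlocalForms.H10.ofTest φ))
    (hsymm : ∀ A B : Set Ω, MeasurableSet A → MeasurableSet B → μ (A ×ˢ B) = μ (B ×ˢ A))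
    (hdiag : μ {p : Ω × Ω | p.1 = p.2} = 0)
    (hlsc : NonlocalForms.WeaklyLSC F)
    (M : ℝ) (hM : 0 < M)
    (hosc : ∀ φ : 𝓓(Ω, ℝ), (F (NonlocalForms.H10.ofTest φ) : ℝ≥0∞) ≤
      ENNReal.ofReal (M * NonlocalForms.osc Ω φ ^ 2) +
        NonlocalForms.dirichlet (NonlocalForms.H10.ofTest φ)) :
    (∀ B : Set Ω, MeasurableSet B → NonlocalForms.capacity Ω (Subtype.val '' B) = 0 →
      μ (B ×ˢ Set.univ) = 0 ∧ ν B = 0) ∧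
    (NonlocalForms.IsQuadraticOnBdd F →
      (∀ u ∈ NonlocalForms.H10Bdd Ω, ∀ v : NonlocalForms.Euc d → ℝ,
        NonlocalForms.QuasiEq Ω v (NonlocalForms.preciseRep u) →
        (F u : ℝ≥0∞) = NonlocalForms.formValue μ ν v u) ∧
      (NonlocalForms.DecreasesUnderTruncation F →
        ∀ u : NonlocalForms.H10 Ω, ∀ v : NonlocalForms.Euc d → ℝ,
          NonlocalForms.QuasiEq Ω v (NonlocalForms.preciseRep u) →
          (F u : ℝ≥0∞) = NonlocalForms.formValue μ ν v u)) := by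
  have hF : NonlocalForms.IsRepresented μ ν F :=
    ⟨NonlocalForms.lowerSemicontinuous_of_weaklyLSC hlsc, hrep, hdiag⟩
  refine ⟨fun B hB hcap => ?_, fun hQ => ⟨fun u hu v hv => ?_, fun hT u v hv => ?_⟩⟩
  · have h := hF.mass_eq_zero hd hΩb hcap
    have hB' : {x : Ω | (x : NonlocalForms.Euc d) ∈ Subtype.val '' B} = B := by
      ext x; simp
    rw [hB', NonlocalForms.mass, Measure.add_apply, Measure.add_apply, add_eq_zero, add_eq_zero,
      Measure.map_apply measurable_fst hB] at h
    rw [Set.prod_univ]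
    exact ⟨h.2.1, h.1⟩
  · exact hF.eq_formValue_of_bounded hd hΩb hQ (hF.quasiRep_of_quasiEq hd hΩb hv) hu
  · exact hF.eq_formValue hd hΩb hQ hT (hF.quasiRep_of_quasiEq hd hΩb hv)
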